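/- Let $K\in\mathbb R^{N\times N}$ be symmetric and let $G_K=([N],E)$, $|E|=m$, be the graph in which distinct $i,j$ are joined iff $K_{i,j}\neq0$. Assume that $G_K$ is chordal (every induced cycle has length three). Write $\Delta_S=\det K_S$, and let numbers $\hat\Delta_S$ be given for $1\le|S|\le3$. For a triangle $\{a,b,c\}$ put $\hat K_{x,x}=\hat\Delta_{\{x\}}$, $\hat B_{x,y}=\hat K_{x,x}\hat K_{y,y}-\hat\Delta_{\{x,y\}}$ and $$\hat C_{\{a,b,c\}}=\hat\Delta_{\{a,b,c\}}-\big(\hat K_{a,a}\hat K_{b,b}\hat K_{c,c}-\hat B_{a,b}\hat K_{c,c}-\hat B_{a,c}\hat K_{b,b}-\hat B_{b,c}\hat K_{a,a}\big).$$ **Algorithm.** Input: $G_K$ (as a list of its edges) and the numbers $\hat\Delta_S$, $1\le |S|\le 3$. 1. Compute a perfect elimination ordering $v_1,\dots,v_N$, i.e. an ordering in which every $v_i$ together with its neighbours $v_j$, $j>i$, forms a clique. 2. Compute the set $E'$ of the edges $\{v_i,v_{i^*}\}$ for all $i$ such that $v_i$ has a neighbour of larger index, where $i^*=\min\{j>i:\{v_i,v_j\}\in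 E\}$; put $G'=([N],E')$. 3. Give every edge of $E'$ positive sign. 4. Compute $\hat C_{\{v_i,v_j,v_{i^*}\}}$ for all $\{v_i,v_j\}\in E\setminus E'$, $i<j$. 5. Visit the edges $\{v_i,v_j\}$, $i<j$, of $E\setminus E'$ by decreasing $j$, and by decreasing $i$ among the edges with the same $j$, and set $$\operatorname{sgn}(\{v_i,v_j\})=\operatorname{sgn}\big(\hat C_{\{v_i,v_j,v_{i^*}\}}\big)\operatorname{sgn}(\{v_i,v_{i^*}\})\operatorname{sgn}(\{v_j,v_{i^*}\}).$$ **Theorem.** (a) (Running time.) The algorithm can be carried out in $O(m)$ time: there are one program for a random access machine with a real arithmetic unit and one absolute constant $c$ such that, for every symmetric $K$ (of any size) with $G_K$ chordal, every list of the edges of $G_K$ and all numbers $\hat\Delta_S$, the program halts after at most $c\,(m+1)$ steps with the results of all stages of an execution of the algorithm in its memory: the ordering, the set $E'$, the numbers $\hat C$, the order of the visits, and the signs of all edges. Here memory cells are initially zero apart from the input, integers can only be copied, compared and changed by one, any cell of a two-dimensional array and any $\hat\Delta_S$ can be accessed in one step, and each addition, subtraction, multiplication or comparison of reals takes one step. Isolated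 vertices come last in the ordering, in any order, and are not written down. (b) (Correctness.) Suppose moreover that $0\preceq K\preceq I_N$, that for some $\alpha\in(0,1)$ every off-diagonal entry of $K$ satisfies $K_{i,j}=0$ or $|K_{i,j}|\ge\alpha$, and that $|\hat\Delta_S-\Delta_S|\le(\alpha/4)^3$ whenever $1\le|S|\le3$ (in particular, the exact values $\hat\Delta_S=\Delta_S$ are allowed). Then, for every perfect elimination ordering used in step 1, $G'$ is a spanning forest of $G_K$ (acyclic, with the same connected components), and the computed signs are those of $K$ up to a $\mathcal D_N$-similarity: there are $d_1,\dots,d_N\in\{-1,1\}$ with $\operatorname{sgn}(\{a,b\})=d_ad_b\operatorname{sgn}(K_{a,b})$ for every edge $\{a,b\}$ of $G_K$. -/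

import Mathlib

namespace ChordalSigns

/-! ## Kernels, induced graphs, principal minors -/

/-- A kernel of a determinantal point process on `[N]`: a symmetric matrix with `0 ≼ K ≼ I`. -/
def IsKernel {N : ℕ} (K : Matrix (Fin N) (Fin N) ℝ) : Prop :=
  K.PosSemidef ∧ (1 - K).PosSemidef

/-- The graph induced by the symmetric matrix `K`: distinct `i`, `j` are joined iff `K i j ≠ 0`. -/
def inducedGraph {N : ℕ} (K : Matrix (Fin N) (Fin N) ℝ) : SimpleGraph (Fin N) :=
  SimpleGraph.fromRel fun i j => K i j ≠ 0

/-- The principal minor `Δ_S = det K_S`. -/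
noncomputable def principalMinor {N : ℕ} (K : Matrix (Fin N) (Fin N) ℝ)
    (S : Finset (Fin N)) : ℝ :=
  (K.submatrix (fun x : S => (x : Fin N)) (fun x : S => (x : Fin N))).det

/-- Separation: every off-diagonal entry is zero or at least `α` in absolute value. -/
def Separated {N : ℕ} (K : Matrix (Fin N) (Fin N) ℝ) (α : ℝ) : Prop :=
  ∀ i j, i ≠ j → K i j = 0 ∨ α ≤ |K i j|

/-- The given numbers `Δ S` estimate the principal minors of size one, two and three of `K`
to within `(α / 4) ^ 3`. -/
def Accurate {N : ℕ} (K : Matrix (Fin N) (Fin N) ℝ) (α : ℝ) (Δ : Finset (Fin N) → ℝ) : Prop :=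
  ∀ S : Finset (Fin N), 1 ≤ S.card → S.card ≤ 3 → |Δ S - principalMinor K S| ≤ (α / 4) ^ 3

/-! ## Chordal graphs, perfect elimination orderings, spanning forests -/

/-- Every induced cycle has length three. -/
def IsChordal {V : Type*} (G : SimpleGraph V) : Prop :=
  ∀ n : ℕ, 3 ≤ n → Nonempty (SimpleGraph.cycleGraph n ↪g G) → n = 3

/-- The ordering `v 0, v 1, …` of the vertices is a perfect elimination ordering: every vertex
forms a clique with its neighbours that come later. -/
def IsPEO {N : ℕ} (G : SimpleGraph (Fin N)) (v : Fin N ≃ Fin N) : Prop :=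
  ∀ i, G.IsClique ({v i} ∪ {w | ∃ j, i < j ∧ w = v j ∧ G.Adj (v i) (v j)})

open scoped Classical in
/-- The positions of the later neighbours of the `i`-th vertex. -/
noncomputable def later {N : ℕ} (G : SimpleGraph (Fin N)) (v : Fin N ≃ Fin N) (i : Fin N) :
    Finset (Fin N) :=
  Finset.univ.filter fun j => i < j ∧ G.Adj (v i) (v j)

open scoped Classical in
/-- `i* = min {j | j > i, {v_i, v_j} ∈ E}` (and `i` itself if there is no such `j`; this
value is never used). -/
noncomputable def star {N : ℕ} (G : SimpleGraph (Fin N)) (v : Fin N ≃ Fin N) (i : Fin N) :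
    Fin N :=
  if h : (later G v i).Nonempty then (later G v i).min' h else i

/-- `E'`: the edges `{v_i, v_{i*}}`, for all `i` for which `i*` exists. -/
def forestEdges {N : ℕ} (G : SimpleGraph (Fin N)) (v : Fin N ≃ Fin N) : Set (Sym2 (Fin N)) :=
  {x | ∃ i, (later G v i).Nonempty ∧ x = s(v i, v (star G v i))}

/-- `F` is a spanning forest of `G`: an acyclic subgraph on the same vertices with the same
connected components. -/
def IsSpanningForest {V : Type*} (F G : SimpleGraph V) : Prop :=
  F ≤ G ∧ F.IsAcyclic ∧ ∀ a b, G.Reachable a b → F.Reachable a b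

/-! ## The algorithm -/

/-- The quantity `Ĉ_{a,b,c}` for a triangle `a, b, c`: the estimated minor `Δ̂_{abc}`
minus the sum `∑_M (-1)^|M| ∏_{xy ∈ M} B̂_{xy} ∏_{x ∉ V(M)} K̂_{xx}` over the four matchings `M`
of the triangle, where `K̂_{xx} = Δ̂_x` and `B̂_{xy} = K̂_{xx} K̂_{yy} - Δ̂_{xy}`. -/
def triangleStat {N : ℕ} (Δ : Finset (Fin N) → ℝ) (a b c : Fin N) : ℝ :=
  let Kd : Fin N → ℝ := fun x => Δ {x}
  let B : Fin N → Fin N → ℝ := fun x y => Kd x * Kd y - Δ {x, y}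
  Δ {a, b, c} - (Kd a * Kd b * Kd c - B a b * Kd c - B a c * Kd b - B b c * Kd a)

/-- `L` lists the edges `{v_i, v_j}` of `E \ E'`, `i < j`, each one once, as pairs `(i, j)` of
positions, by decreasing larger endpoint `j`, and by decreasing smaller endpoint `i` among the
edges with the same larger endpoint. -/
def IsVisitOrder {N : ℕ} (G : SimpleGraph (Fin N)) (v : Fin N ≃ Fin N)
    (L : List (Fin N × Fin N)) : Prop :=
  (∀ i j, (i, j) ∈ L ↔ i < j ∧ G.Adj (v i) (v j) ∧ s(v i, v j) ∉ forestEdges G v) ∧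
  L.Pairwise fun p q => q.2 < p.2 ∨ (q.2 = p.2 ∧ q.1 < p.1)

open scoped Classical in
/-- The edges in `E'` get positive sign. The value `0` stands for "not set yet". -/
noncomputable def initSigns {N : ℕ} (G : SimpleGraph (Fin N)) (v : Fin N ≃ Fin N) :
    Sym2 (Fin N) → SignType :=
  fun x => if x ∈ forestEdges G v then 1 else 0

open scoped Classical in
/-- One visit: the edge at positions `p = (i, j)` gets the sign
`sgn Ĉ_{i,j,i*} · sgn {i,i*} · sgn {j,i*}`. -/
noncomputable def visit {N : ℕ} (G : SimpleGraph (Fin N)) (v : Fin N ≃ Fin N)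
    (Δ : Finset (Fin N) → ℝ) (σ : Sym2 (Fin N) → SignType) (p : Fin N × Fin N) :
    Sym2 (Fin N) → SignType :=
  Function.update σ s(v p.1, v p.2)
    (SignType.sign (triangleStat Δ (v p.1) (v p.2) (v (star G v p.1))) *
      σ s(v p.1, v (star G v p.1)) * σ s(v p.2, v (star G v p.1)))

/-- The signs computed by visiting the edges in the order `L`. -/
noncomputable def runSigns {N : ℕ} (G : SimpleGraph (Fin N)) (v : Fin N ≃ Fin N)
    (Δ : Finset (Fin N) → ℝ) (L : List (Fin N × Fin N)) : Sym2 (Fin N) → SignType :=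
  L.foldl (visit G v Δ) (initSigns G v)

/-- `σ` gives the signs of the edges of the graph induced by `K` up to a simultaneous change of
the signs of rows and columns: `σ_{ab} = d_a d_b sgn K_{ab}` on all edges, with `d = ±1`. -/
def SignsRecovered {N : ℕ} (K : Matrix (Fin N) (Fin N) ℝ) (σ : Sym2 (Fin N) → SignType) :
    Prop :=
  ∃ d : Fin N → ℤˣ, ∀ a b, (inducedGraph K).Adj a b →
    (σ s(a, b) : ℤ) = (d a : ℤ) * (d b : ℤ) * (SignType.sign (K a b) : ℤ)

/-! ## The machine model: a random access machine with a real arithmetic unit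

A program is a finite piece of syntax, in which finitely many integer and real variables and
finitely many (two-dimensional) integer and real arrays occur. All cells hold zero unless they
hold part of the input. Integers can only be copied, compared, and increased or decreased by one,
so a computation of `t` steps only meets integers that exceed those in its input and program by at
most `t`. Real numbers can be added, subtracted, multiplied and compared, but never converted to
integers. Each operation, memory access, table look-up, assignment and test takes one step. -/

/-- Integer expressions. Arrays have two indices. -/
inductive NExp where
  | const (n : ℕ)
  | var (x : ℕ)
  | arr (a : ℕ) (i j : NExp)
  | succ (e : NExp)
  | pred (e : NExp)

/-- Real expressions. `minor i j k` looks up the given estimate `Δ̂_{i,j,k}` in the input table;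
repeated indices give the estimates for sets of size one and two. -/
inductive RExp where
  | const (z : ℤ)
  | var (x : ℕ)
  | arr (a : ℕ) (i j : NExp)
  | minor (i j k : NExp)
  | add (e f : RExp)
  | sub (e f : RExp)
  | mul (e f : RExp)

/-- Tests. -/
inductive Test where
  | nlt (e f : NExp)
  | neq (e f : NExp)
  | rlt (e f : RExp)
  | neg (b : Test)
  | and (b c : Test)

/-- Programs. -/
inductive Prog where
  | skip
  | nset (x : ℕ) (e : NExp)
  | nstore (a : ℕ) (i j e : NExp)
  | rset (x : ℕ) (e : RExp)
  | rstore (a : ℕ) (i j : NExp) (e : RExp)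
  | seq (p q : Prog)
  | branch (b : Test) (p q : Prog)
  | loop (b : Test) (p : Prog)

/-- Memory: integer variables, integer arrays, real variables, real arrays. -/
structure Mem where
  nvar : ℕ → ℕ
  narr : ℕ → ℕ → ℕ → ℕ
  rvar : ℕ → ℝ
  rarr : ℕ → ℕ → ℕ → ℝ

def NExp.eval (s : Mem) : NExp → ℕ
  | .const n => n
  | .var x => s.nvar x
  | .arr a i j => s.narr a (i.eval s) (j.eval s)
  | .succ e => e.eval s + 1
  | .pred e => e.eval s - 1

/-- Number of steps of an evaluation. -/
def NExp.cost : NExp → ℕ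
  | .const _ => 1
  | .var _ => 1
  | .arr _ i j => i.cost + j.cost + 1
  | .succ e => e.cost + 1
  | .pred e => e.cost + 1

/-- `tab` is the input table of estimated minors. -/
def RExp.eval (tab : ℕ → ℕ → ℕ → ℝ) (s : Mem) : RExp → ℝ
  | .const z => z
  | .var x => s.rvar x
  | .arr a i j => s.rarr a (i.eval s) (j.eval s)
  | .minor i j k => tab (i.eval s) (j.eval s) (k.eval s)
  | .add e f => e.eval tab s + f.eval tab s
  | .sub e f => e.eval tab s - f.eval tab s
  | .mul e f => e.eval tab s * f.eval tab s

def RExp.cost : RExp → ℕ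
  | .const _ => 1
  | .var _ => 1
  | .arr _ i j => i.cost + j.cost + 1
  | .minor i j k => i.cost + j.cost + k.cost + 1
  | .add e f => e.cost + f.cost + 1
  | .sub e f => e.cost + f.cost + 1
  | .mul e f => e.cost + f.cost + 1

def Test.holds (tab : ℕ → ℕ → ℕ → ℝ) (s : Mem) : Test → Prop
  | .nlt e f => e.eval s < f.eval s
  | .neq e f => e.eval s = f.eval s
  | .rlt e f => e.eval tab s < f.eval tab s
  | .neg b => ¬ b.holds tab s
  | .and b c => b.holds tab s ∧ c.holds tab s

def Test.cost : Test → ℕ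
  | .nlt e f => e.cost + f.cost + 1
  | .neq e f => e.cost + f.cost + 1
  | .rlt e f => e.cost + f.cost + 1
  | .neg b => b.cost + 1
  | .and b c => b.cost + c.cost + 1

/-- `Exec tab p s t s'`: started in memory `s`, the program `p` halts after exactly `t` steps in
memory `s'`. -/
inductive Exec (tab : ℕ → ℕ → ℕ → ℝ) : Prog → Mem → ℕ → Mem → Prop where
  | skip (s : Mem) : Exec tab .skip s 1 s
  | nset (x : ℕ) (e : NExp) (s : Mem) :
      Exec tab (.nset x e) s (e.cost + 1)
        { s with nvar := Function.update s.nvar x (e.eval s) }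
  | nstore (a : ℕ) (i j e : NExp) (s : Mem) :
      Exec tab (.nstore a i j e) s (i.cost + j.cost + e.cost + 1)
        { s with narr := Function.update s.narr a (Function.update (s.narr a) (i.eval s)
            (Function.update (s.narr a (i.eval s)) (j.eval s) (e.eval s))) }
  | rset (x : ℕ) (e : RExp) (s : Mem) :
      Exec tab (.rset x e) s (e.cost + 1)
        { s with rvar := Function.update s.rvar x (e.eval tab s) }
  | rstore (a : ℕ) (i j : NExp) (e : RExp) (s : Mem) :
      Exec tab (.rstore a i j e) s (i.cost + j.cost + e.cost + 1)
        { s with rarr := Function.update s.rarr a (Function.update (s.rarr a) (i.eval s)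
            (Function.update (s.rarr a (i.eval s)) (j.eval s) (e.eval tab s))) }
  | seq {p q : Prog} {s s' s'' : Mem} {t t' : ℕ} :
      Exec tab p s t s' → Exec tab q s' t' s'' → Exec tab (.seq p q) s (t + t') s''
  | branch_true {b : Test} {p q : Prog} {s s' : Mem} {t : ℕ} :
      b.holds tab s → Exec tab p s t s' → Exec tab (.branch b p q) s (b.cost + 1 + t) s'
  | branch_false {b : Test} {p q : Prog} {s s' : Mem} {t : ℕ} :
      ¬ b.holds tab s → Exec tab q s t s' → Exec tab (.branch b p q) s (b.cost + 1 + t) s'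
  | loop_stop {b : Test} {p : Prog} {s : Mem} :
      ¬ b.holds tab s → Exec tab (.loop b p) s (b.cost + 1) s
  | loop_step {b : Test} {p : Prog} {s s' s'' : Mem} {t t' : ℕ} :
      b.holds tab s → Exec tab p s t s' → Exec tab (.loop b p) s' t' s'' →
      Exec tab (.loop b p) s (b.cost + 1 + t + t') s''

/-! ## Input and output conventions -/

/-- `e` lists the `m` edges of `G`, each exactly once, with its endpoints in either order. -/
def IsEdgeList {N m : ℕ} (G : SimpleGraph (Fin N)) (e : Fin m → Fin N × Fin N) : Prop :=
  (Function.Injective fun k => s((e k).1, (e k).2)) ∧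
  (Set.range fun k => s((e k).1, (e k).2)) = G.edgeSet

/-- The table of the estimates `Δ̂_S`, `1 ≤ |S| ≤ 3`. -/
def minorTable {N : ℕ} (Δ : Finset (Fin N) → ℝ) (i j k : ℕ) : ℝ :=
  if h : i < N ∧ j < N ∧ k < N then Δ {⟨i, h.1⟩, ⟨j, h.2.1⟩, ⟨k, h.2.2⟩} else 0

/-- Initial memory: `N` and `m` in the integer variables `0` and `1`, the two endpoints of the
`k`-th edge in the cells `(k, 0)` of the integer arrays `0` and `1`; all else is zero. -/
def initMem {N m : ℕ} (e : Fin m → Fin N × Fin N) : Mem where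
  nvar x := if x = 0 then N else if x = 1 then m else 0
  narr a k j :=
    if h : k < m then
      if a = 0 ∧ j = 0 then ((e ⟨k, h⟩).1 : ℕ)
      else if a = 1 ∧ j = 0 then ((e ⟨k, h⟩).2 : ℕ)
      else 0
    else 0
  rvar _ := 0
  rarr _ _ _ := 0

/-- The memory `s` holds the results of all stages of an execution of the algorithm with
perfect elimination ordering `v` and visiting order `L`:
* integer variable `2` holds the number of non-isolated vertices; these come first in `v`, and
  integer array `2` lists them in this order (isolated vertices follow in any order and are not
  written down);
* integer array `3` marks the edges of the spanning forest;
* integer variable `3` holds the number of edges outside the forest, integer array `4` lists their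
  indices in the order of the visits, and real array `0` holds the statistic `Ĉ` of each of them;
* real array `1` holds the signs of all edges. -/
def Holds {N m : ℕ} (s : Mem) (G : SimpleGraph (Fin N)) (e : Fin m → Fin N × Fin N)
    (Δ : Finset (Fin N) → ℝ) (v : Fin N ≃ Fin N) (L : List (Fin N × Fin N)) : Prop :=
  (∀ t : Fin N, (t : ℕ) < s.nvar 2 ↔ ∃ w, G.Adj (v t) w) ∧
  s.nvar 2 ≤ N ∧
  (∀ t : Fin N, (t : ℕ) < s.nvar 2 → s.narr 2 t 0 = (v t : ℕ)) ∧
  (∀ k : Fin m, (s((e k).1, (e k).2) ∈ forestEdges G v → s.narr 3 k 0 = 1) ∧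
    (s((e k).1, (e k).2) ∉ forestEdges G v → s.narr 3 k 0 = 0)) ∧
  s.nvar 3 = L.length ∧
  (∀ t : Fin L.length, ∃ k : Fin m, s.narr 4 t 0 = (k : ℕ) ∧
    s((e k).1, (e k).2) = s(v (L.get t).1, v (L.get t).2) ∧
    s.rarr 0 k 0 =
      triangleStat Δ (v (L.get t).1) (v (L.get t).2) (v (star G v (L.get t).1))) ∧
  (∀ k : Fin m, s.rarr 1 k 0 = (runSigns G v Δ L s((e k).1, (e k).2) : ℝ))

end ChordalSigns

/-! Correctness. For a kernel, subtracting the matching terms from a 3×3 principal minor leaves the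
two three-cycles, so the exact triangle statistic is `2 K_ab K_ac K_bc`. All entries are at most one
in absolute value, hence an error `ε` in the minors moves the statistic by at most `24 ε`. For `ε =
(α/4)^3` this is `3α³/8`, less than the guaranteed size `2α³`, so the sign survives
(`sign_triangleStat`). A vertex has at most one forest edge to a later vertex, which rules out
cycles. An edge `v_i v_j` outside the forest can be replaced by `v_i v_{i*}` and `v_{i*} v_j`, where
the second edge exists by the clique property; downward induction on `i` then gives connectedness.
On a forest all signs can be made positive by flipping vertices (`vertexSign`). After these flips,
the triangle on `i, j, i*` passes the correct sign to `v_i v_j`: the edge `v_i v_{i*}` is in the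
forest, and `v_{i*} v_j` is in the forest or was visited before, having the same larger endpoint and
a larger smaller endpoint (`IsVisitOrder.runSigns_eq`).

Running time. The ordering comes from maximum cardinality search: positions are filled from the last
to the first, each time by an unvisited vertex with the most visited neighbours. In a chordal graph
this yields a perfect elimination ordering (`MaxNbhdSearch.no_inducedPath`, `Found.isPEO`). There is
one stack per label. A relabelled vertex is pushed again and its old entry stays behind; whatever is
popped unvisited still has the largest label. The search gives the other data at no extra cost. The
last visited neighbour to touch a vertex `v_i` before its own visit is `v_{i*}`. Every vertex is
appended to the bucket of each later neighbour other than `v_{i*}`, so the buckets come out sorted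
by decreasing position, and reading them from the last position down is the required visiting order.
Isolated vertices are never touched. A potential that is linear in the degree sum `2m` drops at
every iteration (`Searching.step`), which bounds the search and also the total bucket size.
`Prog.exec_loop` converts potentials into step counts. -/

namespace ChordalSigns

/-! ## Loop-free programs and the loop rule -/

def Prog.LoopFree : Prog → Prop
  | .seq p q => p.LoopFree ∧ q.LoopFree
  | .branch _ p q => p.LoopFree ∧ q.LoopFree
  | .loop _ _ => False
  | _ => True

/-- An upper bound for the number of steps of a loop-free program. -/
def Prog.bound : Prog → ℕ
  | .skip => 1
  | .nset _ e => e.cost + 1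
  | .nstore _ i j e => i.cost + j.cost + e.cost + 1
  | .rset _ e => e.cost + 1
  | .rstore _ i j e => i.cost + j.cost + e.cost + 1
  | .seq p q => p.bound + q.bound
  -- Adding the branches instead of taking their maximum is wasteful but keeps the bound linear. The
  -- value at loops is a dummy, excluded by `LoopFree`.
  | .branch b p q => b.cost + 1 + (p.bound + q.bound)
  | .loop _ _ => 0

/-- Storing a value into a cell of a two-dimensional array. -/
def upd2 {α : Type*} (f : ℕ → ℕ → α) (i j : ℕ) (e : α) : ℕ → ℕ → α :=
  Function.update f i (Function.update (f i) j e)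

theorem upd2_apply {α : Type*} (f : ℕ → ℕ → α) (i j : ℕ) (e : α) (k l : ℕ) :
    upd2 f i j e k l = if k = i ∧ l = j then e else f k l := by
  unfold upd2
  by_cases hk : k = i
  · subst hk
    simp [Function.update_apply]
  · simp [hk]

open scoped Classical in
/-- The final memory of a loop-free program. -/
noncomputable def Prog.run (tab : ℕ → ℕ → ℕ → ℝ) : Prog → Mem → Mem
  | .skip, s => s
  | .nset x e, s => { s with nvar := Function.update s.nvar x (e.eval s) }
  | .nstore a i j e, s =>
      { s with narr := Function.update s.narr a (upd2 (s.narr a) (i.eval s) (j.eval s) (e.eval s)) }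
  | .rset x e, s => { s with rvar := Function.update s.rvar x (e.eval tab s) }
  | .rstore a i j e, s =>
      { s with
        rarr := Function.update s.rarr a (upd2 (s.rarr a) (i.eval s) (j.eval s) (e.eval tab s)) }
  | .seq p q, s => q.run tab (p.run tab s)
  | .branch b p q, s => if b.holds tab s then p.run tab s else q.run tab s
  | .loop _ _, s => s

theorem Prog.exec_run (tab : ℕ → ℕ → ℕ → ℝ) (p : Prog) (hp : p.LoopFree) (s : Mem) :
    ∃ t ≤ p.bound, Exec tab p s t (p.run tab s) := by
  induction p generalizing s with
  | skip => exact ⟨_, le_rfl, .skip s⟩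
  | nset x e => exact ⟨_, le_rfl, .nset x e s⟩
  | nstore a i j e => exact ⟨_, le_rfl, .nstore a i j e s⟩
  | rset x e => exact ⟨_, le_rfl, .rset x e s⟩
  | rstore a i j e => exact ⟨_, le_rfl, .rstore a i j e s⟩
  | seq p q ihp ihq =>
    obtain ⟨t, ht, h⟩ := ihp hp.1 s
    obtain ⟨t', ht', h'⟩ := ihq hp.2 (p.run tab s)
    exact ⟨t + t', add_le_add ht ht', .seq h h'⟩
  | branch b p q ihp ihq =>
    by_cases hb : b.holds tab s
    · obtain ⟨t, ht, h⟩ := ihp hp.1 s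
      refine ⟨b.cost + 1 + t, by simp only [Prog.bound]; omega, ?_⟩
      simpa only [Prog.run, if_pos hb] using Exec.branch_true hb h
    · obtain ⟨t, ht, h⟩ := ihq hp.2 s
      refine ⟨b.cost + 1 + t, by simp only [Prog.bound]; omega, ?_⟩
      simpa only [Prog.run, if_neg hb] using Exec.branch_false hb h
  | loop b p => exact hp.elim

/-- A loop with a loop-free body, an invariant `I` and a potential `Φ` that drops with every
iteration. -/
theorem Prog.exec_loop (tab : ℕ → ℕ → ℕ → ℝ) (b : Test) (p : Prog) (hp : p.LoopFree)
    (I : Mem → Prop) (Φ : Mem → ℕ)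
    (hI : ∀ s, I s → b.holds tab s → I (p.run tab s) ∧ Φ (p.run tab s) < Φ s)
    (s : Mem) (hs : I s) :
    ∃ t s', Exec tab (.loop b p) s t s' ∧ t ≤ (p.bound + b.cost + 1) * (Φ s + 1) ∧
      I s' ∧ ¬ b.holds tab s' := by
  induction hn : Φ s using Nat.strong_induction_on generalizing s with
  | _ n ih =>
    subst hn
    by_cases hb : b.holds tab s
    · obtain ⟨h1, h2⟩ := hI s hs hb
      obtain ⟨t, ht, h⟩ := p.exec_run tab hp s
      obtain ⟨t', s', h', ht', hI', hb'⟩ := ih _ h2 _ h1 rfl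
      refine ⟨_, s', .loop_step hb h h', ?_, hI', hb'⟩
      have : (p.bound + b.cost + 1) * (Φ (p.run tab s) + 1) ≤ (p.bound + b.cost + 1) * Φ s :=
        Nat.mul_le_mul_left _ h2
      rw [Nat.mul_succ]
      omega
    · have h : Exec tab (.loop b p) s (b.cost + 1) s := by
        constructor
        exact hb
      exact ⟨_, s, h, by nlinarith [Nat.zero_le (Φ s)], hs, hb⟩


/-! ## Maximum neighbourhood search on chordal graphs -/

theorem cycleGraph_adj_of_lt {j : ℕ} {u v : Fin (j + 2)} (h : u < v) :
    (SimpleGraph.cycleGraph (j + 2)).Adj u v ↔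
      (v : ℕ) = u + 1 ∨ ((u : ℕ) = 0 ∧ (v : ℕ) = j + 1) := by
  rw [SimpleGraph.cycleGraph_adj']
  -- Subtraction in `Fin` wraps around here; the result is `1` exactly when `u` is the first and `v`
  -- the last vertex.
  have h1 : ((u - v : Fin (j + 2)) : ℕ) = j + 2 - (v - u) := by
    rw [Fin.coe_sub_iff_lt.mpr h]
    omega
  have h2 : ((v - u : Fin (j + 2)) : ℕ) = v - u := Fin.sub_val_of_le h.le
  rw [h1, h2]
  have := v.2
  have : (u : ℕ) < v := h
  omega

/-- `p 0, …, p k` is an induced path. -/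
def InducedPath {V : Type*} (G : SimpleGraph V) (p : ℕ → V) (k : ℕ) : Prop :=
  ∀ i j, i < j → j ≤ k → p i ≠ p j ∧ (G.Adj (p i) (p j) ↔ j = i + 1)

theorem InducedPath.reverse {V : Type*} {G : SimpleGraph V} {p : ℕ → V} {k : ℕ}
    (h : InducedPath G p k) : InducedPath G (fun i => p (k - i)) k := by
  intro i j hij hj
  obtain ⟨h1, h2⟩ := h (k - j) (k - i) (by omega) (by omega)
  refine ⟨h1.symm, ?_⟩
  rw [G.adj_comm, h2]
  omega

theorem InducedPath.append {V : Type*} {G : SimpleGraph V} {p : ℕ → V} {k : ℕ} {d : V}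
    (h : InducedPath G p k) (hd : ∀ i ≤ k, p i ≠ d) (hadj : ∀ i ≤ k, G.Adj (p i) d ↔ i = k) :
    InducedPath G (fun i => if i ≤ k then p i else d) (k + 1) := by
  intro i j hij hj
  have hi : i ≤ k := by omega
  simp only [if_pos hi]
  split_ifs with hjk
  · exact h i j hij hjk
  · refine ⟨hd i hi, ?_⟩
    rw [hadj i hi]
    omega

/-- In a chordal graph, an induced path cannot be closed up to a longer cycle. -/
theorem InducedPath.not_closed {V : Type*} {G : SimpleGraph V} (hG : IsChordal G) {p : ℕ → V}
    {k : ℕ} (hk : 2 ≤ k) {d : V} (h : InducedPath G p k) (hd : ∀ i ≤ k, p i ≠ d)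
    (hadj : ∀ i ≤ k, G.Adj (p i) d ↔ i = 0 ∨ i = k) : False := by
  have key : ∀ u v : Fin (k + 2), u < v →
      (if (u : ℕ) ≤ k then p u else d) ≠ (if (v : ℕ) ≤ k then p v else d) ∧
      (G.Adj (if (u : ℕ) ≤ k then p u else d) (if (v : ℕ) ≤ k then p v else d) ↔
        (SimpleGraph.cycleGraph (k + 2)).Adj u v) := by
    intro u v huv
    have huv' : (u : ℕ) < v := huv
    have hu : (u : ℕ) ≤ k := by omega
    rw [cycleGraph_adj_of_lt huv, if_pos hu]
    split_ifs with hv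
    · refine ⟨(h u v huv' hv).1, ?_⟩
      rw [(h u v huv' hv).2]
      omega
    · refine ⟨hd _ hu, ?_⟩
      rw [hadj _ hu]
      omega
  have := hG (k + 2) (by omega) ⟨⟨⟨fun i => if (i : ℕ) ≤ k then p i else d, ?_⟩, ?_⟩⟩
  · omega
  · intro u v huv
    by_contra hne
    rcases lt_or_gt_of_ne hne with hlt | hlt
    · exact (key u v hlt).1 huv
    · exact (key v u hlt).1 huv.symm
  · intro u v
    rcases lt_trichotomy u v with hlt | rfl | hlt
    · exact (key u v hlt).2
    · simp
    · exact (G.adj_comm _ _).trans ((key v u hlt).2.trans (SimpleGraph.adj_comm _ _ _))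

/-- Vertices are searched by decreasing `pos`: a vertex `b` searched before `c` is preferred
because its searched neighbourhood is not strictly contained in that of `c`. -/
def MaxNbhdSearch {V : Type*} (G : SimpleGraph V) (pos : V → ℕ) : Prop :=
  ∀ a b c, pos c < pos b → pos b < pos a → G.Adj a c → ¬ G.Adj a b →
    ∃ d, pos b < pos d ∧ G.Adj d b ∧ ¬ G.Adj d c

/-- The induction pushes the lower end `p k` upwards. The search property for `p 0`, `p k`, `p 1`
gives a vertex `d` above `p k` that is adjacent to `p k` but not to `p 1`. Let `j ≥ 2` be the first
positive index with `p j` adjacent to `d`. If `d` is adjacent to `p 0`, then `p 0, …, p j, d` is an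
induced cycle of length at least four. Otherwise it is an induced path of the same kind, with both
ends above `p k`. -/
theorem MaxNbhdSearch.no_inducedPath {V : Type*} {G : SimpleGraph V} (hG : IsChordal G)
    {pos : V → ℕ} (hinj : Function.Injective pos) (hP : MaxNbhdSearch G pos) {N : ℕ}
    (hN : ∀ x, pos x < N) (n : ℕ) :
    ∀ (k : ℕ) (p : ℕ → V), 2 ≤ k → InducedPath G p k →
      (∀ i, 0 < i → i < k → pos (p i) < pos (p k)) → pos (p k) < pos (p 0) →
      N - pos (p k) = n → False := by
  induction n using Nat.strong_induction_on with
  | _ n ih =>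
    intro k p hk hp hint hends hn
    have h01 : G.Adj (p 0) (p 1) := ((hp 0 1 (by omega) (by omega)).2).2 rfl
    have h0k : ¬ G.Adj (p 0) (p k) := fun h => by
      have := ((hp 0 k (by omega) le_rfl).2).1 h
      omega
    obtain ⟨d, hd, hdk, hd1⟩ := hP (p 0) (p k) (p 1) (hint 1 (by omega) (by omega)) hends h01 h0k
    classical
    have hex : ∃ j, 1 ≤ j ∧ j ≤ k ∧ G.Adj d (p j) := ⟨k, by omega, le_rfl, hdk⟩
    obtain ⟨hj1, hjk, hdj⟩ := Nat.find_spec hex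
    have hmin := fun i => @Nat.find_min _ _ hex i
    generalize Nat.find hex = j at *
    have hj2 : 2 ≤ j := by
      rcases Nat.lt_or_ge j 2 with h | h
      · obtain rfl : j = 1 := by omega
        exact absurd hdj hd1
      · exact h
    have hne : ∀ i ≤ j, p i ≠ d := by
      rintro i hi rfl
      rcases Nat.eq_zero_or_pos i with rfl | hi0
      · exact hd1 h01
      · rcases Nat.lt_or_ge i k with hik | hik
        · exact absurd hd (by have := hint i hi0 hik; omega)
        · obtain rfl : i = k := by omega
          exact G.loopless.irrefl _ hdk
    have hpj : InducedPath G p j := fun i i' h h' => hp i i' h (h'.trans hjk)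
    have hadj : ∀ i ≤ j, 1 ≤ i → (G.Adj (p i) d ↔ i = j) := by
      intro i hi hi1
      constructor
      · intro h
        by_contra hij
        exact hmin i (by omega) ⟨hi1, by omega, h.symm⟩
      · rintro rfl
        exact hdj.symm
    by_cases hd0 : G.Adj (p 0) d
    · refine hpj.not_closed hG hj2 hne fun i hi => ?_
      rcases Nat.eq_zero_or_pos i with rfl | hi0
      · simp [hd0]
      · rw [hadj i hi hi0]
        omega
    · have hq := hpj.append hne (d := d) fun i hi => by
        rcases Nat.eq_zero_or_pos i with rfl | hi0
        · exact iff_of_false hd0 (by omega)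
        · exact hadj i hi hi0
      have hsmall : ∀ i, 0 < i → i ≤ j → pos (p i) ≤ pos (p k) := by
        intro i hi0 hij
        rcases Nat.lt_or_ge i k with hik | hik
        · exact (hint i hi0 hik).le
        · obtain rfl : i = k := by omega
          exact le_rfl
      have hNd := hN d
      have hN0 := hN (p 0)
      have hpd : pos (p 0) ≠ pos d := fun h => hne 0 (by omega) (hinj h)
      -- The lower of the two ends `p 0`, `d` has to come last, so the path is reversed if that is
      -- `p 0`.
      rcases lt_or_gt_of_ne hpd with hlt | hlt
      · refine ih (N - pos (p 0)) (by omega) (j + 1) _ (by omega) hq.reverse ?_ ?_ ?_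
        · intro i hi hij
          have := hsmall (j + 1 - i) (by omega) (by omega)
          simp only [if_pos (show j + 1 - i ≤ j by omega), Nat.sub_self, Nat.zero_le, if_true]
          omega
        · simpa using hlt
        · simp
      · refine ih (N - pos d) (by omega) (j + 1) _ (by omega) hq ?_ ?_ ?_
        · intro i hi hij
          have := hsmall i (by omega) (by omega)
          simp only [if_pos (show i ≤ j by omega), if_neg (show ¬ j + 1 ≤ j by omega)]
          omega
        · simpa using hlt
        · simp

/-- If `a` and `b` were not adjacent, the path `a, c, b` would be a forbidden induced path with `k =
2`. -/
theorem MaxNbhdSearch.adj {V : Type*} {G : SimpleGraph V} (hG : IsChordal G)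
    {pos : V → ℕ} (hinj : Function.Injective pos) (hP : MaxNbhdSearch G pos) {N : ℕ}
    (hN : ∀ x, pos x < N) {a b c : V} (ha : pos c < pos a) (hb : pos c < pos b) (hab : a ≠ b)
    (hca : G.Adj c a) (hcb : G.Adj c b) : G.Adj a b := by
  wlog h : pos b < pos a generalizing a b
  · have hne : pos a ≠ pos b := fun h => hab (hinj h)
    exact (this (a := b) (b := a) hb ha hab.symm hcb hca (by omega)).symm
  by_contra hnab
  refine hP.no_inducedPath hG hinj hN _ 2 (fun i => if i = 0 then a else if i = 1 then c else b)
    le_rfl ?_ ?_ ?_ rfl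
  · intro i j hij hj
    have : j = 1 ∨ j = 2 := by omega
    rcases this with rfl | rfl
    · obtain rfl : i = 0 := by omega
      simp [hca.symm, hca.ne']
    · have : i = 0 ∨ i = 1 := by omega
      rcases this with rfl | rfl
      · simp [hnab, hab]
      · simp [hcb, hcb.ne]
  · intro i hi hi2
    obtain rfl : i = 1 := by omega
    simpa using hb
  · simpa using h

theorem isPEO_of_maxNbhdSearch {N : ℕ} {G : SimpleGraph (Fin N)} (hG : IsChordal G)
    (v : Fin N ≃ Fin N) (hP : MaxNbhdSearch G fun x => (v.symm x : ℕ)) : IsPEO G v := by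
  have hinj : Function.Injective fun x => (v.symm x : ℕ) :=
    Fin.val_injective.comp v.symm.injective
  intro i x hx y hy hxy
  simp only [Set.mem_union, Set.mem_singleton_iff, Set.mem_ofPred_eq] at hx hy
  rcases hx with rfl | ⟨j, hij, rfl, hj⟩ <;> rcases hy with rfl | ⟨k, hik, rfl, hk⟩
  · exact absurd rfl hxy
  · exact hk
  · exact hj.symm
  · exact hP.adj hG hinj (N := N) (fun x => (v.symm x).2) (c := v i) (by simpa using hij)
      (by simpa using hik) hxy hj hk


/-! ## The spanning forest -/

section Forest

variable {N : ℕ} {G : SimpleGraph (Fin N)} {v : Fin N ≃ Fin N}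

theorem mem_later {i j : Fin N} : j ∈ later G v i ↔ i < j ∧ G.Adj (v i) (v j) := by
  simp [later]

theorem star_mem {i : Fin N} (h : (later G v i).Nonempty) : star G v i ∈ later G v i := by
  rw [star, dif_pos h]
  exact Finset.min'_mem _ _

theorem star_le {i j : Fin N} (h : j ∈ later G v i) : star G v i ≤ j := by
  rw [star, dif_pos ⟨j, h⟩]
  exact Finset.min'_le _ _ h

theorem mem_forestEdges {i j : Fin N} (hij : i < j) :
    s(v i, v j) ∈ forestEdges G v ↔ j ∈ later G v i ∧ star G v i = j := by
  constructor
  · rintro ⟨k, hk, h⟩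
    have hs := (mem_later.1 (star_mem hk)).1
    rcases Sym2.eq_iff.1 h with ⟨h1, h2⟩ | ⟨h1, h2⟩
    · obtain rfl := v.injective h1
      obtain rfl := v.injective h2
      exact ⟨star_mem hk, rfl⟩
    · obtain rfl := v.injective h1
      obtain rfl := v.injective h2
      exact absurd hs hij.asymm
  · rintro ⟨h, hs⟩
    exact ⟨i, ⟨j, h⟩, by rw [hs]⟩

theorem forest_adj {i j : Fin N} (hij : i < j) :
    (SimpleGraph.fromEdgeSet (forestEdges G v)).Adj (v i) (v j) ↔
      j ∈ later G v i ∧ star G v i = j := by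
  rw [SimpleGraph.fromEdgeSet_adj, mem_forestEdges hij]
  simp [hij.ne]

theorem forest_le : SimpleGraph.fromEdgeSet (forestEdges G v) ≤ G := by
  intro a b hab
  rw [SimpleGraph.fromEdgeSet_adj] at hab
  obtain ⟨⟨k, hk, h⟩, -⟩ := hab
  have hs := (mem_later.1 (star_mem hk)).2
  rcases Sym2.eq_iff.1 h with ⟨rfl, rfl⟩ | ⟨rfl, rfl⟩
  · exact hs
  · exact hs.symm

/-- Rotate a cycle so that it starts at its earliest vertex `y`. Both neighbours of `y` on the cycle
are later, but the only forest edge from `y` to a later vertex is the one to its star, so the two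
neighbours coincide. -/
theorem forest_isAcyclic : (SimpleGraph.fromEdgeSet (forestEdges G v)).IsAcyclic := by
  intro x c hc
  obtain ⟨y, hy, hmin⟩ := Finset.exists_min_image c.support.toFinset (fun z => v.symm z)
    ⟨x, by simp⟩
  rw [List.mem_toFinset] at hy
  have hc' := hc.rotate hy
  have hmin' : ∀ z ∈ (c.rotate _ hy).support, v.symm y ≤ v.symm z := by
    intro z hz
    exact hmin z (by simpa [SimpleGraph.Walk.mem_support_rotate_iff] using hz)
  generalize c.rotate _ hy = c' at hc' hmin'
  have key : ∀ z ∈ c'.support, (SimpleGraph.fromEdgeSet (forestEdges G v)).Adj y z →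
      z = v (star G v (v.symm y)) := by
    intro z hz hyz
    have hlt : v.symm y < v.symm z :=
      lt_of_le_of_ne (hmin' z hz) fun h => hyz.ne (v.symm.injective h)
    have := (forest_adj (G := G) (v := v) hlt).1 (by simpa using hyz)
    rw [this.2]
    simp
  have h1 := key _ (c'.getVert_mem_support 1) (c'.adj_snd hc'.not_nil)
  have h2 := key _ (c'.getVert_mem_support _) (c'.adj_penultimate hc'.not_nil).symm
  exact hc'.snd_ne_penultimate (h1.trans h2.symm)

theorem IsPEO.adj (hv : IsPEO G v) {i j k : Fin N} (hj : j ∈ later G v i)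
    (hk : k ∈ later G v i) (hjk : j ≠ k) : G.Adj (v j) (v k) := by
  rw [mem_later] at hj hk
  exact hv i (Or.inr ⟨j, hj.1, rfl, hj.2⟩) (Or.inr ⟨k, hk.1, rfl, hk.2⟩)
    fun h => hjk (v.injective h)

/-- Induction from the last position downwards: after the forest edge to `i*`, the vertices at `i*`
and `j` are adjacent by the clique property, and `i*` is later than `i`. -/
theorem IsPEO.forest_reachable_of_adj (hv : IsPEO G v) (n : ℕ) :
    ∀ i j : Fin N, N - (i : ℕ) = n → i < j → G.Adj (v i) (v j) →
      (SimpleGraph.fromEdgeSet (forestEdges G v)).Reachable (v i) (v j) := by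
  induction n using Nat.strong_induction_on with
  | _ n ih =>
    intro i j hn hij hadj
    have hj : j ∈ later G v i := mem_later.2 ⟨hij, hadj⟩
    have hs := star_mem ⟨j, hj⟩
    have hi := (mem_later.1 hs).1
    have h1 : (SimpleGraph.fromEdgeSet (forestEdges G v)).Reachable (v i) (v (star G v i)) :=
      ((forest_adj hi).2 ⟨hs, rfl⟩).reachable
    by_cases h : star G v i = j
    · rwa [h] at h1
    · have := i.2
      have : (i : ℕ) < star G v i := hi
      exact h1.trans (ih (N - (star G v i : ℕ)) (by omega) _ _ rfl
        (lt_of_le_of_ne (star_le hj) h) (hv.adj hs hj h))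

theorem IsPEO.isSpanningForest (hv : IsPEO G v) :
    IsSpanningForest (SimpleGraph.fromEdgeSet (forestEdges G v)) G := by
  refine ⟨forest_le, forest_isAcyclic, ?_⟩
  have hadj : ∀ a b, G.Adj a b → (SimpleGraph.fromEdgeSet (forestEdges G v)).Reachable a b := by
    intro a b hab
    obtain ⟨i, rfl⟩ := v.surjective a
    obtain ⟨j, rfl⟩ := v.surjective b
    rcases lt_trichotomy i j with h | rfl | h
    · exact hv.forest_reachable_of_adj _ i j rfl h hab
    · exact absurd hab (G.loopless.irrefl _)
    · exact (hv.forest_reachable_of_adj _ j i rfl h hab.symm).symm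
  rintro a b ⟨w⟩
  induction w with
  | nil => rfl
  | cons h _ ih => exact (hadj _ _ h).trans ih

/-- Signs of the vertices that make given signs of the forest edges positive. -/
noncomputable def vertexSign (G : SimpleGraph (Fin N)) (v : Fin N ≃ Fin N)
    (τ : Fin N → Fin N → SignType) (i : Fin N) : SignType :=
  open scoped Classical in
  if _ : (later G v i).Nonempty then τ i (star G v i) * vertexSign G v τ (star G v i) else 1
  termination_by N - (i : ℕ)
  decreasing_by
    have : (i : ℕ) < star G v i := (mem_later.1 (star_mem ‹_›)).1
    have := (star G v i).2
    omega

theorem vertexSign_eq {τ : Fin N → Fin N → SignType} {i : Fin N} (h : (later G v i).Nonempty) :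
    vertexSign G v τ i = τ i (star G v i) * vertexSign G v τ (star G v i) := by
  rw [vertexSign, dif_pos h]

theorem vertexSign_ne_zero {τ : Fin N → Fin N → SignType}
    (hτ : ∀ i, ∀ j ∈ later G v i, τ i j ≠ 0) (n : ℕ) :
    ∀ i : Fin N, N - (i : ℕ) = n → vertexSign G v τ i ≠ 0 := by
  induction n using Nat.strong_induction_on with
  | _ n ih =>
    intro i hn
    by_cases h : (later G v i).Nonempty
    · have h1 : (i : ℕ) < star G v i := (mem_later.1 (star_mem h)).1
      have h2 := (star G v i).2
      rw [vertexSign_eq h]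
      exact mul_ne_zero (hτ _ _ (star_mem h)) (ih _ (by omega) _ rfl)
    · rw [vertexSign, dif_neg h]
      decide

end Forest


/-! ## The triangle statistic -/

section Statistic

variable {N : ℕ} {K : Matrix (Fin N) (Fin N) ℝ}

/-- Replaces the determinant indexed by a subtype with one indexed by `Fin n`, to which the explicit
formulas for small determinants apply. -/
theorem principalMinor_image (K : Matrix (Fin N) (Fin N) ℝ) {n : ℕ} {f : Fin n → Fin N}
    (hf : Function.Injective f) :
    principalMinor K (Finset.univ.image f) = (K.submatrix f f).det := by
  have hb : Function.Bijective
      (fun i => ⟨f i, by simp⟩ : Fin n → (Finset.univ.image f : Finset (Fin N))) := by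
    constructor
    · intro i j h
      exact hf (Subtype.ext_iff.1 h)
    · rintro ⟨x, hx⟩
      obtain ⟨i, -, rfl⟩ := Finset.mem_image.1 hx
      exact ⟨i, rfl⟩
  rw [principalMinor, ← Matrix.det_submatrix_equiv_self (Equiv.ofBijective _ hb)]
  rfl

theorem principalMinor_singleton (K : Matrix (Fin N) (Fin N) ℝ) (a : Fin N) :
    principalMinor K {a} = K a a := by
  have h : ({a} : Finset (Fin N)) = Finset.univ.image ![a] := by
    ext x; simp
  rw [h, principalMinor_image K (Function.injective_of_subsingleton _), Matrix.det_fin_one]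
  simp

theorem principalMinor_pair (K : Matrix (Fin N) (Fin N) ℝ) {a b : Fin N} (hab : a ≠ b) :
    principalMinor K {a, b} = K a a * K b b - K a b * K b a := by
  have h : ({a, b} : Finset (Fin N)) = Finset.univ.image ![a, b] := by
    ext x; simp [eq_comm]
  rw [h, principalMinor_image K]
  · rw [Matrix.det_fin_two]
    simp
  · intro i j
    fin_cases i <;> fin_cases j <;> simp [hab, hab.symm]

theorem principalMinor_triple (K : Matrix (Fin N) (Fin N) ℝ) {a b c : Fin N} (hab : a ≠ b)
    (hac : a ≠ c) (hbc : b ≠ c) :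
    principalMinor K {a, b, c} =
      K a a * K b b * K c c - K a a * K b c * K c b - K a b * K b a * K c c +
        K a b * K b c * K c a + K a c * K b a * K c b - K a c * K b b * K c a := by
  have h : ({a, b, c} : Finset (Fin N)) = Finset.univ.image ![a, b, c] := by
    ext x; simp [eq_comm, Fin.exists_fin_succ]
  rw [h, principalMinor_image K]
  · rw [Matrix.det_fin_three]
    simp
  · intro i j
    fin_cases i <;> fin_cases j <;> simp [hab, hab.symm, hac, hac.symm, hbc, hbc.symm]

theorem IsKernel.symm (hK : IsKernel K) (i j : Fin N) : K j i = K i j := by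
  simpa using hK.1.1.apply i j

theorem IsKernel.ne_zero_of_adj (hK : IsKernel K) {i j : Fin N}
    (h : (inducedGraph K).Adj i j) : K i j ≠ 0 := by
  rcases h.2 with h | h
  · exact h
  · exact (hK.symm i j).symm.trans_ne h

theorem IsKernel.diag_nonneg (hK : IsKernel K) (i : Fin N) : 0 ≤ K i i :=
  hK.1.diag_nonneg

theorem IsKernel.diag_le_one (hK : IsKernel K) (i : Fin N) : K i i ≤ 1 := by
  simpa using hK.2.diag_nonneg (i := i)

/-- The submatrix on `![i, j]` is positive semidefinite, so the square is at most `K i i * K j j ≤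
1`. The case `i = j` needs no separate treatment. -/
theorem IsKernel.sq_le_one (hK : IsKernel K) (i j : Fin N) : K i j ^ 2 ≤ 1 := by
  have h := (hK.1.submatrix ![i, j]).det_nonneg
  simp only [Matrix.det_fin_two, Matrix.submatrix_apply, Matrix.cons_val_zero,
    Matrix.cons_val_one, hK.symm i j] at h
  have := mul_le_one₀ (hK.diag_le_one i) (hK.diag_nonneg j) (hK.diag_le_one j)
  nlinarith

theorem abs_mul_sub_mul_le {p q p' q' δ ε : ℝ} (hp : |p| ≤ 1) (hq : |q| ≤ 1)
    (hδ : |p' - p| ≤ δ) (hε : |q' - q| ≤ ε) : |p' * q' - p * q| ≤ δ * (1 + ε) + ε := by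
  have h1 : |q'| ≤ 1 + ε := by
    have := abs_add_le (q' - q) q
    rw [sub_add_cancel] at this
    linarith
  have h0 : 0 ≤ δ := (abs_nonneg _).trans hδ
  calc |p' * q' - p * q| = |(p' - p) * q' + p * (q' - q)| := by ring_nf
    _ ≤ |p' - p| * |q'| + |p| * |q' - q| := by
        rw [← abs_mul, ← abs_mul]; exact abs_add_le _ _
    _ ≤ δ * (1 + ε) + 1 * ε := by gcongr
    _ = δ * (1 + ε) + ε := by ring

theorem sign_eq_of_abs_sub_lt {x y : ℝ} (h : |x - y| < |y|) :
    SignType.sign x = SignType.sign y := by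
  rcases lt_trichotomy y 0 with hy | rfl | hy
  · rw [abs_of_neg hy, abs_lt] at h
    rw [sign_neg hy, sign_neg (by linarith)]
  · simp at h
    exact absurd h (abs_nonneg x).not_gt
  · rw [abs_of_pos hy, abs_lt] at h
    rw [sign_pos hy, sign_pos (by linarith)]

/-- The error budget is `ε` for the triple minor, `5 ε` for the product of the diagonal entries and
`6 ε` for each of the three terms with an edge factor: `1 + 5 + 18 = 24`. The assumption `ε ≤ 1 /
64` absorbs the quadratic terms that arise in products. -/
theorem abs_triangleStat_sub_le (hK : IsKernel K) {Δ : Finset (Fin N) → ℝ} {ε : ℝ}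
    (hε : ε ≤ 1 / 64)
    (hΔ : ∀ S : Finset (Fin N), 1 ≤ S.card → S.card ≤ 3 → |Δ S - principalMinor K S| ≤ ε)
    {a b c : Fin N} (hab : a ≠ b) (hac : a ≠ c) (hbc : b ≠ c) :
    |triangleStat Δ a b c - 2 * (K a b * K a c * K b c)| ≤ 24 * ε := by
  have hk : ∀ x, |Δ {x} - K x x| ≤ ε := fun x => by
    rw [← principalMinor_singleton K x]
    exact hΔ _ (by simp) (by simp)
  have hk1 : ∀ x, |K x x| ≤ 1 := fun x => by
    rw [abs_of_nonneg (hK.diag_nonneg x)]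
    exact hK.diag_le_one x
  have hε0 : 0 ≤ ε := (abs_nonneg _).trans (hk a)
  have hkk : ∀ x y, |Δ {x} * Δ {y} - K x x * K y y| ≤ 3 * ε := fun x y =>
    (abs_mul_sub_mul_le (hk1 x) (hk1 y) (hk x) (hk y)).trans (by nlinarith)
  have hkk1 : ∀ x y, |K x x * K y y| ≤ 1 := fun x y => by
    rw [abs_mul]
    exact mul_le_one₀ (hk1 x) (abs_nonneg _) (hk1 y)
  have hB : ∀ x y, x ≠ y → |(Δ {x} * Δ {y} - Δ {x, y}) - K x y ^ 2| ≤ 4 * ε := fun x y hxy => by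
    have h2 := hΔ {x, y} (by simp [hxy]) (by simp [hxy])
    rw [principalMinor_pair K hxy, hK.symm x y] at h2
    have h1 := hkk x y
    rw [abs_le] at h1 h2 ⊢
    constructor <;> nlinarith
  have hB1 : ∀ x y, |K x y ^ 2| ≤ 1 := fun x y => by
    rw [abs_of_nonneg (sq_nonneg _)]
    exact hK.sq_le_one x y
  have hBK : ∀ x y z, x ≠ y →
      |(Δ {x} * Δ {y} - Δ {x, y}) * Δ {z} - K x y ^ 2 * K z z| ≤ 6 * ε := fun x y z hxy =>
    (abs_mul_sub_mul_le (hB1 x y) (hk1 z) (hB x y hxy) (hk z)).trans (by nlinarith)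
  have h0 := hΔ {a, b, c} (by simp [hab, hac, hbc]) Finset.card_le_three
  rw [principalMinor_triple K hab hac hbc, hK.symm a b, hK.symm a c, hK.symm b c] at h0
  have h1 : |Δ {a} * Δ {b} * Δ {c} - K a a * K b b * K c c| ≤ 5 * ε :=
    (abs_mul_sub_mul_le (hkk1 a b) (hk1 c) (hkk a b) (hk c)).trans (by nlinarith)
  have h2 := hBK a b c hab
  have h3 := hBK a c b hac
  have h4 := hBK b c a hbc
  simp only [triangleStat]
  rw [abs_le] at h0 h1 h2 h3 h4 ⊢
  constructor <;> nlinarith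

theorem sign_triangleStat (hK : IsKernel K) {α : ℝ} (hα : 0 < α) (hα1 : α < 1)
    (hs : Separated K α) {Δ : Finset (Fin N) → ℝ} (hΔ : Accurate K α Δ) {a b c : Fin N}
    (hab : (inducedGraph K).Adj a b) (hac : (inducedGraph K).Adj a c)
    (hbc : (inducedGraph K).Adj b c) :
    SignType.sign (triangleStat Δ a b c) =
      SignType.sign (K a b) * SignType.sign (K a c) * SignType.sign (K b c) := by
  have hge : ∀ x y, (inducedGraph K).Adj x y → α ≤ |K x y| := by
    intro x y h
    exact (hs x y h.ne).resolve_left (hK.ne_zero_of_adj h)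
  have h3 : α ^ 3 ≤ |K a b * K a c * K b c| := by
    rw [abs_mul, abs_mul, pow_three, ← mul_assoc]
    have := hge _ _ hab
    have := hge _ _ hac
    have := hge _ _ hbc
    gcongr
  have hp : 0 < α ^ 3 := by positivity
  have hp1 : α ^ 3 ≤ 1 := pow_le_one₀ hα.le hα1.le
  -- The error is at most `24 α³ / 64`, below the lower bound `2 α³` for the exact value.
  have h := abs_triangleStat_sub_le hK (ε := (α / 4) ^ 3) (by rw [div_pow]; norm_num; linarith)
    hΔ hab.ne hac.ne hbc.ne
  rw [sign_eq_of_abs_sub_lt (h.trans_lt _), sign_mul, sign_mul, sign_mul]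
  · simp
  · rw [abs_mul, div_pow, abs_two]
    linarith

end Statistic

/-! ## Correctness of the signs -/

theorem SignType.mul_self_of_ne_zero {s : SignType} (h : s ≠ 0) : s * s = 1 := by
  revert h; revert s; decide

theorem exists_units_cast (s : SignType) (h : s ≠ 0) : ∃ u : ℤˣ, (u : ℤ) = (s : ℤ) := by
  cases s with
  | zero => exact absurd rfl h
  | neg => exact ⟨-1, rfl⟩
  | pos => exact ⟨1, rfl⟩

theorem runSigns_append {N : ℕ} (G : SimpleGraph (Fin N)) (v : Fin N ≃ Fin N)
    (Δ : Finset (Fin N) → ℝ) (L : List (Fin N × Fin N)) (p : Fin N × Fin N) :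
    runSigns G v Δ (L ++ [p]) = visit G v Δ (runSigns G v Δ L) p := by
  simp [runSigns]

section Signs

variable {N : ℕ} {K : Matrix (Fin N) (Fin N) ℝ} {v : Fin N ≃ Fin N}

/-- The vector `δ` is the change of signs that makes all forest edges positive. The induction runs
over prefixes `L₁` of the visits and shows that every sign set so far is the true one, transformed
by `δ`. -/
theorem IsVisitOrder.runSigns_eq {α : ℝ} {Δ : Finset (Fin N) → ℝ} {L : List (Fin N × Fin N)}
    (hK : IsKernel K) (hα : 0 < α) (hα1 : α < 1) (hs : Separated K α) (hΔ : Accurate K α Δ)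
    (hv : IsPEO (inducedGraph K) v) (hL : IsVisitOrder (inducedGraph K) v L)
    (δ : Fin N → SignType) (hδ : ∀ i, δ i ≠ 0)
    (hδs : ∀ i, (later (inducedGraph K) v i).Nonempty →
      δ i = SignType.sign (K (v i) (v (star (inducedGraph K) v i))) *
        δ (star (inducedGraph K) v i)) (L₁ : List (Fin N × Fin N)) :
    ∀ L₂, L = L₁ ++ L₂ → ∀ i j, i < j →
      (s(v i, v j) ∈ forestEdges (inducedGraph K) v ∨ (i, j) ∈ L₁) →
      runSigns (inducedGraph K) v Δ L₁ s(v i, v j) =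
        δ i * δ j * SignType.sign (K (v i) (v j)) := by
  have hsign : ∀ a b, (inducedGraph K).Adj a b → SignType.sign (K a b) ≠ 0 := by
    intro a b h
    simpa [sign_eq_zero_iff] using hK.ne_zero_of_adj h
  induction L₁ using List.reverseRecOn with
  | nil =>
    intro L₂ _ i j hij h
    replace h := h.resolve_right (by simp)
    rw [runSigns, List.foldl_nil, initSigns, if_pos h]
    obtain ⟨h1, rfl⟩ := (mem_forestEdges hij).1 h
    rw [hδs i ⟨_, h1⟩]
    have h2 := hsign _ _ (mem_later.1 h1).2
    have h3 := hδ (star (inducedGraph K) v i)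
    generalize SignType.sign (K (v i) (v (star (inducedGraph K) v i))) = s at *
    generalize δ (star (inducedGraph K) v i) = t at *
    clear h1 h hij
    -- What remains is `1 = s * t * t * s` for nonzero signs.
    revert s t
    decide
  | append_singleton L₁ p ih =>
    rintro L₂ hL₂ i j hij h
    have ih' := ih (p :: L₂) (by simpa using hL₂)
    rw [runSigns_append]
    by_cases hp : p = (i, j)
    · subst hp
      rw [visit, Function.update_self]
      obtain ⟨-, hadj, hnf⟩ := (hL.1 i j).1 (by rw [hL₂]; simp)
      have hj : j ∈ later (inducedGraph K) v i := mem_later.2 ⟨hij, hadj⟩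
      have hst := star_mem ⟨j, hj⟩
      have hne : star (inducedGraph K) v i ≠ j := fun h =>
        hnf ((mem_forestEdges hij).2 ⟨hj, h⟩)
      have hlt := lt_of_le_of_ne (star_le hj) hne
      have hadj2 := hv.adj hj hst hne.symm
      have hi := mem_later.1 hst
      -- This is where the visiting order matters: since `i < i* < j`, the pair `(i*, j)` cannot
      -- come after `(i, j)`, so its sign is already set unless it is a forest edge.
      have hq : s(v (star (inducedGraph K) v i), v j) ∈ forestEdges (inducedGraph K) v ∨
          (star (inducedGraph K) v i, j) ∈ L₁ := by
        by_contra! hcon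
        have hm := (hL.1 (star (inducedGraph K) v i) j).2 ⟨hlt, hadj2.symm, hcon.1⟩
        rw [hL₂, List.append_assoc, List.mem_append] at hm
        replace hm := hm.resolve_left hcon.2
        rw [List.singleton_append, List.mem_cons] at hm
        rcases hm with hm | hm
        · exact hi.1.ne' (Prod.ext_iff.1 hm).1
        · have hpw := hL.2
          rw [hL₂, List.append_assoc, List.pairwise_append] at hpw
          have := List.rel_of_pairwise_cons hpw.2.1 hm
          simp only [lt_irrefl, false_or, true_and] at this
          exact this.asymm hi.1
      rw [ih' _ _ hi.1 (Or.inl ((mem_forestEdges hi.1).2 ⟨hst, rfl⟩)), Sym2.eq_swap (a := v j),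
        ih' _ _ hlt hq, sign_triangleStat hK hα hα1 hs hΔ hadj hi.2 hadj2,
        hK.symm (v j) (v (star (inducedGraph K) v i))]
      have h1 := hsign _ _ hi.2
      have h2 := hsign _ _ hadj2
      have h3 := hδ (star (inducedGraph K) v i)
      generalize SignType.sign (K (v i) (v (star (inducedGraph K) v i))) = s at *
      generalize SignType.sign (K (v j) (v (star (inducedGraph K) v i))) = s' at *
      generalize δ (star (inducedGraph K) v i) = t at *
      -- The signs of both edges at `i*` and the flip at `i*` occur twice each and cancel.
      calc _ = (s * s) * (s' * s') * (t * t) *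
            (δ i * δ j * SignType.sign (K (v i) (v j))) := by ac_rfl
        _ = _ := by
          rw [SignType.mul_self_of_ne_zero h1, SignType.mul_self_of_ne_zero h2,
            SignType.mul_self_of_ne_zero h3, one_mul, one_mul, one_mul]
    · obtain ⟨hp1, -, hpnf⟩ := (hL.1 p.1 p.2).1 (by rw [hL₂]; simp)
      rw [visit, Function.update_of_ne, ih' i j hij]
      · refine h.imp id fun h => ?_
        rw [List.mem_append, List.mem_singleton] at h
        exact h.resolve_right (Ne.symm hp)
      · intro heq
        rcases Sym2.eq_iff.1 heq with ⟨h1, h2⟩ | ⟨h1, h2⟩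
        · exact hp (Prod.ext (v.injective h1).symm (v.injective h2).symm)
        · have h1 := v.injective h1
          have h2 := v.injective h2
          subst h1 h2
          exact hp1.asymm hij

theorem IsVisitOrder.signsRecovered {α : ℝ} {Δ : Finset (Fin N) → ℝ}
    {L : List (Fin N × Fin N)}
    (hK : IsKernel K) (hα : 0 < α) (hα1 : α < 1) (hs : Separated K α) (hΔ : Accurate K α Δ)
    (hv : IsPEO (inducedGraph K) v) (hL : IsVisitOrder (inducedGraph K) v L) :
    SignsRecovered K (runSigns (inducedGraph K) v Δ L) := by
  set G := inducedGraph K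
  set τ : Fin N → Fin N → SignType := fun i j => SignType.sign (K (v i) (v j))
  have hτ : ∀ i, ∀ j ∈ later G v i, τ i j ≠ 0 := by
    intro i j hj
    simpa [τ, sign_eq_zero_iff] using hK.ne_zero_of_adj (mem_later.1 hj).2
  have hδ : ∀ i, vertexSign G v τ i ≠ 0 := fun i => vertexSign_ne_zero hτ _ i rfl
  choose d hd using fun i => exists_units_cast _ (hδ i)
  -- The flips are indexed by positions and have to be carried over to vertices.
  refine ⟨fun a => d (v.symm a), fun a b hab => ?_⟩
  have key : ∀ i j, i < j → G.Adj (v i) (v j) → (runSigns G v Δ L s(v i, v j) : ℤ) =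
      (d i : ℤ) * (d j : ℤ) * (SignType.sign (K (v i) (v j)) : ℤ) := by
    intro i j hij hadj
    rw [hL.runSigns_eq hK hα hα1 hs hΔ hv _ hδ (fun i hi => vertexSign_eq hi) L [] (by simp)
      i j hij, hd, hd, SignType.coe_mul, SignType.coe_mul]
    by_contra! hcon
    exact hcon.2 ((hL.1 i j).2 ⟨hij, hadj, hcon.1⟩)
  obtain ⟨i, rfl⟩ := v.surjective a
  obtain ⟨j, rfl⟩ := v.surjective b
  simp only [Equiv.symm_apply_apply]
  rcases lt_trichotomy i j with h | rfl | h
  · exact key i j h hab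
  · exact absurd hab (G.loopless.irrefl _)
  · rw [Sym2.eq_swap, key j i h hab.symm, hK.symm (v i) (v j), mul_comm (d j : ℤ)]

end Signs


/-! ## The program

Integer variables: `4` edge counter, `5`, `6` the endpoints of an edge, `7` position, `8` largest
label, `9` and `10` index in and length of the list being read, `11` to `13` vertices.
Integer arrays: `5` degrees, `6` neighbours, `7` indices of edges, `8` sizes and `9` entries of the
stacks, `10` labels, `11` marks of visited vertices, `12` the vertices `v_{i*}`, `13` sizes and `14`
entries of the lists of the lower endpoints of edges outside the forest, `15` positions. -/

/-- Enter `y` as a neighbour of `x`. -/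
def linkProg (x y : NExp) : Prog :=
  -- At its first edge a vertex is pushed on row `0` of array `9`. This list of the non-isolated
  -- vertices later serves as the stack of label `0`.
  .seq (.branch (.neq (.arr 5 x (.const 0)) (.const 0))
    (.seq (.nstore 9 (.const 0) (.var 2) x) (.nset 2 (.succ (.var 2)))) .skip) <|
  .seq (.nstore 6 x (.arr 5 x (.const 0)) y) <|
  .seq (.nstore 5 x (.const 0) (.succ (.arr 5 x (.const 0)))) <|
  .nstore 7 x y (.var 4)

def readBody : Prog :=
  .seq (.nset 5 (.arr 0 (.var 4) (.const 0))) <|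
  .seq (.nset 6 (.arr 1 (.var 4) (.const 0))) <|
  .seq (linkProg (.var 5) (.var 6)) <|
  .seq (linkProg (.var 6) (.var 5)) <|
  .nset 4 (.succ (.var 4))

def readTest : Test := .nlt (.var 4) (.var 1)

def searchInit : Prog :=
  .seq (.nstore 8 (.const 0) (.const 0) (.var 2)) <| .seq (.nset 7 (.var 2)) (.nset 4 (.const 0))

/-- Process the next neighbour of the current vertex. -/
def touchProg : Prog :=
  .seq (.nset 12 (.arr 6 (.var 11) (.var 9))) <|
  .seq (.nset 9 (.succ (.var 9))) <|
  .branch (.neq (.arr 11 (.var 12) (.const 0)) (.const 0))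
    (.seq (.nstore 10 (.var 12) (.const 0) (.succ (.arr 10 (.var 12) (.const 0)))) <|
     -- The entry on the stack of the old label is not removed; it becomes stale.
     .seq (.nstore 9 (.arr 10 (.var 12) (.const 0))
       (.arr 8 (.arr 10 (.var 12) (.const 0)) (.const 0)) (.var 12)) <|
     .seq (.nstore 8 (.arr 10 (.var 12) (.const 0)) (.const 0)
       (.succ (.arr 8 (.arr 10 (.var 12) (.const 0)) (.const 0)))) <|
     -- Every visited neighbour overwrites this cell. Visits proceed by decreasing position, so the
     -- last value is the neighbour with the smallest larger position, that is `v_{i*}`.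
     .nstore 12 (.var 12) (.const 0) (.var 11))
    (.branch (.neq (.arr 12 (.var 11) (.const 0)) (.var 12)) .skip
      (.seq (.nstore 14 (.var 12) (.arr 13 (.var 12) (.const 0)) (.var 11)) <|
       .nstore 13 (.var 12) (.const 0) (.succ (.arr 13 (.var 12) (.const 0)))))

/-- Take a vertex from the stack of the vertices with the largest label. -/
def popProg : Prog :=
  .seq (.nstore 8 (.var 8) (.const 0) (.pred (.arr 8 (.var 8) (.const 0)))) <|
  .seq (.nset 12 (.arr 9 (.var 8) (.arr 8 (.var 8) (.const 0)))) <|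
  .branch (.neq (.arr 11 (.var 12) (.const 0)) (.const 0))
    (.seq (.nstore 11 (.var 12) (.const 0) (.const 1)) <|
     .seq (.nset 7 (.pred (.var 7))) <|
     .seq (.nstore 2 (.var 7) (.const 0) (.var 12)) <|
     .seq (.nstore 15 (.var 12) (.const 0) (.var 7)) <|
     .seq (.nset 11 (.var 12)) <|
     .seq (.nset 9 (.const 0)) <|
     .seq (.nset 10 (.arr 5 (.var 12) (.const 0))) <|
     -- Each label is about to grow by at most one, so the bound for the largest label does too.
     .nset 8 (.succ (.var 8)))
    .skip

def searchBody : Prog :=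
  .branch (.nlt (.var 9) (.var 10)) touchProg
    (.branch (.neq (.arr 8 (.var 8) (.const 0)) (.const 0)) (.nset 8 (.pred (.var 8))) popProg)

/-- A disjunction written with negations. The second alternative lets the current list be finished
when no positions are left. -/
def searchTest : Test :=
  .neg (.and (.neg (.nlt (.const 0) (.var 7))) (.neg (.nlt (.var 9) (.var 10))))

def forestTest (x y : NExp) : Test :=
  .and (.neq (.arr 12 x (.const 0)) y) (.nlt (.arr 15 x (.const 0)) (.arr 15 y (.const 0)))

def markTest : Test :=
  .neg (.and (.neg (forestTest (.var 5) (.var 6))) (.neg (forestTest (.var 6) (.var 5))))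

def markBody : Prog :=
  .seq (.nset 5 (.arr 0 (.var 4) (.const 0))) <|
  .seq (.nset 6 (.arr 1 (.var 4) (.const 0))) <|
  .seq (.branch markTest
    (.seq (.nstore 3 (.var 4) (.const 0) (.const 1)) (.rstore 1 (.var 4) (.const 0) (.const 1)))
    .skip) <|
  .nset 4 (.succ (.var 4))

def visitInit : Prog :=
  .seq (.nset 7 (.var 2)) <| .seq (.nset 9 (.const 0)) (.nset 10 (.const 0))

def diagExp (x : ℕ) : RExp := .minor (.var x) (.var x) (.var x)

def offExp (x y : ℕ) : RExp :=
  .sub (.mul (diagExp x) (diagExp y)) (.minor (.var x) (.var y) (.var y))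

/-- The triangle statistic of the vertices in the variables `x`, `y`, `z`. -/
def statExp (x y z : ℕ) : RExp :=
  .sub (.minor (.var x) (.var y) (.var z))
    (.sub (.sub (.sub (.mul (.mul (diagExp x) (diagExp y)) (diagExp z))
      (.mul (offExp x y) (diagExp z))) (.mul (offExp x z) (diagExp y)))
      (.mul (offExp y z) (diagExp x)))

/-- The sign of real variable `0` goes to real variable `1`. -/
def signProg : Prog :=
  .branch (.rlt (.const 0) (.var 0)) (.rset 1 (.const 1))
    (.branch (.rlt (.var 0) (.const 0)) (.rset 1 (.const (-1))) (.rset 1 (.const 0)))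

def visitBody : Prog :=
  .branch (.nlt (.var 9) (.var 10))
    (.seq (.nset 11 (.arr 14 (.var 12) (.var 9))) <|
     .seq (.nset 13 (.arr 12 (.var 11) (.const 0))) <|
     .seq (.nset 4 (.arr 7 (.var 11) (.var 12))) <|
     .seq (.nstore 4 (.var 3) (.const 0) (.var 4)) <|
     .seq (.nset 3 (.succ (.var 3))) <|
     .seq (.nset 9 (.succ (.var 9))) <|
     .seq (.rset 0 (statExp 11 12 13)) <|
     .seq (.rstore 0 (.var 4) (.const 0) (.var 0)) <|
     .seq signProg <|
     .rstore 1 (.var 4) (.const 0) (.mul (.mul (.var 1)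
       (.arr 1 (.arr 7 (.var 11) (.var 13)) (.const 0)))
       (.arr 1 (.arr 7 (.var 12) (.var 13)) (.const 0))))
    (.seq (.nset 7 (.pred (.var 7))) <|
     .seq (.nset 12 (.arr 2 (.var 7) (.const 0))) <|
     .seq (.nset 9 (.const 0)) <|
     .nset 10 (.arr 13 (.var 12) (.const 0)))

def signsProg : Prog :=
  .seq (.loop readTest readBody) <|
  .seq searchInit <|
  .seq (.loop searchTest searchBody) <|
  .seq (.loop readTest markBody) <|
  .seq visitInit <|
  .loop searchTest visitBody

/-! ## The data structure of the search -/

/-- The contents of the variables and arrays that the search works with. -/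
@[ext]
structure Store where
  (n p j r d u : ℕ)
  (ord deg cnt lab vis par bsz pos : ℕ → ℕ)
  (nbr stk bkt : ℕ → ℕ → ℕ)

def Mem.store (s : Mem) : Store where
  n := s.nvar 2
  p := s.nvar 7
  j := s.nvar 8
  r := s.nvar 9
  d := s.nvar 10
  u := s.nvar 11
  ord x := s.narr 2 x 0
  deg x := s.narr 5 x 0
  cnt x := s.narr 8 x 0
  lab x := s.narr 10 x 0
  vis x := s.narr 11 x 0
  par x := s.narr 12 x 0
  bsz x := s.narr 13 x 0
  pos x := s.narr 15 x 0
  nbr := s.narr 6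
  stk := s.narr 9
  bkt := s.narr 14

namespace Store

open Function (update)

variable (st : Store)

/-- The neighbour `w` of the current vertex has not been visited before. -/
def touchNew (w : ℕ) : Store :=
  { st with
    r := st.r + 1
    lab := update st.lab w (st.lab w + 1)
    stk := upd2 st.stk (st.lab w + 1) (st.cnt (st.lab w + 1)) w
    cnt := update st.cnt (st.lab w + 1) (st.cnt (st.lab w + 1) + 1)
    par := update st.par w st.u }

/-- The edge from the current vertex to `w` belongs to the forest. -/
def touchForest : Store :=
  { st with r := st.r + 1 }

/-- The edge from the current vertex to `w` does not belong to the forest. -/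
def touchOld (w : ℕ) : Store :=
  { st with
    r := st.r + 1
    bkt := upd2 st.bkt w (st.bsz w) st.u
    bsz := update st.bsz w (st.bsz w + 1) }

def lower : Store :=
  { st with j := st.j - 1 }

/-- The top entry of the current stack was visited before. -/
def popOld : Store :=
  { st with cnt := update st.cnt st.j (st.cnt st.j - 1) }

/-- The top entry `w` of the current stack becomes the current vertex. -/
def popNew (w : ℕ) : Store :=
  { st with
    cnt := update st.cnt st.j (st.cnt st.j - 1)
    vis := update st.vis w 1
    p := st.p - 1
    ord := update st.ord (st.p - 1) w
    pos := update st.pos w (st.p - 1)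
    u := w
    r := 0
    d := st.deg w
    j := st.j + 1 }

def step : Store :=
  if st.r < st.d then
    if st.vis (st.nbr st.u st.r) = 0 then st.touchNew (st.nbr st.u st.r)
    else if st.par st.u = st.nbr st.u st.r then st.touchForest
    else st.touchOld (st.nbr st.u st.r)
  else if st.cnt st.j = 0 then st.lower
  else if st.vis (st.stk st.j (st.cnt st.j - 1)) = 0 then
    st.popNew (st.stk st.j (st.cnt st.j - 1))
  else st.popOld

end Store

/-- With this simulation, all invariants can be proved for the pure function `Store.step`, without
reference to programs. -/
theorem store_run_searchBody (tab : ℕ → ℕ → ℕ → ℝ) (s : Mem) :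
    (searchBody.run tab s).store = s.store.step := by
  by_cases h : s.nvar 9 < s.nvar 10
  · by_cases h1 : s.narr 11 (s.narr 6 (s.nvar 11) (s.nvar 9)) 0 = 0
    · have e1 : s.store.step = s.store.touchNew (s.narr 6 (s.nvar 11) (s.nvar 9)) := by
        simp [Store.step, Mem.store, h, h1]
      rw [e1]
      simp [searchBody, touchProg, Prog.run, Test.holds, NExp.eval, h, h1]
      ext <;> simp [Mem.store, Store.touchNew, upd2_apply, Function.update_apply]
    · by_cases h2 : s.narr 12 (s.nvar 11) 0 = s.narr 6 (s.nvar 11) (s.nvar 9)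
      · simp [searchBody, touchProg, Prog.run, Test.holds, NExp.eval, h, h1, h2, Store.step,
          Mem.store, Store.touchForest]
      · have e1 : s.store.step = s.store.touchOld (s.narr 6 (s.nvar 11) (s.nvar 9)) := by
          simp [Store.step, Mem.store, h, h1, h2]
        rw [e1]
        simp [searchBody, touchProg, Prog.run, Test.holds, NExp.eval, h, h1, h2]
        ext <;> simp [Mem.store, Store.touchOld, upd2_apply, Function.update_apply]
  · by_cases h1 : s.narr 8 (s.nvar 8) 0 = 0
    · simp [searchBody, Prog.run, Test.holds, NExp.eval, h, h1, Store.step,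
          Mem.store, Store.lower]
    · by_cases h2 : s.narr 11 (s.narr 9 (s.nvar 8) (s.narr 8 (s.nvar 8) 0 - 1)) 0 = 0
      · have e1 : s.store.step =
            s.store.popNew (s.narr 9 (s.nvar 8) (s.narr 8 (s.nvar 8) 0 - 1)) := by
          simp [Store.step, Mem.store, h, h1, h2]
        rw [e1]
        simp [searchBody, popProg, Prog.run, Test.holds, NExp.eval, h, h1, h2, upd2_apply]
        ext <;> simp [Mem.store, Store.popNew, upd2_apply, Function.update_apply]
      · have e1 : s.store.step = s.store.popOld := by
          simp [Store.step, Mem.store, h, h1, h2]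
        rw [e1]
        simp [searchBody, popProg, Prog.run, Test.holds, NExp.eval, h, h1, h2, upd2_apply]
        ext <;> simp [Mem.store, Store.popOld, upd2_apply, Function.update_apply]


/-! ## Invariants of the search -/

/-- The lists `nbr x 0, …, nbr x (deg x - 1)` enumerate the neighbours `A x y` of `x`. -/
structure Adjacency (N : ℕ) (A : ℕ → ℕ → Prop) (deg : ℕ → ℕ) (nbr : ℕ → ℕ → ℕ) : Prop where
  lt : ∀ x y, A x y → x < N
  nbr_adj : ∀ x i, i < deg x → A x (nbr x i)
  exists_nbr : ∀ x y, A x y → ∃ i < deg x, nbr x i = y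
  nbr_inj : ∀ x i i', i < deg x → i' < deg x → nbr x i = nbr x i' → i = i'

theorem Adjacency.deg_pos_iff {N : ℕ} {A : ℕ → ℕ → Prop} {deg : ℕ → ℕ} {nbr : ℕ → ℕ → ℕ}
    (hA : Adjacency N A deg nbr) (x : ℕ) : 0 < deg x ↔ ∃ y, A x y :=
  ⟨fun h => ⟨_, hA.nbr_adj x 0 h⟩, fun ⟨y, h⟩ => by
    obtain ⟨i, hi, -⟩ := hA.exists_nbr x y h
    omega⟩

/-- `w` is a neighbour of the current vertex that remains to be processed. -/
def Store.Pending (st : Store) (w : ℕ) : Prop :=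
  ∃ i, st.r ≤ i ∧ i < st.d ∧ st.nbr st.u i = w

open scoped Classical in
noncomputable def unvisited (N : ℕ) (st : Store) : Finset ℕ :=
  (Finset.range N).filter fun w => 0 < st.deg w ∧ st.vis w = 0

open scoped Classical in
noncomputable def visitedNbrs (N : ℕ) (A : ℕ → ℕ → Prop) (st : Store) (w : ℕ) : Finset ℕ :=
  (Finset.range N).filter fun x => A w x ∧ st.vis x ≠ 0

theorem mem_visitedNbrs {N : ℕ} {A : ℕ → ℕ → Prop} {st : Store} {w x : ℕ} :
    x ∈ visitedNbrs N A st w ↔ x < N ∧ A w x ∧ st.vis x ≠ 0 := by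
  simp [visitedNbrs]

theorem mem_unvisited {N : ℕ} {st : Store} {w : ℕ} :
    w ∈ unvisited N st ↔ w < N ∧ 0 < st.deg w ∧ st.vis w = 0 := by
  simp [unvisited]

open scoped Classical in
/-- The invariants of the search in the graph with adjacency relation `A`. -/
structure Searching (N : ℕ) (A : ℕ → ℕ → Prop) (st : Store) : Prop where
  r_le : st.r ≤ st.d
  d_le : st.d ≤ st.deg st.u
  cur : st.r < st.d → st.vis st.u ≠ 0 ∧ st.pos st.u = st.p
  vis_pos : ∀ w, st.vis w ≠ 0 →
    st.p ≤ st.pos w ∧ st.pos w < st.n ∧ st.ord (st.pos w) = w ∧ 0 < st.deg w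
  ord_vis : ∀ t, st.p ≤ t → t < st.n → st.vis (st.ord t) ≠ 0 ∧ st.pos (st.ord t) = t
  p_le : st.p ≤ st.n
  -- Keeps the label pointer at most `n`, hence within the range over which the potential sums stack
  -- sizes.
  j_le : st.j + st.p ≤ st.n
  count : (unvisited N st).card = st.p
  -- The current vertex is marked as visited before its neighbours are relabelled; the summand for
  -- pending vertices accounts for the delay.
  lab : ∀ w, st.vis w = 0 →
    st.lab w + (if st.Pending w then 1 else 0) = (visitedNbrs N A st w).card
  -- Among the visited neighbours of `w` that lie above `w`, the recorded one has the least
  -- position. Unvisited vertices count as lying below all visited ones.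
  par : ∀ w y, A w y → st.vis y ≠ 0 → (st.vis w = 0 ∨ st.pos w < st.pos y) →
    ¬ (st.vis w = 0 ∧ st.Pending w) →
    A w (st.par w) ∧ st.vis (st.par w) ≠ 0 ∧
      (st.vis w = 0 ∨ st.pos w < st.pos (st.par w)) ∧ st.pos (st.par w) ≤ st.pos y
  search : ∀ a b c, st.vis a ≠ 0 → st.vis b ≠ 0 → st.pos b < st.pos a →
    (st.vis c = 0 ∨ st.pos c < st.pos b) → A a c → ¬ A a b →
    ∃ d, st.vis d ≠ 0 ∧ st.pos b < st.pos d ∧ A d b ∧ ¬ A d c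
  -- Stale entries are allowed: vertices already visited, or with a label that has grown beyond `k`.
  stk_mem : ∀ k i, i < st.cnt k →
    0 < st.deg (st.stk k i) ∧ (st.vis (st.stk k i) = 0 → k ≤ st.lab (st.stk k i))
  stk_surj : ∀ w, 0 < st.deg w → st.vis w = 0 →
    ∃ i < st.cnt (st.lab w), st.stk (st.lab w) i = w
  stk_top : ∀ k, st.j < k → st.cnt k = 0
  lab_lt : ∀ w, st.vis w = 0 → st.Pending w → st.lab w < st.j
  bkt_mem : ∀ w i, i < st.bsz w → st.vis (st.bkt w i) ≠ 0 ∧ st.vis w ≠ 0 ∧ A (st.bkt w i) w ∧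
    st.pos (st.bkt w i) < st.pos w ∧ st.par (st.bkt w i) ≠ w ∧
    ¬ (st.bkt w i = st.u ∧ st.Pending w)
  bkt_surj : ∀ x w, st.vis x ≠ 0 → st.vis w ≠ 0 → A x w → st.pos x < st.pos w →
    st.par x ≠ w → ¬ (x = st.u ∧ st.Pending w) → ∃ i < st.bsz w, st.bkt w i = x
  bkt_sorted : ∀ w i i', i < i' → i' < st.bsz w →
    st.pos (st.bkt w i') < st.pos (st.bkt w i)

section Steps

open Function (update)

variable {N : ℕ} {A : ℕ → ℕ → Prop} {st : Store}

theorem Searching.pos_inj (h : Searching N A st) {x y : ℕ} (hx : st.vis x ≠ 0)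
    (hy : st.vis y ≠ 0) (hxy : st.pos x = st.pos y) : x = y := by
  rw [← (h.vis_pos x hx).2.2.1, hxy, (h.vis_pos y hy).2.2.1]

theorem pending_self (hr : st.r < st.d) : st.Pending (st.nbr st.u st.r) :=
  ⟨st.r, le_rfl, hr, rfl⟩

theorem Searching.pending_succ_iff (h : Searching N A st)
    (hA : Adjacency N A st.deg st.nbr) (hr : st.r < st.d) {st' : Store} (hr' : st'.r = st.r + 1)
    (hd' : st'.d = st.d) (hu' : st'.u = st.u) (hn' : st'.nbr = st.nbr) (x : ℕ) :
    st'.Pending x ↔ st.Pending x ∧ x ≠ st.nbr st.u st.r := by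
  unfold Store.Pending
  rw [hr', hd', hu', hn']
  constructor
  · rintro ⟨i, h1, h2, rfl⟩
    refine ⟨⟨i, by omega, h2, rfl⟩, fun heq => ?_⟩
    have := hA.nbr_inj _ _ _ (h2.trans_le h.d_le) (hr.trans_le h.d_le) heq
    omega
  · rintro ⟨⟨i, h1, h2, rfl⟩, hne⟩
    refine ⟨i, ?_, h2, rfl⟩
    by_contra hi
    obtain rfl : i = st.r := by omega
    exact hne rfl

theorem not_pending (hr : st.d ≤ st.r) (x : ℕ) : ¬ st.Pending x := by
  rintro ⟨i, h1, h2, -⟩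
  omega

/-- Only the list of pending vertices shrinks, and the vertex dropped from it is the recorded parent
of `st.u`, which the bucket conditions exclude. -/
theorem Searching.touchForest (h : Searching N A st) (hA : Adjacency N A st.deg st.nbr)
    (hr : st.r < st.d) (hv : st.vis (st.nbr st.u st.r) ≠ 0)
    (hp : st.par st.u = st.nbr st.u st.r) : Searching N A st.touchForest := by
  classical
  have hpe : ∀ x, st.touchForest.Pending x ↔ st.Pending x ∧ x ≠ st.nbr st.u st.r :=
    h.pending_succ_iff hA hr rfl rfl rfl rfl
  have hpe0 : ∀ x, st.vis x = 0 → (st.touchForest.Pending x ↔ st.Pending x) := by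
    intro x hx
    rw [hpe, and_iff_left]
    rintro rfl
    exact hv hx
  exact
  { h with
    r_le := hr
    cur := fun _ => h.cur hr
    lab := fun w hw => by
      rw [if_congr (hpe0 w hw) rfl rfl]
      exact h.lab w hw
    par := fun w y h1 h2 h3 h4 => h.par w y h1 h2 h3 fun h5 => h4 ⟨h5.1, (hpe0 w h5.1).2 h5.2⟩
    lab_lt := fun w h1 h2 => h.lab_lt w h1 ((hpe0 w h1).1 h2)
    bkt_mem := fun w i hi => by
      obtain ⟨h1, h2, h3, h4, h5, h6⟩ := h.bkt_mem w i hi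
      exact ⟨h1, h2, h3, h4, h5, fun h7 => h6 ⟨h7.1, ((hpe w).1 h7.2).1⟩⟩
    bkt_surj := fun x w h1 h2 h3 h4 h5 h6 => h.bkt_surj x w h1 h2 h3 h4 h5 fun h7 => h6 ⟨h7.1, by
      refine (hpe w).2 ⟨h7.2, ?_⟩
      rintro rfl
      exact h5 (h7.1 ▸ hp)⟩ }

theorem Searching.touchOld (h : Searching N A st) (hA : Adjacency N A st.deg st.nbr)
    (hirr : ∀ x, ¬ A x x) (hr : st.r < st.d) (hv : st.vis (st.nbr st.u st.r) ≠ 0)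
    (hp : st.par st.u ≠ st.nbr st.u st.r) :
    Searching N A (st.touchOld (st.nbr st.u st.r)) := by
  classical
  have hpe : ∀ x, (st.touchOld (st.nbr st.u st.r)).Pending x ↔
      st.Pending x ∧ x ≠ st.nbr st.u st.r :=
    h.pending_succ_iff hA hr rfl rfl rfl rfl
  have hself := pending_self hr
  have hadj := hA.nbr_adj _ _ (hr.trans_le h.d_le)
  obtain ⟨hu, hpu⟩ := h.cur hr
  generalize hwdef : st.nbr st.u st.r = w₀ at *
  have hpe0 : ∀ x, st.vis x = 0 → ((st.touchOld w₀).Pending x ↔ st.Pending x) := by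
    intro x hx
    rw [hpe, and_iff_left]
    rintro rfl
    exact hv hx
  have hlt : ∀ x, st.vis x ≠ 0 → x ≠ st.u → st.pos st.u < st.pos x := by
    intro x hx hne
    have h1 := h.vis_pos x hx
    have h2 : st.pos st.u ≠ st.pos x := fun heq => hne (h.pos_inj hu hx heq).symm
    omega
  have hw₀ : st.pos st.u < st.pos w₀ := hlt _ hv (by rintro rfl; exact hirr _ hadj)
  exact
  { h with
    r_le := hr
    cur := fun _ => h.cur hr
    lab := fun w hw => by
      rw [if_congr (hpe0 w hw) rfl rfl]
      exact h.lab w hw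
    par := fun w y h1 h2 h3 h4 => h.par w y h1 h2 h3 fun h5 => h4 ⟨h5.1, (hpe0 w h5.1).2 h5.2⟩
    lab_lt := fun w h1 h2 => h.lab_lt w h1 ((hpe0 w h1).1 h2)
    bkt_mem := fun w i hi => by
      by_cases hnew : w = w₀ ∧ i = st.bsz w₀
      · obtain ⟨rfl, rfl⟩ := hnew
        have e : (st.touchOld w).bkt w (st.bsz w) = st.u := by
          simp [Store.touchOld, upd2_apply]
        rw [e, hpe]
        exact ⟨hu, hv, hadj, hw₀, hp, fun h => h.2.2 rfl⟩
      · have hi' : i < st.bsz w := by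
          simp only [Store.touchOld, Function.update_apply] at hi
          split_ifs at hi with hw
          · subst hw
            have : i ≠ st.bsz w := fun h => hnew ⟨rfl, h⟩
            omega
          · exact hi
        have e : (st.touchOld w₀).bkt w i = st.bkt w i := by
          simp only [Store.touchOld, upd2_apply, if_neg hnew]
        rw [e, hpe]
        obtain ⟨h1, h2, h3, h4, h5, h6⟩ := h.bkt_mem w i hi'
        exact ⟨h1, h2, h3, h4, h5, fun h7 => h6 ⟨h7.1, h7.2.1⟩⟩
    bkt_surj := fun x w h1 h2 h3 h4 h5 h6 => by
      by_cases hnew : x = st.u ∧ w = w₀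
      · obtain ⟨rfl, rfl⟩ := hnew
        refine ⟨st.bsz w, ?_, ?_⟩ <;> simp [Store.touchOld, upd2_apply]
      · obtain ⟨i, hi, hb⟩ := h.bkt_surj x w h1 h2 h3 h4 h5 fun h7 => h6 ⟨h7.1, (hpe w).2
          ⟨h7.2, fun hw => hnew ⟨h7.1, hw⟩⟩⟩
        refine ⟨i, ?_, ?_⟩
        · simp only [Store.touchOld, Function.update_apply]
          split_ifs with hw
          · subst hw
            omega
          · exact hi
        · rw [← hb]
          simp only [Store.touchOld, upd2_apply]
          rw [if_neg]
          rintro ⟨rfl, rfl⟩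
          exact lt_irrefl _ hi
    bkt_sorted := fun w i i' hii hi' => by
      simp only [Store.touchOld, Function.update_apply, upd2_apply] at hi' ⊢
      by_cases hw : w = w₀
      · subst hw
        rw [if_pos rfl] at hi'
        rw [if_neg (show ¬ (w = w ∧ i = st.bsz w) by omega)]
        by_cases hi2 : i' = st.bsz w
        · rw [if_pos ⟨rfl, hi2⟩]
          obtain ⟨h1, -, -, -, -, h6⟩ := h.bkt_mem w i (by omega)
          -- The older entry is not `st.u`, since the pair of `st.u` and `w` was still pending. All
          -- other visited vertices lie above `st.u`.
          exact hlt _ h1 fun h7 => h6 ⟨h7, hself⟩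
        · rw [if_neg (by tauto)]
          exact h.bkt_sorted w i i' hii (by omega)
      · rw [if_neg hw] at hi'
        rw [if_neg (by tauto), if_neg (by tauto)]
        exact h.bkt_sorted w i i' hii hi' }

theorem Searching.touchNew (h : Searching N A st) (hA : Adjacency N A st.deg st.nbr)
    (hsymm : ∀ x y, A x y → A y x) (hr : st.r < st.d) (hv : st.vis (st.nbr st.u st.r) = 0) :
    Searching N A (st.touchNew (st.nbr st.u st.r)) := by
  classical
  have hpe : ∀ x, (st.touchNew (st.nbr st.u st.r)).Pending x ↔
      st.Pending x ∧ x ≠ st.nbr st.u st.r :=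
    h.pending_succ_iff hA hr rfl rfl rfl rfl
  have hself := pending_self hr
  have hadj := hA.nbr_adj _ _ (hr.trans_le h.d_le)
  obtain ⟨hu, hpu⟩ := h.cur hr
  generalize hwdef : st.nbr st.u st.r = w₀ at *
  have hpar : ∀ x, x ≠ w₀ → (st.touchNew w₀).par x = st.par x := fun x hx => by
    simp [Store.touchNew, hx]
  have hlab : ∀ x, x ≠ w₀ → (st.touchNew w₀).lab x = st.lab x := fun x hx => by
    simp [Store.touchNew, hx]
  have hlabw : (st.touchNew w₀).lab w₀ = st.lab w₀ + 1 := by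
    simp [Store.touchNew]
  have hdeg : 0 < st.deg w₀ := (hA.deg_pos_iff _).2 ⟨_, hsymm _ _ hadj⟩
  have hcnt : ∀ k, st.cnt k ≤ (st.touchNew w₀).cnt k := fun k => by
    simp only [Store.touchNew, Function.update_apply]
    split_ifs with hk
    · subst hk; omega
    · exact le_rfl
  have hstk : ∀ k i, i < st.cnt k → (st.touchNew w₀).stk k i = st.stk k i := fun k i hi => by
    simp only [Store.touchNew, upd2_apply]
    rw [if_neg]
    rintro ⟨rfl, rfl⟩
    exact lt_irrefl _ hi
  exact
  { h with
    r_le := hr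
    cur := fun _ => h.cur hr
    lab := fun w hw => by
      have h1 := h.lab w hw
      change _ = (visitedNbrs N A st w).card
      rw [← h1, if_congr (hpe w) rfl rfl]
      by_cases hww : w = w₀
      · subst hww
        rw [hlabw, if_neg (by tauto), if_pos hself]
      · rw [hlab w hww]
        simp [hww]
    par := fun w y h1 h2 h3 h4 => by
      by_cases hww : w = w₀
      · subst hww
        have e : (st.touchNew w).par w = st.u := by simp [Store.touchNew]
        rw [e]
        -- The current vertex occupies position `st.p`, the least one filled so far.
        exact ⟨hsymm _ _ hadj, hu, Or.inl hv, hpu.trans_le (h.vis_pos y h2).1⟩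
      · rw [hpar w hww]
        exact h.par w y h1 h2 h3 fun h5 => h4 ⟨h5.1, (hpe w).2 ⟨h5.2, hww⟩⟩
    stk_mem := fun k i hi => by
      by_cases hnew : k = st.lab w₀ + 1 ∧ i = st.cnt (st.lab w₀ + 1)
      · obtain ⟨rfl, rfl⟩ := hnew
        have e : (st.touchNew w₀).stk (st.lab w₀ + 1) (st.cnt (st.lab w₀ + 1)) = w₀ := by
          simp [Store.touchNew, upd2_apply]
        rw [e, hlabw]
        exact ⟨hdeg, fun _ => le_rfl⟩
      · have hi' : i < st.cnt k := by
          simp only [Store.touchNew, Function.update_apply] at hi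
          split_ifs at hi with hk
          · subst hk
            have : i ≠ st.cnt (st.lab w₀ + 1) := fun h => hnew ⟨rfl, h⟩
            omega
          · exact hi
        rw [hstk k i hi']
        obtain ⟨h1, h2⟩ := h.stk_mem k i hi'
        refine ⟨h1, fun h3 => (h2 h3).trans ?_⟩
        by_cases hww : st.stk k i = w₀
        · rw [hww, hlabw]
          omega
        · rw [hlab _ hww]
    stk_surj := fun w h1 h2 => by
      by_cases hww : w = w₀
      · subst hww
        rw [hlabw]
        refine ⟨st.cnt (st.lab w + 1), ?_, ?_⟩ <;> simp [Store.touchNew, upd2_apply]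
      · rw [hlab w hww]
        obtain ⟨i, hi, hs⟩ := h.stk_surj w h1 h2
        exact ⟨i, hi.trans_le (hcnt _), (hstk _ _ hi).trans hs⟩
    stk_top := fun k hk => by
      have h1 := h.lab_lt _ hv hself
      change st.j < k at hk
      simp only [Store.touchNew, Function.update_apply]
      rw [if_neg (by omega)]
      exact h.stk_top k hk
    lab_lt := fun w h1 h2 => by
      obtain ⟨h3, h4⟩ := (hpe w).1 h2
      rw [hlab w h4]
      exact h.lab_lt w h1 h3
    bkt_mem := fun w i hi => by
      obtain ⟨h1, h2, h3, h4, h5, h6⟩ := h.bkt_mem w i hi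
      refine ⟨h1, h2, h3, h4, ?_, fun h7 => h6 ⟨h7.1, ((hpe w).1 h7.2).1⟩⟩
      change (st.touchNew w₀).par (st.bkt w i) ≠ w
      rwa [hpar]
      intro h7
      exact h1 (h7 ▸ hv)
    bkt_surj := fun x w h1 h2 h3 h4 h5 h6 => by
      rw [hpar x (by rintro rfl; exact h1 hv)] at h5
      refine h.bkt_surj x w h1 h2 h3 h4 h5 fun h7 => h6 ⟨h7.1, (hpe w).2 ⟨h7.2, ?_⟩⟩
      rintro rfl
      exact h2 hv }

/-- An unvisited vertex lies on the stack of its label, and the stacks above `st.j` are empty. -/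
theorem Searching.lab_le (h : Searching N A st) {w : ℕ} (hd : 0 < st.deg w)
    (hw : st.vis w = 0) : st.lab w ≤ st.j := by
  obtain ⟨i, hi, -⟩ := h.stk_surj w hd hw
  by_contra hlt
  rw [h.stk_top _ (by omega)] at hi
  omega

theorem Searching.exists_unvisited (h : Searching N A st) (hp : 0 < st.p) :
    ∃ w, 0 < st.deg w ∧ st.vis w = 0 := by
  rw [← h.count, Finset.card_pos] at hp
  obtain ⟨w, hw⟩ := hp
  exact ⟨w, (mem_unvisited.1 hw).2⟩

theorem Searching.lower (h : Searching N A st) (hr : ¬ st.r < st.d) (hc : st.cnt st.j = 0) :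
    Searching N A st.lower :=
  { h with
    j_le := (Nat.add_le_add_right (Nat.sub_le _ _) _).trans h.j_le
    stk_top := fun k hk => by
      change st.j - 1 < k at hk
      rcases eq_or_ne k st.j with rfl | hk2
      · exact hc
      · exact h.stk_top k (by omega)
    lab_lt := fun w _ h2 => absurd h2 (not_pending (by exact not_lt.1 hr) w) }

theorem Searching.popOld (h : Searching N A st)
    (hv : st.vis (st.stk st.j (st.cnt st.j - 1)) ≠ 0) :
    Searching N A st.popOld := by
  have hcnt : ∀ k, st.popOld.cnt k ≤ st.cnt k := fun k => by
    simp only [Store.popOld, Function.update_apply]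
    split_ifs with hk
    · subst hk; omega
    · exact le_rfl
  exact
  { h with
    stk_mem := fun k i hi => h.stk_mem k i (hi.trans_le (hcnt k))
    stk_surj := fun w h1 h2 => by
      obtain ⟨i, hi, hs⟩ := h.stk_surj w h1 h2
      refine ⟨i, ?_, hs⟩
      simp only [Store.popOld, Function.update_apply]
      split_ifs with hk
      · have : i ≠ st.cnt st.j - 1 := by
          rintro rfl
          rw [hk] at hs
          rw [hs] at hv
          exact hv h2
        rw [hk] at hi
        omega
      · exact hi
    stk_top := fun k hk => Nat.eq_zero_of_le_zero ((hcnt k).trans (h.stk_top k hk).le) }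

/-- The popped vertex has the largest label: its own is at least `st.j` by `stk_mem`, and all others
are at most `st.j` by `lab_le`. Nothing is pending at this moment, so labels are the exact numbers
of visited neighbours, and maximality yields the `search` condition for the new vertex. -/
theorem Searching.popNew (h : Searching N A st) (hA : Adjacency N A st.deg st.nbr)
    (hsymm : ∀ x y, A x y → A y x) (hirr : ∀ x, ¬ A x x) (hr : ¬ st.r < st.d)
    (hc : st.cnt st.j ≠ 0) (hv : st.vis (st.stk st.j (st.cnt st.j - 1)) = 0) :
    Searching N A (st.popNew (st.stk st.j (st.cnt st.j - 1))) := by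
  classical
  obtain ⟨hdeg, hjl⟩ := h.stk_mem st.j (st.cnt st.j - 1) (by omega)
  replace hjl := hjl hv
  have hnp := not_pending (not_lt.1 hr)
  have htop : ∀ w, st.vis w = 0 → w ≠ st.stk st.j (st.cnt st.j - 1) →
      ∀ i < st.cnt (st.lab w), st.stk (st.lab w) i = w →
      i < (st.popNew (st.stk st.j (st.cnt st.j - 1))).cnt (st.lab w) := by
    intro w hw hne i hi hs
    simp only [Store.popNew, Function.update_apply]
    split_ifs with hk
    · have : i ≠ st.cnt st.j - 1 := by
        rintro rfl
        rw [hk] at hs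
        exact hne hs.symm
      rw [hk] at hi
      omega
    · exact hi
  generalize hwdef : st.stk st.j (st.cnt st.j - 1) = w₀ at *
  have hcnt : ∀ k, (st.popNew w₀).cnt k ≤ st.cnt k := fun k => by
    simp only [Store.popNew, Function.update_apply]
    split_ifs with hk
    · subst hk; omega
    · exact le_rfl
  have hpe : ∀ x, (st.popNew w₀).Pending x ↔ A w₀ x := by
    intro x
    constructor
    · rintro ⟨i, -, hi, rfl⟩
      exact hA.nbr_adj _ _ hi
    · intro hx
      obtain ⟨i, hi, rfl⟩ := hA.exists_nbr _ _ hx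
      exact ⟨i, Nat.zero_le _, hi, rfl⟩
  have hpos : ∀ x, x ≠ w₀ → (st.popNew w₀).pos x = st.pos x := fun x hx => by
    simp [Store.popNew, hx]
  have hposw : (st.popNew w₀).pos w₀ = st.p - 1 := by simp [Store.popNew]
  have hvis : ∀ x, (st.popNew w₀).vis x ≠ 0 ↔ x = w₀ ∨ st.vis x ≠ 0 := fun x => by
    by_cases hx : x = w₀ <;> simp [Store.popNew, hx]
  have hvis0 : ∀ x, (st.popNew w₀).vis x = 0 ↔ x ≠ w₀ ∧ st.vis x = 0 := fun x => by
    by_cases hx : x = w₀ <;> simp [Store.popNew, hx]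
  have hne : ∀ x, st.vis x ≠ 0 → x ≠ w₀ := by
    rintro x hx rfl
    exact hx hv
  have hwN : w₀ < N := hA.lt _ _ ((hA.deg_pos_iff _).1 hdeg).choose_spec
  have hwun : w₀ ∈ unvisited N st := mem_unvisited.2 ⟨hwN, hdeg, hv⟩
  have hp : 0 < st.p := by
    rw [← h.count]
    exact Finset.card_pos.2 ⟨_, hwun⟩
  have hlt : ∀ x, st.vis x ≠ 0 → st.p - 1 < st.pos x := fun x hx => by
    have := (h.vis_pos x hx).1
    omega
  have hord : ∀ t, t ≠ st.p - 1 → (st.popNew w₀).ord t = st.ord t := fun t ht => by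
    simp [Store.popNew, ht]
  have hordw : (st.popNew w₀).ord (st.p - 1) = w₀ := by simp [Store.popNew]
  have hmax : ∀ w, 0 < st.deg w → st.vis w = 0 → st.lab w ≤ st.lab w₀ := fun w h1 h2 =>
    (h.lab_le h1 h2).trans hjl
  exact
  { r_le := Nat.zero_le _
    d_le := le_rfl
    cur := fun _ => ⟨(hvis _).2 (Or.inl rfl), hposw⟩
    vis_pos := fun w hw => by
      change st.p - 1 ≤ _ ∧ _ < st.n ∧ _ ∧ 0 < st.deg w
      have hpn := h.p_le
      rcases (hvis w).1 hw with rfl | hw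
      · rw [hposw, hordw]
        exact ⟨le_rfl, by omega, rfl, hdeg⟩
      · obtain ⟨h1, h2, h3, h4⟩ := h.vis_pos w hw
        rw [hpos w (hne w hw), hord _ (by omega)]
        exact ⟨by omega, h2, h3, h4⟩
    ord_vis := fun t h1 h2 => by
      change st.p - 1 ≤ t at h1
      rcases eq_or_ne t (st.p - 1) with rfl | ht
      · rw [hordw, hposw]
        exact ⟨(hvis _).2 (Or.inl rfl), rfl⟩
      · rw [hord t ht]
        obtain ⟨h3, h4⟩ := h.ord_vis t (by omega) h2
        rw [hpos _ (hne _ h3)]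
        exact ⟨(hvis _).2 (Or.inr h3), h4⟩
    p_le := (Nat.sub_le _ _).trans h.p_le
    j_le := by
      have := h.j_le
      change st.j + 1 + (st.p - 1) ≤ st.n
      omega
    count := by
      have e : unvisited N (st.popNew w₀) = (unvisited N st).erase w₀ := by
        ext x
        rw [Finset.mem_erase, mem_unvisited, mem_unvisited, hvis0]
        change _ ∧ 0 < st.deg x ∧ _ ↔ _
        tauto
      rw [e, Finset.card_erase_of_mem hwun, h.count]
      rfl
    lab := fun w hw => by
      obtain ⟨hw0, hw1⟩ := (hvis0 w).1 hw
      have h1 := h.lab w hw1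
      rw [if_neg (hnp w)] at h1
      rw [if_congr (hpe w) rfl rfl]
      change st.lab w + _ = _
      by_cases hadj : A w₀ w
      · have e : visitedNbrs N A (st.popNew w₀) w = insert w₀ (visitedNbrs N A st w) := by
          ext x
          rw [Finset.mem_insert, mem_visitedNbrs, mem_visitedNbrs, hvis]
          constructor
          · tauto
          · rintro (rfl | h)
            · exact ⟨hwN, hsymm _ _ hadj, Or.inl rfl⟩
            · tauto
        rw [if_pos hadj, e, Finset.card_insert_of_notMem, ← h1]
        rw [mem_visitedNbrs]
        exact fun h => h.2.2 hv
      · have e : visitedNbrs N A (st.popNew w₀) w = visitedNbrs N A st w := by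
          ext x
          rw [mem_visitedNbrs, mem_visitedNbrs, hvis]
          constructor
          · rintro ⟨h1, h2, rfl | h3⟩
            · exact absurd (hsymm _ _ h2) hadj
            · exact ⟨h1, h2, h3⟩
          · tauto
        rw [if_neg hadj, e, ← h1]
    par := fun w y h1 h2 h3 h4 => by
      change A w (st.par w) ∧ _ ∧ (_ ∨ _ < (st.popNew w₀).pos (st.par w)) ∧
        (st.popNew w₀).pos (st.par w) ≤ _
      rw [hpe] at h4
      -- If `y` is the new vertex, then its neighbour `w` is unvisited and pending, a case excluded
      -- by `h4`.
      rcases (hvis y).1 h2 with rfl | hy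
      · exfalso
        rcases h3 with h3 | h3
        · exact h4 ⟨h3, hsymm _ _ h1⟩
        · rw [hposw] at h3
          by_cases hw : w = y
          · exact hirr _ (hw ▸ h1)
          · by_cases hw' : st.vis w = 0
            · exact h4 ⟨(hvis0 w).2 ⟨hw, hw'⟩, hsymm _ _ h1⟩
            · rw [hpos w hw] at h3
              exact absurd (hlt w hw') h3.asymm
      · have h5 : st.vis w = 0 ∨ st.pos w < st.pos y := by
          by_cases hw : w = w₀
          · exact Or.inl (hw ▸ hv)
          · rwa [hvis0, and_iff_right hw, hpos w hw, hpos y (hne y hy)] at h3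
        obtain ⟨h6, h7, h8, h9⟩ := h.par w y h1 hy h5 fun h => hnp _ h.2
        refine ⟨h6, (hvis _).2 (Or.inr h7), ?_, ?_⟩
        · rw [hpos _ (hne _ h7)]
          by_cases hw : w = w₀
          · right
            nth_rw 1 [hw]
            rw [hposw]
            exact hlt _ h7
          · rwa [hvis0, and_iff_right hw, hpos w hw]
        · rwa [hpos _ (hne _ h7), hpos _ (hne _ hy)]
    search := fun a b c h1 h2 h3 h4 h5 h6 => by
      rcases (hvis b).1 h2 with rfl | hb
      · rcases (hvis a).1 h1 with rfl | ha
        · exact absurd h3 (lt_irrefl _)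
        have hc : c ≠ b ∧ st.vis c = 0 := by
          by_contra hcon
          have h4 := h4.resolve_left fun h7 => hcon ((hvis0 c).1 h7)
          rw [hposw] at h4
          by_cases hcb : c = b
          · rw [hcb, hposw] at h4
            exact lt_irrefl _ h4
          · rw [hpos c hcb] at h4
            exact (hlt c fun h7 => hcon ⟨hcb, h7⟩).asymm h4
        -- If every visited neighbour of `b` were a neighbour of `c`, then `a` would make the
        -- inclusion of visited neighbourhoods strict, and `c` would have the larger label.
        by_contra! hcon
        have hsub : visitedNbrs N A st b ⊆ visitedNbrs N A st c := by
          intro x hx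
          obtain ⟨hx1, hx2, hx3⟩ := mem_visitedNbrs.1 hx
          refine mem_visitedNbrs.2 ⟨hx1, hsymm _ _ ?_, hx3⟩
          refine hcon x ((hvis x).2 (Or.inr hx3)) ?_ (hsymm _ _ hx2)
          rw [hposw, hpos x (hne x hx3)]
          exact hlt x hx3
        have hss : visitedNbrs N A st b ⊂ visitedNbrs N A st c := by
          refine (Finset.ssubset_iff_of_subset hsub).2 ⟨a, ?_, ?_⟩
          · exact mem_visitedNbrs.2 ⟨hA.lt _ _ h5, hsymm _ _ h5, ha⟩
          · exact fun h7 => h6 (hsymm _ _ (mem_visitedNbrs.1 h7).2.1)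
        have h7 := Finset.card_lt_card hss
        rw [← h.lab b hv, ← h.lab c hc.2, if_neg (hnp b), if_neg (hnp c)] at h7
        have h8 := hmax c ((hA.deg_pos_iff c).2 ⟨a, hsymm _ _ h5⟩) hc.2
        omega
      · have ha : st.vis a ≠ 0 := by
          refine ((hvis a).1 h1).resolve_left ?_
          rintro rfl
          rw [hposw, hpos b (hne b hb)] at h3
          exact (hlt b hb).asymm h3
        rw [hpos a (hne a ha), hpos b (hne b hb)] at h3
        have hc : st.vis c = 0 ∨ st.pos c < st.pos b := by
          by_cases hcw : c = w₀
          · exact Or.inl (hcw ▸ hv)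
          · rwa [hvis0, and_iff_right hcw, hpos c hcw, hpos b (hne b hb)] at h4
        obtain ⟨d, hd1, hd2, hd3⟩ := h.search a b c ha hb h3 hc h5 h6
        refine ⟨d, (hvis d).2 (Or.inr hd1), ?_, hd3⟩
        rwa [hpos b (hne b hb), hpos d (hne d hd1)]
    stk_mem := fun k i hi => by
      obtain ⟨h1, h2⟩ := h.stk_mem k i (hi.trans_le (hcnt k))
      exact ⟨h1, fun h3 => h2 ((hvis0 _).1 h3).2⟩
    stk_surj := fun w h1 h2 => by
      obtain ⟨hw0, hw1⟩ := (hvis0 w).1 h2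
      obtain ⟨i, hi, hs⟩ := h.stk_surj w h1 hw1
      exact ⟨i, htop w hw1 hw0 i hi hs, hs⟩
    stk_top := fun k hk => Nat.eq_zero_of_le_zero ((hcnt k).trans
      (h.stk_top k (lt_of_le_of_lt (Nat.le_succ _) hk)).le)
    lab_lt := fun w h1 h2 => by
      obtain ⟨hw0, hw1⟩ := (hvis0 w).1 h1
      refine Nat.lt_succ_of_le (h.lab_le ?_ hw1)
      exact (hA.deg_pos_iff _).2 ⟨_, hsymm _ _ ((hpe w).1 h2)⟩
    bkt_mem := fun w i hi => by
      obtain ⟨h1, h2, h3, h4, h5, h6⟩ := h.bkt_mem w i hi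
      refine ⟨(hvis _).2 (Or.inr h1), (hvis _).2 (Or.inr h2), h3, ?_, h5, fun h7 => hne _ h1 h7.1⟩
      change (st.popNew w₀).pos (st.bkt w i) < _
      rwa [hpos _ (hne _ h1), hpos _ (hne _ h2)]
    bkt_surj := fun x w h1 h2 h3 h4 h5 h6 => by
      rw [hpe] at h6
      have hx : x ≠ w₀ := by
        rintro rfl
        exact h6 ⟨rfl, h3⟩
      replace h1 := ((hvis x).1 h1).resolve_left hx
      rw [hpos x hx] at h4
      have hw : w ≠ w₀ := by
        rintro rfl
        rw [hposw] at h4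
        exact absurd (hlt x h1) h4.asymm
      rw [hpos w hw] at h4
      exact h.bkt_surj x w h1 (((hvis w).1 h2).resolve_left hw) h3 h4 h5 fun h => hnp _ h.2
    bkt_sorted := fun w i i' hii hi' => by
      change (st.popNew w₀).pos (st.bkt w i') < (st.popNew w₀).pos (st.bkt w i)
      rw [hpos _ (hne _ (h.bkt_mem w i' hi').1), hpos _ (hne _ (h.bkt_mem w i (hii.trans hi')).1)]
      exact h.bkt_sorted w i i' hii hi' }

end Steps


/-! ## The potential of the search -/

/-- The potential of the search, an upper bound for the number of remaining steps. -/
noncomputable def potential (N : ℕ) (st : Store) : ℕ :=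
  st.j + ∑ k ∈ Finset.range (N + 1), st.cnt k + 3 * ∑ w ∈ unvisited N st, st.deg w +
    2 * (st.d - st.r) + ∑ w ∈ Finset.range N, st.bsz w

theorem sum_update_succ {s : Finset ℕ} {f : ℕ → ℕ} {i : ℕ} (hi : i ∈ s) :
    ∑ k ∈ s, Function.update f i (f i + 1) k = ∑ k ∈ s, f k + 1 := by
  rw [Finset.sum_update_of_mem hi, Finset.sum_eq_add_sum_sdiff_singleton_of_mem hi f]
  ring

theorem sum_update_pred {s : Finset ℕ} {f : ℕ → ℕ} {i : ℕ} (hi : i ∈ s) (h : f i ≠ 0) :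
    ∑ k ∈ s, Function.update f i (f i - 1) k + 1 = ∑ k ∈ s, f k := by
  rw [Finset.sum_update_of_mem hi, Finset.sum_eq_add_sum_sdiff_singleton_of_mem hi f]
  omega

/-- Processing a neighbour releases two units of the potential, of which at most one is used for a
push on a stack or into a bucket. A newly visited vertex releases `3 * deg`, of which `2 * deg` goes
to its neighbour list; the rise of `j` by one is offset by the popped entry, and `deg > 0` makes the
drop strict. -/
theorem Searching.step {N : ℕ} {A : ℕ → ℕ → Prop} {st : Store} (h : Searching N A st)
    (hA : Adjacency N A st.deg st.nbr) (hsymm : ∀ x y, A x y → A y x) (hirr : ∀ x, ¬ A x x)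
    (hn : st.n ≤ N) (hrun : 0 < st.p ∨ st.r < st.d) :
    Searching N A st.step ∧ potential N st.step < potential N st ∧ st.step.n = st.n ∧
      st.step.deg = st.deg ∧ st.step.nbr = st.nbr := by
  classical
  have hjN : st.j < N + 1 := by
    have := h.j_le
    omega
  unfold Store.step
  split_ifs with hr h1 h2 h1 h2
  · refine ⟨h.touchNew hA hsymm hr h1, ?_, rfl, rfl, rfl⟩
    have hl := h.lab_lt _ h1 (pending_self hr)
    have hs := sum_update_succ (f := st.cnt)
      (Finset.mem_range.2 (show st.lab (st.nbr st.u st.r) + 1 < N + 1 by omega))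
    have e : unvisited N (st.touchNew (st.nbr st.u st.r)) = unvisited N st := rfl
    unfold potential
    rw [e]
    simp only [Store.touchNew] at hs ⊢
    rw [hs]
    omega
  · refine ⟨h.touchForest hA hr h1 h2, ?_, rfl, rfl, rfl⟩
    have e : unvisited N st.touchForest = unvisited N st := rfl
    unfold potential
    rw [e]
    simp only [Store.touchForest]
    omega
  · refine ⟨h.touchOld hA hirr hr h1 h2, ?_, rfl, rfl, rfl⟩
    have hw : st.nbr st.u st.r < N :=
      hA.lt _ _ (hsymm _ _ (hA.nbr_adj _ _ (hr.trans_le h.d_le)))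
    have hs := sum_update_succ (f := st.bsz) (Finset.mem_range.2 hw)
    have e : unvisited N (st.touchOld (st.nbr st.u st.r)) = unvisited N st := rfl
    unfold potential
    rw [e]
    simp only [Store.touchOld] at hs ⊢
    rw [hs]
    omega
  · refine ⟨h.lower hr h1, ?_, rfl, rfl, rfl⟩
    obtain ⟨w, hw1, hw2⟩ := h.exists_unvisited (hrun.resolve_right hr)
    obtain ⟨i, hi, -⟩ := h.stk_surj w hw1 hw2
    have hle := h.lab_le hw1 hw2
    -- Some vertex is unvisited. If `st.j` were `0`, its label would be `0` and it would lie on the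
    -- empty stack.
    have hj : st.j ≠ 0 := by
      intro hj
      rw [show st.lab w = st.j by omega, h1] at hi
      omega
    have e : unvisited N st.lower = unvisited N st := rfl
    unfold potential
    rw [e]
    simp only [Store.lower]
    omega
  · refine ⟨h.popNew hA hsymm hirr hr h1 h2, ?_, rfl, rfl, rfl⟩
    obtain ⟨hd, -⟩ := h.stk_mem st.j (st.cnt st.j - 1) (by omega)
    generalize hw : st.stk st.j (st.cnt st.j - 1) = w at *
    have hs := sum_update_pred (Finset.mem_range.2 hjN) h1
    have hwN : w < N := hA.lt _ _ ((hA.deg_pos_iff _).1 hd).choose_spec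
    have hwun : w ∈ unvisited N st := mem_unvisited.2 ⟨hwN, hd, h2⟩
    have e : unvisited N (st.popNew w) = (unvisited N st).erase w := by
      ext x
      rw [Finset.mem_erase, mem_unvisited, mem_unvisited]
      by_cases hx : x = w <;> simp [Store.popNew, hx]
    have hsum := Finset.add_sum_erase _ st.deg hwun
    unfold potential
    rw [e]
    simp only [Store.popNew]
    omega
  · refine ⟨h.popOld h2, ?_, rfl, rfl, rfl⟩
    have hs := sum_update_pred (Finset.mem_range.2 hjN) h1
    have e : unvisited N st.popOld = unvisited N st := rfl
    unfold potential
    rw [e]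
    simp only [Store.popOld]
    omega

/-! ## Variables and arrays that a program does not change -/

/-- A syntactic condition, so that `simp` can check it on concrete programs; the same holds for the
next two. -/
def Prog.KeepsVar (x : ℕ) : Prog → Prop
  | .nset y _ => x ≠ y
  | .seq p q => p.KeepsVar x ∧ q.KeepsVar x
  | .branch _ p q => p.KeepsVar x ∧ q.KeepsVar x
  | .loop _ p => p.KeepsVar x
  | _ => True

def Prog.KeepsArr (a : ℕ) : Prog → Prop
  | .nstore b _ _ _ => a ≠ b
  | .seq p q => p.KeepsArr a ∧ q.KeepsArr a
  | .branch _ p q => p.KeepsArr a ∧ q.KeepsArr a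
  | .loop _ p => p.KeepsArr a
  | _ => True

def Prog.KeepsReal (a : ℕ) : Prog → Prop
  | .rstore b _ _ _ => a ≠ b
  | .seq p q => p.KeepsReal a ∧ q.KeepsReal a
  | .branch _ p q => p.KeepsReal a ∧ q.KeepsReal a
  | .loop _ p => p.KeepsReal a
  | _ => True

section Keeps

variable {tab : ℕ → ℕ → ℕ → ℝ} {p : Prog} {s s' : Mem} {t : ℕ}

theorem Exec.nvar_eq (h : Exec tab p s t s') {x : ℕ} (hp : p.KeepsVar x) :
    s'.nvar x = s.nvar x := by
  induction h with
  | nset y e s => exact Function.update_of_ne hp _ _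
  | seq _ _ ih ih' => rw [ih' hp.2, ih hp.1]
  | branch_true _ _ ih => exact ih hp.1
  | branch_false _ _ ih => exact ih hp.2
  | loop_step _ _ _ ih ih' => rw [ih' hp, ih hp]
  | _ => rfl

theorem Exec.narr_eq (h : Exec tab p s t s') {a : ℕ} (hp : p.KeepsArr a) :
    s'.narr a = s.narr a := by
  induction h with
  | nstore b i j e s => exact Function.update_of_ne hp _ _
  | seq _ _ ih ih' => rw [ih' hp.2, ih hp.1]
  | branch_true _ _ ih => exact ih hp.1
  | branch_false _ _ ih => exact ih hp.2
  | loop_step _ _ _ ih ih' => rw [ih' hp, ih hp]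
  | _ => rfl

theorem Exec.rarr_eq (h : Exec tab p s t s') {a : ℕ} (hp : p.KeepsReal a) :
    s'.rarr a = s.rarr a := by
  induction h with
  | rstore b i j e s => exact Function.update_of_ne hp _ _
  | seq _ _ ih ih' => rw [ih' hp.2, ih hp.1]
  | branch_true _ _ ih => exact ih hp.1
  | branch_false _ _ ih => exact ih hp.2
  | loop_step _ _ _ ih ih' => rw [ih' hp, ih hp]
  | _ => rfl

theorem Prog.run_nvar_eq (hp : p.LoopFree) {x : ℕ} (hx : p.KeepsVar x) :
    (p.run tab s).nvar x = s.nvar x := by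
  obtain ⟨t, -, h⟩ := p.exec_run tab hp s
  exact h.nvar_eq hx

theorem Prog.run_narr_eq (hp : p.LoopFree) {a : ℕ} (ha : p.KeepsArr a) :
    (p.run tab s).narr a = s.narr a := by
  obtain ⟨t, -, h⟩ := p.exec_run tab hp s
  exact h.narr_eq ha

end Keeps

/-! ## The search loop -/

theorem searchBody_loopFree : searchBody.LoopFree := by
  simp [searchBody, touchProg, popProg, Prog.LoopFree]

theorem searchTest_holds (tab : ℕ → ℕ → ℕ → ℝ) (s : Mem) :
    searchTest.holds tab s ↔ 0 < s.nvar 7 ∨ s.nvar 9 < s.nvar 10 := by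
  simp only [searchTest, Test.holds, NExp.eval]
  tauto

theorem exec_search (tab : ℕ → ℕ → ℕ → ℝ) {N : ℕ} {A : ℕ → ℕ → Prop} {s : Mem}
    (h : Searching N A s.store) (hA : Adjacency N A s.store.deg s.store.nbr)
    (hsymm : ∀ x y, A x y → A y x) (hirr : ∀ x, ¬ A x x) (hn : s.store.n ≤ N) :
    ∃ t s', Exec tab (.loop searchTest searchBody) s t s' ∧
      t ≤ (searchBody.bound + searchTest.cost + 1) * (potential N s.store + 1) ∧
      Searching N A s'.store ∧ s'.store.p = 0 ∧ s'.store.d ≤ s'.store.r ∧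
      ∑ w ∈ Finset.range N, s'.store.bsz w ≤ potential N s.store := by
  obtain ⟨t, s', h1, h2, h3, h4⟩ := Prog.exec_loop tab searchTest searchBody searchBody_loopFree
    (fun s' => Searching N A s'.store ∧ Adjacency N A s'.store.deg s'.store.nbr ∧
      s'.store.n ≤ N ∧ potential N s'.store ≤ potential N s.store) (fun s => potential N s.store)
    (fun s₁ ⟨hs, hA, hn, hle⟩ hb => by
      rw [searchTest_holds] at hb
      obtain ⟨h1, h2, h3, h4, h5⟩ := hs.step hA hsymm hirr hn hb
      simp only [store_run_searchBody, h3, h4, h5]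
      exact ⟨⟨h1, hA, hn, h2.le.trans hle⟩, h2⟩) s ⟨h, hA, hn, le_rfl⟩
  refine ⟨t, s', h1, h2, h3.1, ?_, ?_, ?_⟩
  · by_contra hp
    exact h4 ((searchTest_holds _ _).2 (Or.inl (Nat.pos_of_ne_zero hp)))
  · by_contra hr
    exact h4 ((searchTest_holds _ _).2 (Or.inr (not_le.1 hr)))
  -- Bucket sizes are a summand of the potential, so the number of entries left for the visits is
  -- bounded by its initial value.
  · refine le_trans ?_ h3.2.2.2
    unfold potential
    omega


/-! ## Reading the list of edges -/

/-- The neighbour lists, the indices of edges, and the list of the non-isolated vertices of the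
graph with adjacency relation `A`, whose edges have the endpoints `ends k`, `k < m`. -/
structure Linked (N m : ℕ) (ends : ℕ → Sym2 ℕ) (A : ℕ → ℕ → Prop) (c : ℕ) (s : Mem) : Prop where
  adj : Adjacency N A (fun x => s.narr 5 x 0) (s.narr 6)
  edge : ∀ x y, A x y → s.narr 7 x y < m ∧ ends (s.narr 7 x y) = s(x, y)
  stk_pos : ∀ i < s.nvar 2, 0 < s.narr 5 (s.narr 9 0 i) 0
  stk_surj : ∀ x, 0 < s.narr 5 x 0 → ∃ i < s.nvar 2, s.narr 9 0 i = x
  count : s.nvar 2 = ((Finset.range N).filter fun x => 0 < s.narr 5 x 0).card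
  sum : ∑ x ∈ Finset.range N, s.narr 5 x 0 = c

theorem linkProg_loopFree (x y : NExp) : (linkProg x y).LoopFree := by
  simp [linkProg, Prog.LoopFree]

/-- One direction of an edge is entered. The condition `hnew` keeps the neighbour lists free of
repetitions. The endpoints must not be held in variable `2`, which may change before they are read
again. -/
theorem Linked.link {N m : ℕ} {ends : ℕ → Sym2 ℕ} {A : ℕ → ℕ → Prop} {c : ℕ} {s : Mem}
    (h : Linked N m ends A c s) (tab : ℕ → ℕ → ℕ → ℝ) {a b : ℕ} (ha : a ≠ 2) (hb : b ≠ 2)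
    (hnew : ¬ A (s.nvar a) (s.nvar b)) (hN : s.nvar a < N) (hk : s.nvar 4 < m)
    (hends : ends (s.nvar 4) = s(s.nvar a, s.nvar b)) :
    Linked N m ends (fun u w => A u w ∨ (u = s.nvar a ∧ w = s.nvar b)) (c + 1)
      ((linkProg (.var a) (.var b)).run tab s) := by
  generalize hx : s.nvar a = x at *
  generalize hy : s.nvar b = y at *
  obtain ⟨s', hs'⟩ : ∃ s', s' = (linkProg (.var a) (.var b)).run tab s := ⟨_, rfl⟩
  have hdeg : ∀ z, s'.narr 5 z 0 = if z = x then s.narr 5 x 0 + 1 else s.narr 5 z 0 := by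
    intro z
    rw [hs']
    by_cases h0 : s.narr 5 x 0 = 0 <;>
      simp [linkProg, Prog.run, Test.holds, NExp.eval, upd2_apply, hx, hy, h0, ha, hb]
  have hnbr : ∀ z i, s'.narr 6 z i = if z = x ∧ i = s.narr 5 x 0 then y else s.narr 6 z i := by
    intro z i
    rw [hs']
    by_cases h0 : s.narr 5 x 0 = 0 <;>
      simp [linkProg, Prog.run, Test.holds, NExp.eval, upd2_apply, hx, hy, h0, ha, hb]
  have hidx : ∀ z w, s'.narr 7 z w = if z = x ∧ w = y then s.nvar 4 else s.narr 7 z w := by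
    intro z w
    rw [hs']
    by_cases h0 : s.narr 5 x 0 = 0 <;>
      simp [linkProg, Prog.run, Test.holds, NExp.eval, upd2_apply, hx, hy, h0, ha, hb]
  have hn : s'.nvar 2 = if s.narr 5 x 0 = 0 then s.nvar 2 + 1 else s.nvar 2 := by
    rw [hs']
    by_cases h0 : s.narr 5 x 0 = 0 <;>
      simp [linkProg, Prog.run, Test.holds, NExp.eval, hx, h0]
  have hstk : ∀ i, s'.narr 9 0 i =
      if s.narr 5 x 0 = 0 ∧ i = s.nvar 2 then x else s.narr 9 0 i := by
    intro i
    rw [hs']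
    by_cases h0 : s.narr 5 x 0 = 0 <;>
      simp [linkProg, Prog.run, Test.holds, NExp.eval, upd2_apply, hx, h0]
  rw [← hs']
  clear hs'
  have hdegx : s'.narr 5 x 0 = s.narr 5 x 0 + 1 := by rw [hdeg, if_pos rfl]
  have hdegne : ∀ z, z ≠ x → s'.narr 5 z 0 = s.narr 5 z 0 := fun z hz => by rw [hdeg, if_neg hz]
  have hpos : ∀ z, 0 < s'.narr 5 z 0 ↔ z = x ∨ 0 < s.narr 5 z 0 := by
    intro z
    rw [hdeg]
    split_ifs with hz <;> simp [hz]
  have hold : ∀ z i, i < s.narr 5 z 0 → s'.narr 6 z i = s.narr 6 z i := by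
    intro z i hi
    rw [hnbr, if_neg]
    rintro ⟨rfl, rfl⟩
    exact lt_irrefl _ hi
  have hlast : s'.narr 6 x (s.narr 5 x 0) = y := by rw [hnbr, if_pos ⟨rfl, rfl⟩]
  have hsplit : ∀ z i, i < s'.narr 5 z 0 →
      i < s.narr 5 z 0 ∨ z = x ∧ i = s.narr 5 x 0 := by
    intro z i hi
    by_cases hz : z = x
    · subst hz
      omega
    · rw [hdegne z hz] at hi
      exact Or.inl hi
  refine ⟨⟨?_, ?_, ?_, ?_⟩, ?_, ?_, ?_, ?_, ?_⟩
  · rintro u w (huw | ⟨rfl, -⟩)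
    · exact h.adj.lt _ _ huw
    · exact hN
  · intro z i hi
    rcases hsplit z i hi with h1 | ⟨rfl, rfl⟩
    · rw [hold z i h1]
      exact Or.inl (h.adj.nbr_adj z i h1)
    · exact Or.inr ⟨rfl, hlast⟩
  · rintro u w (huw | ⟨rfl, rfl⟩)
    · obtain ⟨i, hi, rfl⟩ := h.adj.exists_nbr _ _ huw
      refine ⟨i, hi.trans_le ?_, hold _ _ hi⟩
      change _ ≤ s'.narr 5 u 0
      rw [hdeg]
      split_ifs with hu
      · subst hu; omega
      · exact le_rfl
    · exact ⟨_, (Nat.lt_succ_self _).trans_eq hdegx.symm, hlast⟩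
  · intro z i i' hi hi' heq
    rcases hsplit z i hi with h1 | ⟨rfl, rfl⟩ <;> rcases hsplit z i' hi' with h2 | ⟨h2, rfl⟩
    · rw [hold _ _ h1, hold _ _ h2] at heq
      exact h.adj.nbr_inj z i i' h1 h2 heq
    · subst h2
      rw [hold _ _ h1, hlast] at heq
      exact absurd (heq ▸ h.adj.nbr_adj _ _ h1) hnew
    · rw [hlast, hold _ _ h2] at heq
      exact absurd (heq ▸ h.adj.nbr_adj _ _ h2) hnew
    · rfl
  · intro u w huw
    rw [hidx]
    split_ifs with h1
    · obtain ⟨rfl, rfl⟩ := h1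
      exact ⟨hk, hends⟩
    · exact h.edge u w (huw.resolve_right h1)
  · intro i hi
    rw [hstk, hpos]
    split_ifs with h1
    · exact Or.inl rfl
    · refine Or.inr (h.stk_pos i ?_)
      rw [hn] at hi
      split_ifs at hi with h0
      · have : i ≠ s.nvar 2 := fun h => h1 ⟨h0, h⟩
        omega
      · exact hi
  · intro z hz
    by_cases h0 : s.narr 5 z 0 = 0
    · obtain rfl : z = x := ((hpos z).1 hz).resolve_right (by omega)
      refine ⟨s.nvar 2, ?_, ?_⟩
      · rw [hn, if_pos h0]
        omega
      · rw [hstk, if_pos ⟨h0, rfl⟩]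
    · obtain ⟨i, hi, rfl⟩ := h.stk_surj z (Nat.pos_of_ne_zero h0)
      refine ⟨i, ?_, ?_⟩
      · rw [hn]
        split_ifs <;> omega
      · rw [hstk, if_neg (by omega)]
  · rw [hn]
    have e : ((Finset.range N).filter fun z => 0 < s'.narr 5 z 0) =
        insert x ((Finset.range N).filter fun z => 0 < s.narr 5 z 0) := by
      ext z
      simp only [Finset.mem_insert, Finset.mem_filter, Finset.mem_range, hpos]
      constructor
      · tauto
      · rintro (rfl | h)
        · exact ⟨hN, Or.inl rfl⟩
        · tauto
    rw [e, h.count]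
    split_ifs with h0
    · rw [Finset.card_insert_of_notMem]
      simp [h0]
    · rw [Finset.insert_eq_of_mem]
      simp only [Finset.mem_filter, Finset.mem_range]
      exact ⟨hN, Nat.pos_of_ne_zero h0⟩
  · have e : (fun z => s'.narr 5 z 0) =
        Function.update (fun z => s.narr 5 z 0) x (s.narr 5 x 0 + 1) := by
      ext z
      rw [hdeg, Function.update_apply]
    have hs := sum_update_succ (f := fun z => s.narr 5 z 0) (Finset.mem_range.2 hN)
    rw [h.sum] at hs
    rw [← hs]
    exact congrArg (fun f : ℕ → ℕ => ∑ z ∈ Finset.range N, f z) e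

/-- The first `k` edges of the list join `x` and `y`. -/
def arcs (ends : ℕ → Sym2 ℕ) (k x y : ℕ) : Prop :=
  ∃ k' < k, ends k' = s(x, y)

theorem arcs_symm {ends : ℕ → Sym2 ℕ} {k x y : ℕ} (h : arcs ends k x y) : arcs ends k y x := by
  obtain ⟨k', hk, h⟩ := h
  exact ⟨k', hk, h.trans Sym2.eq_swap⟩

theorem readBody_loopFree : readBody.LoopFree := by
  simp [readBody, linkProg, Prog.LoopFree]

/-- The list of the edges of a graph in the memory. -/
structure EdgeInput (N m : ℕ) (ea eb : ℕ → ℕ) : Prop where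
  ea_lt : ∀ k < m, ea k < N
  eb_lt : ∀ k < m, eb k < N
  ne : ∀ k < m, ea k ≠ eb k
  inj : ∀ k < m, ∀ k' < m, s(ea k, eb k) = s(ea k', eb k') → k = k'

theorem Linked.readBody {N m : ℕ} {ea eb : ℕ → ℕ} (he : EdgeInput N m ea eb) {s : Mem}
    (tab : ℕ → ℕ → ℕ → ℝ) (hea : ∀ k < m, s.narr 0 k 0 = ea k)
    (heb : ∀ k < m, s.narr 1 k 0 = eb k) (hk : s.nvar 4 < m)
    (h : Linked N m (fun k => s(ea k, eb k)) (arcs (fun k => s(ea k, eb k)) (s.nvar 4))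
      (2 * s.nvar 4) s) :
    (readBody.run tab s).nvar 4 = s.nvar 4 + 1 ∧
    Linked N m (fun k => s(ea k, eb k))
      (arcs (fun k => s(ea k, eb k)) (s.nvar 4 + 1)) (2 * (s.nvar 4 + 1))
      (readBody.run tab s) := by
  set s₁ : Mem :=
    { s with
      nvar := Function.update (Function.update s.nvar 5 (ea (s.nvar 4))) 6 (eb (s.nvar 4)) }
    with hs₁
  set s₂ := (linkProg (.var 5) (.var 6)).run tab s₁ with hs₂
  set s₃ := (linkProg (.var 6) (.var 5)).run tab s₂ with hs₃
  have hrun : ChordalSigns.readBody.run tab s =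
      { s₃ with nvar := Function.update s₃.nvar 4 (s₃.nvar 4 + 1) } := by
    simp only [ChordalSigns.readBody, Prog.run, hs₃, hs₂, hs₁, NExp.eval]
    simp [hea _ hk, heb _ hk]
  have h1 : Linked N m (fun k => s(ea k, eb k)) (arcs (fun k => s(ea k, eb k)) (s.nvar 4))
      (2 * s.nvar 4) s₁ := ⟨h.adj, h.edge, h.stk_pos, h.stk_surj, h.count, h.sum⟩
  have hv₂ : ∀ x, x ≠ 2 → s₂.nvar x = s₁.nvar x := fun x hx =>
    Prog.run_nvar_eq (linkProg_loopFree _ _) (by simp [linkProg, Prog.KeepsVar, hx])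
  have hv₃ : ∀ x, x ≠ 2 → s₃.nvar x = s₂.nvar x := fun x hx =>
    Prog.run_nvar_eq (linkProg_loopFree _ _) (by simp [linkProg, Prog.KeepsVar, hx])
  have e4 : s₁.nvar 4 = s.nvar 4 := by simp [hs₁]
  have e5 : s₁.nvar 5 = ea (s.nvar 4) := by simp [hs₁]
  have e6 : s₁.nvar 6 = eb (s.nvar 4) := by simp [hs₁]
  have hnot : ∀ x y, s(ea (s.nvar 4), eb (s.nvar 4)) = s(x, y) →
      ¬ arcs (fun k => s(ea k, eb k)) (s.nvar 4) x y := by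
    rintro x y hxy ⟨k', hk', h⟩
    have := he.inj k' (hk'.trans hk) _ hk (h.trans hxy.symm)
    omega
  have h2 := h1.link tab (a := 5) (b := 6) (by norm_num) (by norm_num)
    (by rw [e5, e6]; exact hnot _ _ rfl) (by rw [e5]; exact he.ea_lt _ hk) (by rwa [e4])
    (by rw [e4, e5, e6])
  rw [← hs₂, e5, e6] at h2
  have f4 := (hv₂ 4 (by norm_num)).trans e4
  have f5 := (hv₂ 5 (by norm_num)).trans e5
  have f6 := (hv₂ 6 (by norm_num)).trans e6
  -- The reverse direction is also new, because the endpoints differ.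
  have h3 := h2.link tab (a := 6) (b := 5) (by norm_num) (by norm_num)
    (by
      rw [f5, f6]
      rintro (h | ⟨h, -⟩)
      · exact hnot _ _ Sym2.eq_swap h
      · exact he.ne _ hk h.symm)
    (by rw [f6]; exact he.eb_lt _ hk) (by rwa [f4])
    (by rw [f4, f5, f6]; exact Sym2.eq_swap)
  rw [← hs₃, f5, f6] at h3
  have g4 := (hv₃ 4 (by norm_num)).trans f4
  rw [hrun]
  refine ⟨by simp [g4], ?_⟩
  have earcs : arcs (fun k => s(ea k, eb k)) (s.nvar 4 + 1) = fun u w =>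
      (arcs (fun k => s(ea k, eb k)) (s.nvar 4) u w ∨ u = ea (s.nvar 4) ∧ w = eb (s.nvar 4)) ∨
        u = eb (s.nvar 4) ∧ w = ea (s.nvar 4) := by
    ext u w
    constructor
    · rintro ⟨k', hk', h⟩
      rcases Nat.lt_succ_iff_lt_or_eq.1 hk' with hlt | rfl
      · exact Or.inl (Or.inl ⟨k', hlt, h⟩)
      · rcases Sym2.eq_iff.1 h with ⟨rfl, rfl⟩ | ⟨rfl, rfl⟩
        · exact Or.inl (Or.inr ⟨rfl, rfl⟩)
        · exact Or.inr ⟨rfl, rfl⟩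
    · rintro ((⟨k', hk', h⟩ | ⟨rfl, rfl⟩) | ⟨rfl, rfl⟩)
      · exact ⟨k', hk'.trans (Nat.lt_succ_self _), h⟩
      · exact ⟨_, Nat.lt_succ_self _, rfl⟩
      · exact ⟨_, Nat.lt_succ_self _, Sym2.eq_swap⟩
  rw [earcs]
  have e2 : (Function.update s₃.nvar 4 (s₃.nvar 4 + 1)) 2 = s₃.nvar 2 := by simp
  refine ⟨h3.adj, h3.edge, ?_, ?_, ?_, ?_⟩
  · simpa using h3.stk_pos
  · simpa using h3.stk_surj
  · simpa using h3.count
  · rw [h3.sum]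
    ring

theorem exec_read {N m : ℕ} {ea eb : ℕ → ℕ} (he : EdgeInput N m ea eb) {s : Mem}
    (tab : ℕ → ℕ → ℕ → ℝ) (hm : s.nvar 1 = m) (hea : ∀ k < m, s.narr 0 k 0 = ea k)
    (heb : ∀ k < m, s.narr 1 k 0 = eb k) (h2 : s.nvar 2 = 0) (h4 : s.nvar 4 = 0)
    (h5 : ∀ x, s.narr 5 x 0 = 0) :
    ∃ t s', Exec tab (.loop readTest readBody) s t s' ∧
      t ≤ (readBody.bound + readTest.cost + 1) * (m + 1) ∧
      Linked N m (fun k => s(ea k, eb k)) (arcs (fun k => s(ea k, eb k)) m) (2 * m) s' := by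
  obtain ⟨t, s', h1, h2, h3, h4'⟩ := Prog.exec_loop tab readTest readBody readBody_loopFree
    (fun s => s.nvar 1 = m ∧ (∀ k < m, s.narr 0 k 0 = ea k) ∧ (∀ k < m, s.narr 1 k 0 = eb k) ∧
      s.nvar 4 ≤ m ∧ Linked N m (fun k => s(ea k, eb k))
        (arcs (fun k => s(ea k, eb k)) (s.nvar 4)) (2 * s.nvar 4) s)
    (fun s => m - s.nvar 4)
    (fun s₁ ⟨hm, hea, heb, hle, hs⟩ hb => by
      change s₁.nvar 4 < s₁.nvar 1 at hb
      rw [hm] at hb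
      obtain ⟨h1, h2⟩ := hs.readBody he tab hea heb hb
      rw [h1, Prog.run_nvar_eq readBody_loopFree (x := 1)
          (by simp [readBody, linkProg, Prog.KeepsVar]),
        Prog.run_narr_eq readBody_loopFree (a := 0)
          (by simp [readBody, linkProg, Prog.KeepsArr]),
        Prog.run_narr_eq readBody_loopFree (a := 1)
          (by simp [readBody, linkProg, Prog.KeepsArr])]
      exact ⟨⟨hm, hea, heb, hb, h2⟩, by omega⟩) s ⟨hm, hea, heb, by omega, by
        rw [h4]
        have hno : ∀ x y, ¬ arcs (fun k => s(ea k, eb k)) 0 x y := by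
          rintro x y ⟨k, hk, -⟩
          omega
        refine ⟨⟨?_, ?_, ?_, ?_⟩, ?_, ?_, ?_, ?_, ?_⟩
        · exact fun x y h => absurd h (hno x y)
        · intro x i hi
          rw [h5] at hi
          omega
        · exact fun x y h => absurd h (hno x y)
        · intro x i i' hi
          rw [h5] at hi
          omega
        · exact fun x y h => absurd h (hno x y)
        · intro i hi
          omega
        · intro x hx
          rw [h5] at hx
          omega
        · simp [h5, h2]
        · simp [h5]⟩
  refine ⟨t, s', h1, h2.trans (Nat.mul_le_mul_left _ (by omega)), ?_⟩
  obtain ⟨hm', -, -, hle, hl⟩ := h3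
  change ¬ s'.nvar 4 < s'.nvar 1 at h4'
  rw [show s'.nvar 4 = m by omega] at hl
  exact hl


/-! ## The beginning of the search -/

theorem searchInit_loopFree : searchInit.LoopFree := by
  simp [searchInit, Prog.LoopFree]

/-- The degree sum is `c` and every listed vertex has positive degree, so there are at most `c`
listed vertices. They contribute `c` to the potential as entries of the stack of label `0`, and `3 *
c` through their degrees. -/
theorem Linked.searching {N m : ℕ} {ends : ℕ → Sym2 ℕ} {A : ℕ → ℕ → Prop} {c : ℕ} {s : Mem}
    (h : Linked N m ends A c s) (tab : ℕ → ℕ → ℕ → ℝ)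
    (h8 : s.nvar 8 = 0) (h9 : s.nvar 9 = 0) (h10 : s.nvar 10 = 0)
    (ha8 : ∀ x, s.narr 8 x 0 = 0) (ha10 : ∀ x, s.narr 10 x 0 = 0)
    (ha11 : ∀ x, s.narr 11 x 0 = 0) (ha13 : ∀ x, s.narr 13 x 0 = 0) :
    Searching N A (searchInit.run tab s).store ∧
      potential N (searchInit.run tab s).store ≤ 4 * c ∧
      (searchInit.run tab s).store.n ≤ N ∧ s.nvar 2 ≤ c := by
  classical
  have e : (searchInit.run tab s).store =
      { s.store with
        p := s.nvar 2
        cnt := Function.update (fun _ : ℕ => (0 : ℕ)) 0 (s.nvar 2) } := by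
    ext <;>
      simp [searchInit, Prog.run, NExp.eval, Mem.store, upd2_apply, Function.update_apply, ha8]
  obtain ⟨st, hst⟩ : ∃ st : Store, st = { s.store with
        p := s.nvar 2
        cnt := Function.update (fun _ : ℕ => (0 : ℕ)) 0 (s.nvar 2) } := ⟨_, rfl⟩
  rw [e, ← hst]
  have hr : st.r = 0 := by rw [hst]; exact h9
  have hd : st.d = 0 := by rw [hst]; exact h10
  have hj : st.j = 0 := by rw [hst]; exact h8
  have hvis : ∀ x, st.vis x = 0 := by rw [hst]; exact ha11
  have hlab : ∀ x, st.lab x = 0 := by rw [hst]; exact ha10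
  have hbsz : ∀ x, st.bsz x = 0 := by rw [hst]; exact ha13
  have hcnt : ∀ k, st.cnt k = if k = 0 then s.nvar 2 else 0 := by
    intro k
    rw [hst]
    simp [Function.update_apply]
  have hp : st.p = s.nvar 2 := by rw [hst]
  have hn : st.n = s.nvar 2 := by rw [hst]; rfl
  have hdeg : ∀ x, st.deg x = s.narr 5 x 0 := by
    intro x
    rw [hst]
    rfl
  have hstk : st.stk = s.narr 9 := by rw [hst]; rfl
  have hun : unvisited N st = (Finset.range N).filter fun x => 0 < s.narr 5 x 0 := by
    ext x
    rw [mem_unvisited]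
    simp [hvis, hdeg]
  have hnp : ∀ x, ¬ st.Pending x := not_pending (by omega)
  have hcard : (unvisited N st).card = s.nvar 2 := by
    rw [hun, h.count]
  have h1 : ∑ w ∈ unvisited N st, st.deg w ≤ c := by
    rw [← h.sum]
    simp only [hdeg]
    exact Finset.sum_le_sum_of_subset (Finset.filter_subset _ _)
  have h2 : s.nvar 2 ≤ ∑ w ∈ unvisited N st, st.deg w := by
    rw [← hcard, Finset.card_eq_sum_ones]
    exact Finset.sum_le_sum fun w hw => (mem_unvisited.1 hw).2.1
  refine ⟨?_, ?_, ?_, h2.trans h1⟩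
  · refine ⟨by omega, by omega, by omega, fun w hw => absurd (hvis w) hw, by omega, by omega,
      by omega, by omega, ?_, fun w y _ hy => absurd (hvis y) hy,
      fun a b c ha => absurd (hvis a) ha, ?_, ?_, ?_, fun w _ hw => absurd hw (hnp w), ?_,
      fun x w hx => absurd (hvis x) hx, ?_⟩
    · intro w _
      rw [if_neg (hnp w), hlab, eq_comm, Nat.add_zero, Finset.card_eq_zero]
      ext x
      rw [mem_visitedNbrs]
      simp [hvis]
    · intro k i hi
      rw [hcnt] at hi
      split_ifs at hi with hk
      · subst hk
        rw [hdeg, hstk]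
        exact ⟨h.stk_pos i hi, fun _ => Nat.zero_le _⟩
      · omega
    · intro w hw _
      rw [hlab, hcnt, if_pos rfl, hstk]
      rw [hdeg] at hw
      exact h.stk_surj w hw
    · intro k hk
      rw [hcnt, if_neg (by omega)]
    · intro w i hi
      rw [hbsz] at hi
      omega
    · intro w i i' _ hi
      rw [hbsz] at hi
      omega
  · have h3 : ∑ k ∈ Finset.range (N + 1), st.cnt k = s.nvar 2 := by
      simp [hcnt]
    unfold potential
    rw [h3]
    simp only [hbsz, Finset.sum_const_zero]
    omega
  · rw [hn, h.count]
    exact (Finset.card_filter_le _ _).trans_eq (Finset.card_range N)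

/-! ## Marking the forest -/

theorem markBody_loopFree : markBody.LoopFree := by
  simp [markBody, Prog.LoopFree]

/-- The edge between `x` and `y` joins a vertex `v_i` to `v_{i*}`. -/
def ForestPair (par pos : ℕ → ℕ) (x y : ℕ) : Prop :=
  (par x = y ∧ pos x < pos y) ∨ (par y = x ∧ pos y < pos x)

theorem markTest_holds (tab : ℕ → ℕ → ℕ → ℝ) (s : Mem) :
    markTest.holds tab s ↔ ForestPair (fun x => s.narr 12 x 0) (fun x => s.narr 15 x 0)
      (s.nvar 5) (s.nvar 6) := by
  simp only [markTest, forestTest, Test.holds, NExp.eval, ForestPair]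
  tauto

open scoped Classical in
theorem exec_mark {m : ℕ} {ea eb par pos : ℕ → ℕ} {s : Mem} (tab : ℕ → ℕ → ℕ → ℝ)
    (hm : s.nvar 1 = m) (hea : ∀ k < m, s.narr 0 k 0 = ea k)
    (heb : ∀ k < m, s.narr 1 k 0 = eb k) (hpar : ∀ x, s.narr 12 x 0 = par x)
    (hpos : ∀ x, s.narr 15 x 0 = pos x) (h4 : s.nvar 4 = 0)
    (h3 : ∀ k, s.narr 3 k 0 = 0) (hr : ∀ k, s.rarr 1 k 0 = 0) :
    ∃ t s', Exec tab (.loop readTest markBody) s t s' ∧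
      t ≤ (markBody.bound + readTest.cost + 1) * (m + 1) ∧
      ∀ k < m, (s'.narr 3 k 0 = if ForestPair par pos (ea k) (eb k) then 1 else 0) ∧
        s'.rarr 1 k 0 = if ForestPair par pos (ea k) (eb k) then 1 else 0 := by
  obtain ⟨t, s', h1, h2, h3, h4'⟩ := Prog.exec_loop tab readTest markBody markBody_loopFree
    (fun s => s.nvar 1 = m ∧ (∀ k < m, s.narr 0 k 0 = ea k) ∧ (∀ k < m, s.narr 1 k 0 = eb k) ∧
      (∀ x, s.narr 12 x 0 = par x) ∧ (∀ x, s.narr 15 x 0 = pos x) ∧ s.nvar 4 ≤ m ∧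
      ∀ k, (s.narr 3 k 0 = if k < s.nvar 4 ∧ ForestPair par pos (ea k) (eb k) then 1 else 0) ∧
        s.rarr 1 k 0 = if k < s.nvar 4 ∧ ForestPair par pos (ea k) (eb k) then 1 else 0)
    (fun s => m - s.nvar 4)
    (fun s₁ ⟨hm, hea, heb, hpar, hpos, hle, hs⟩ hb => by
      change s₁.nvar 4 < s₁.nvar 1 at hb
      rw [hm] at hb
      have epar : (fun x => s₁.narr 12 x 0) = par := funext hpar
      have epos : (fun x => s₁.narr 15 x 0) = pos := funext hpos
      have e4 : (markBody.run tab s₁).nvar 4 = s₁.nvar 4 + 1 ∧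
          ∀ k, ((markBody.run tab s₁).narr 3 k 0 =
            if k = s₁.nvar 4 ∧ ForestPair par pos (ea (s₁.nvar 4)) (eb (s₁.nvar 4)) then 1
            else s₁.narr 3 k 0) ∧ ((markBody.run tab s₁).rarr 1 k 0 =
            if k = s₁.nvar 4 ∧ ForestPair par pos (ea (s₁.nvar 4)) (eb (s₁.nvar 4)) then 1
            else s₁.rarr 1 k 0) := by
        simp only [markBody, Prog.run, markTest_holds, NExp.eval]
        by_cases hf : ForestPair par pos (ea (s₁.nvar 4)) (eb (s₁.nvar 4)) <;>
          simp [hea _ hb, heb _ hb, epar, epos, hf, upd2_apply, RExp.eval]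
      obtain ⟨e4, e3⟩ := e4
      rw [e4, Prog.run_nvar_eq markBody_loopFree (x := 1) (by simp [markBody, Prog.KeepsVar]),
        Prog.run_narr_eq markBody_loopFree (a := 0) (by simp [markBody, Prog.KeepsArr]),
        Prog.run_narr_eq markBody_loopFree (a := 1) (by simp [markBody, Prog.KeepsArr]),
        Prog.run_narr_eq markBody_loopFree (a := 12) (by simp [markBody, Prog.KeepsArr]),
        Prog.run_narr_eq markBody_loopFree (a := 15) (by simp [markBody, Prog.KeepsArr])]
      refine ⟨⟨hm, hea, heb, hpar, hpos, hb, fun k => ?_⟩, by omega⟩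
      rw [(e3 k).1, (e3 k).2, (hs k).1, (hs k).2]
      by_cases hk : k = s₁.nvar 4
      · subst hk
        simp
      · have : k < s₁.nvar 4 + 1 ↔ k < s₁.nvar 4 := by omega
        simp [hk, this]) s ⟨hm, hea, heb, hpar, hpos, by omega, fun k => by
          rw [h3, hr, h4]
          simp⟩
  refine ⟨t, s', h1, h2.trans (Nat.mul_le_mul_left _ (by omega)), fun k hk => ?_⟩
  obtain ⟨hm', -, -, -, -, hle, hl⟩ := h3
  change ¬ s'.nvar 4 < s'.nvar 1 at h4'
  simpa [show k < s'.nvar 4 by omega] using hl k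


/-! ## The ordering found by the search -/

/-- The search is over: `v` is the ordering of the vertices of `G` that it found. -/
structure Found {N : ℕ} (G : SimpleGraph (Fin N)) (A : ℕ → ℕ → Prop) (st : Store)
    (v : Fin N ≃ Fin N) : Prop where
  adj_iff : ∀ x y : Fin N, A x y ↔ G.Adj x y
  symm : ∀ x y, A x y → A y x
  lt : ∀ x y, A x y → x < N
  searching : Searching N A st
  le_r : st.d ≤ st.r
  n_le : st.n ≤ N
  lt_iff : ∀ t : Fin N, (t : ℕ) < st.n ↔ ∃ w, G.Adj (v t) w
  ord_eq : ∀ t : Fin N, (t : ℕ) < st.n → st.ord t = v t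
  vis_iff : ∀ x : Fin N, st.vis x ≠ 0 ↔ ∃ w, G.Adj x w
  pos_eq : ∀ x : Fin N, st.vis x ≠ 0 → st.pos x = v.symm x

/-- With all non-isolated vertices visited, `ord` and `pos` are inverse bijections between the first
`n` positions and these vertices. Any extension to a permutation places the isolated vertices last.
-/
theorem Searching.exists_found {N : ℕ} {G : SimpleGraph (Fin N)} {A : ℕ → ℕ → Prop} {st : Store}
    (h : Searching N A st) (hA : Adjacency N A st.deg st.nbr) (hsymm : ∀ x y, A x y → A y x)
    (hAG : ∀ x y : Fin N, A x y ↔ G.Adj x y) (hp : st.p = 0) (hr : st.d ≤ st.r)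
    (hn : st.n ≤ N) : ∃ v, Found G A st v := by
  classical
  have hdeg : ∀ x : Fin N, 0 < st.deg x ↔ ∃ w, G.Adj x w := by
    intro x
    rw [hA.deg_pos_iff]
    constructor
    · rintro ⟨y, hy⟩
      exact ⟨⟨y, hA.lt _ _ (hsymm _ _ hy)⟩, (hAG _ _).1 hy⟩
    · rintro ⟨y, hy⟩
      exact ⟨y, (hAG _ _).2 hy⟩
  have hvis : ∀ x : Fin N, st.vis x ≠ 0 ↔ ∃ w, G.Adj x w := by
    intro x
    rw [← hdeg]
    refine ⟨fun hx => (h.vis_pos x hx).2.2.2, fun hx hv => ?_⟩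
    have hc := h.count
    rw [hp, Finset.card_eq_zero] at hc
    have : (x : ℕ) ∈ unvisited N st := mem_unvisited.2 ⟨x.2, hx, hv⟩
    rw [hc] at this
    simp at this
  have hordv : ∀ t, t < st.n → st.vis (st.ord t) ≠ 0 ∧ st.pos (st.ord t) = t := fun t ht =>
    h.ord_vis t (by omega) ht
  have hordN : ∀ t, t < st.n → st.ord t < N := fun t ht => by
    obtain ⟨y, hy⟩ := (hA.deg_pos_iff _).1 (h.vis_pos _ (hordv t ht).1).2.2.2
    exact hA.lt _ _ hy
  let f : {t : Fin N // (t : ℕ) < st.n} ≃ {x : Fin N // ∃ w, G.Adj x w} :=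
    { toFun := fun t => ⟨⟨st.ord t, hordN _ t.2⟩, (hvis _).1 (hordv _ t.2).1⟩
      invFun := fun x => ⟨⟨st.pos x, ((h.vis_pos x ((hvis _).2 x.2)).2.1).trans_le hn⟩,
        (h.vis_pos x ((hvis _).2 x.2)).2.1⟩
      left_inv := fun t => Subtype.ext (Fin.ext (hordv _ t.2).2)
      right_inv := fun x => Subtype.ext (Fin.ext (h.vis_pos x ((hvis _).2 x.2)).2.2.1) }
  have hv1 : ∀ t : Fin N, (t : ℕ) < st.n → st.ord t = f.extendSubtype t := fun t ht => by
    rw [f.extendSubtype_apply_of_mem t ht]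
    rfl
  refine ⟨f.extendSubtype, hAG, hsymm, hA.lt, h, hr, hn, fun t => ⟨fun ht => ?_, fun ht => ?_⟩, hv1,
    hvis, fun x hx => ?_⟩
  · exact f.extendSubtype_mem t ht
  · by_contra ht'
    exact f.extendSubtype_not_mem t ht' ht
  · obtain ⟨h1, h2, h3, h4⟩ := h.vis_pos x hx
    have h5 := hv1 ⟨st.pos x, h2.trans_le hn⟩ h2
    have h6 : f.extendSubtype ⟨st.pos x, h2.trans_le hn⟩ = x := by
      apply Fin.ext
      rw [← h5]
      exact h3
    rw [← h6, Equiv.symm_apply_apply, h6]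

section Found

variable {N : ℕ} {G : SimpleGraph (Fin N)} {A : ℕ → ℕ → Prop} {st : Store} {v : Fin N ≃ Fin N}

theorem Found.vis_of_adj (h : Found G A st v) {x y : Fin N} (hxy : G.Adj x y) :
    st.vis x ≠ 0 :=
  (h.vis_iff x).2 ⟨y, hxy⟩

theorem Found.pos_apply (h : Found G A st v) {i : Fin N} (hi : st.vis (v i) ≠ 0) :
    st.pos (v i) = i := by
  rw [h.pos_eq _ hi, Equiv.symm_apply_apply]

theorem Found.exists_index (h : Found G A st v) {x : ℕ} (hx : st.vis x ≠ 0) :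
    ∃ i : Fin N, x = v i ∧ st.pos x = i := by
  obtain ⟨h1, h2, h3, h4⟩ := h.searching.vis_pos x hx
  refine ⟨⟨st.pos x, h2.trans_le h.n_le⟩, ?_, rfl⟩
  rw [← h.ord_eq _ h2]
  exact h3.symm

theorem Found.isPEO (h : Found G A st v) (hG : IsChordal G) : IsPEO G v := by
  refine isPEO_of_maxNbhdSearch hG v ?_
  intro a b c hcb hba hac hab
  have ha := h.vis_of_adj hac
  have hc := h.vis_of_adj hac.symm
  -- The search property must cover every `b`, but one placed before the non-isolated vertex `a`
  -- cannot be isolated.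
  have hb : st.vis b ≠ 0 := by
    rw [h.vis_iff]
    have h1 := (h.lt_iff (v.symm b)).1 (by
      have := (h.searching.vis_pos a ha).2.1
      rw [h.pos_eq a ha] at this
      exact hba.trans this)
    simpa using h1
  simp only [← h.pos_eq _ ha, ← h.pos_eq _ hb, ← h.pos_eq _ hc] at hba hcb ⊢
  obtain ⟨d, hd1, hd2, hd3, hd4⟩ := h.searching.search a b c ha hb hba (Or.inr hcb)
    ((h.adj_iff _ _).2 hac) fun h' => hab ((h.adj_iff _ _).1 h')
  have hdN := h.lt _ _ hd3
  refine ⟨⟨d, hdN⟩, ?_, (h.adj_iff ⟨d, hdN⟩ b).1 hd3, fun h' => hd4 ((h.adj_iff ⟨d, hdN⟩ c).2 h')⟩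
  rw [← h.pos_eq ⟨d, hdN⟩ hd1]
  exact hd2

/-- The recorded vertex is a later neighbour, so its position is at least `i*`; the invariant `par`
with `y = v_{i*}` gives the other inequality. -/
theorem Found.par_eq (h : Found G A st v) {i : Fin N} (hi : (later G v i).Nonempty) :
    st.par (v i) = v (star G v i) := by
  obtain ⟨hlt, hadj⟩ := mem_later.1 (star_mem hi)
  have hvi := h.vis_of_adj hadj
  have hvs := h.vis_of_adj hadj.symm
  obtain ⟨h1, h2, h3, h4⟩ := h.searching.par (v i) (v (star G v i)) ((h.adj_iff _ _).2 hadj) hvs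
    (Or.inr (by rw [h.pos_apply hvi, h.pos_apply hvs]; exact hlt)) fun h' => hvi h'.1
  replace h3 := h3.resolve_left hvi
  obtain ⟨j, hj, hpj⟩ := h.exists_index h2
  rw [hj] at h1
  rw [hpj, h.pos_apply hvi] at h3
  rw [hpj, h.pos_apply hvs] at h4
  have h5 : star G v i ≤ j := star_le (mem_later.2 ⟨h3, (h.adj_iff _ _).1 h1⟩)
  rw [hj, le_antisymm (show j ≤ star G v i from h4) h5]

theorem Found.par_eq_iff (h : Found G A st v) {i j : Fin N} (hij : i < j)
    (hadj : G.Adj (v i) (v j)) : st.par (v i) = v j ↔ s(v i, v j) ∈ forestEdges G v := by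
  have hj := mem_later.2 ⟨hij, hadj⟩
  rw [mem_forestEdges hij, and_iff_right hj, h.par_eq ⟨j, hj⟩]
  constructor
  · intro h1
    exact v.injective (Fin.ext h1)
  · rintro rfl
    rfl

theorem Found.forestPair_iff (h : Found G A st v) {x y : Fin N} (hadj : G.Adj x y) :
    ForestPair st.par st.pos x y ↔ s(x, y) ∈ forestEdges G v := by
  have key : ∀ i j : Fin N, i < j → G.Adj (v i) (v j) →
      (ForestPair st.par st.pos (v i) (v j) ↔ s(v i, v j) ∈ forestEdges G v) := by
    intro i j hij hadj
    rw [← h.par_eq_iff hij hadj, ForestPair, h.pos_apply (h.vis_of_adj hadj),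
      h.pos_apply (h.vis_of_adj hadj.symm)]
    have : (i : ℕ) < j := hij
    simp [this, this.asymm]
  obtain ⟨i, rfl⟩ := v.surjective x
  obtain ⟨j, rfl⟩ := v.surjective y
  rcases lt_trichotomy i j with hij | rfl | hij
  · exact key i j hij hadj
  · exact absurd hadj (G.loopless.irrefl _)
  · rw [Sym2.eq_swap, ← key j i hij hadj.symm]
    exact or_comm

theorem Found.bkt_mem (h : Found G A st v) {j : Fin N} {r : ℕ} (hr : r < st.bsz (v j)) :
    ∃ i, st.bkt (v j) r = v i ∧ i < j ∧ G.Adj (v i) (v j) ∧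
      s(v i, v j) ∉ forestEdges G v := by
  obtain ⟨h1, h2, h3, h4, h5, -⟩ := h.searching.bkt_mem (v j) r hr
  obtain ⟨i, hi, hpi⟩ := h.exists_index h1
  rw [hpi, h.pos_apply h2] at h4
  rw [hi] at h3 h5
  have hadj := (h.adj_iff _ _).1 h3
  exact ⟨i, hi, h4, hadj, fun h6 => h5 ((h.par_eq_iff h4 hadj).2 h6)⟩

theorem Found.bkt_surj (h : Found G A st v) {i j : Fin N} (hij : i < j)
    (hadj : G.Adj (v i) (v j)) (hf : s(v i, v j) ∉ forestEdges G v) :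
    ∃ r < st.bsz (v j), st.bkt (v j) r = v i := by
  have hi := h.vis_of_adj hadj
  have hj := h.vis_of_adj hadj.symm
  exact h.searching.bkt_surj (v i) (v j) hi hj ((h.adj_iff _ _).2 hadj)
    (by rw [h.pos_apply hi, h.pos_apply hj]; exact hij)
    (fun h6 => hf ((h.par_eq_iff hij hadj).1 h6)) fun h6 => not_pending h.le_r _ h6.2

theorem Found.bkt_sorted (h : Found G A st v) {i i' j : Fin N} {r r' : ℕ} (hrr : r < r')
    (hr : r' < st.bsz (v j)) (hi : st.bkt (v j) r = v i) (hi' : st.bkt (v j) r' = v i') :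
    i' < i := by
  have h1 := h.searching.bkt_sorted (v j) r r' hrr hr
  have h2 := (h.searching.bkt_mem (v j) r (hrr.trans hr)).1
  have h3 := (h.searching.bkt_mem (v j) r' hr).1
  rw [hi] at h1 h2
  rw [hi'] at h1 h3
  rwa [h.pos_apply h2, h.pos_apply h3] at h1

end Found


/-! ## Visiting the edges outside the forest -/

/-- The value of `statExp`. -/
def statVal (tab : ℕ → ℕ → ℕ → ℝ) (a b c : ℕ) : ℝ :=
  tab a b c - (tab a a a * tab b b b * tab c c c -
    (tab a a a * tab b b b - tab a b b) * tab c c c -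
    (tab a a a * tab c c c - tab a c c) * tab b b b -
    (tab b b b * tab c c c - tab b c c) * tab a a a)

theorem statVal_minorTable {N : ℕ} (Δ : Finset (Fin N) → ℝ) (a b c : Fin N) :
    statVal (minorTable Δ) a b c = triangleStat Δ a b c := by
  simp [statVal, minorTable, triangleStat]

theorem run_signProg (tab : ℕ → ℕ → ℕ → ℝ) (s : Mem) :
    signProg.run tab s =
      { s with rvar := Function.update s.rvar 1 (SignType.sign (s.rvar 0) : ℝ) } := by
  rcases lt_trichotomy (s.rvar 0) 0 with h | h | h
  · simp [signProg, Prog.run, Test.holds, RExp.eval, h, h.not_gt, sign_neg]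
  · simp [signProg, Prog.run, Test.holds, RExp.eval, h]
  · simp [signProg, Prog.run, Test.holds, RExp.eval, h, sign_pos]

theorem run_visitBody (tab : ℕ → ℕ → ℕ → ℝ) {s : Mem} (h : s.nvar 9 < s.nvar 10) {u x k : ℕ}
    (hu : s.narr 14 (s.nvar 12) (s.nvar 9) = u) (hx : s.narr 12 u 0 = x)
    (hk : s.narr 7 u (s.nvar 12) = k) {s' : Mem} (hs' : s' = visitBody.run tab s) :
    s'.nvar 7 = s.nvar 7 ∧ s'.nvar 9 = s.nvar 9 + 1 ∧ s'.nvar 10 = s.nvar 10 ∧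
    s'.nvar 12 = s.nvar 12 ∧ s'.nvar 3 = s.nvar 3 + 1 ∧
    (∀ t, s'.narr 4 t 0 = if t = s.nvar 3 then k else s.narr 4 t 0) ∧
    (∀ l, s'.rarr 0 l 0 = if l = k then statVal tab u (s.nvar 12) x else s.rarr 0 l 0) ∧
    (∀ l, s'.rarr 1 l 0 = if l = k then
        (SignType.sign (statVal tab u (s.nvar 12) x) : ℝ) *
          s.rarr 1 (s.narr 7 u x) 0 * s.rarr 1 (s.narr 7 (s.nvar 12) x) 0
      else s.rarr 1 l 0) := by
  have hsign := run_signProg tab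
  subst hs' hu hx hk
  simp only [visitBody, Prog.run, Test.holds, NExp.eval, if_pos h, hsign]
  refine ⟨?_, ?_, ?_, ?_, ?_, fun t => ?_, fun l => ?_, fun l => ?_⟩ <;>
    simp [upd2_apply, RExp.eval, NExp.eval, statExp, diagExp, offExp, statVal]

theorem run_visitBody_next (tab : ℕ → ℕ → ℕ → ℝ) {s : Mem} (h : ¬ s.nvar 9 < s.nvar 10)
    {s' : Mem} (hs' : s' = visitBody.run tab s) :
    s'.nvar 7 = s.nvar 7 - 1 ∧ s'.nvar 9 = 0 ∧
    s'.nvar 12 = s.narr 2 (s.nvar 7 - 1) 0 ∧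
    s'.nvar 10 = s.narr 13 (s.narr 2 (s.nvar 7 - 1) 0) 0 ∧
    s'.nvar 3 = s.nvar 3 ∧ s'.narr = s.narr ∧ s'.rarr = s.rarr := by
  subst hs'
  simp [visitBody, Prog.run, Test.holds, NExp.eval, h]

theorem visitBody_loopFree : visitBody.LoopFree := by
  simp [visitBody, signProg, Prog.LoopFree]

/-- The results of the search are in the memory, and `L` lists the edges that have been visited. -/
structure Visiting {N m : ℕ} (G : SimpleGraph (Fin N)) (e : Fin m → Fin N × Fin N)
    (Δ : Finset (Fin N) → ℝ) (v : Fin N ≃ Fin N) (st : Store) (s : Mem)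
    (L : List (Fin N × Fin N)) : Prop where
  ord : ∀ t, s.narr 2 t 0 = st.ord t
  par : ∀ x, s.narr 12 x 0 = st.par x
  bsz : ∀ x, s.narr 13 x 0 = st.bsz x
  bkt : s.narr 14 = st.bkt
  idx : ∀ x y, G.Adj x y → ∃ k : Fin m, s.narr 7 x y = k ∧ s((e k).1, (e k).2) = s(x, y)
  q_le : s.nvar 7 ≤ st.n
  cur : (s.nvar 7 = st.n ∧ s.nvar 9 = 0 ∧ s.nvar 10 = 0) ∨
    ∃ j : Fin N, (j : ℕ) = s.nvar 7 ∧ s.nvar 12 = v j ∧ s.nvar 10 = st.bsz (v j) ∧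
      s.nvar 9 ≤ s.nvar 10
  mem : ∀ i j, (i, j) ∈ L ↔ (i < j ∧ G.Adj (v i) (v j) ∧ s(v i, v j) ∉ forestEdges G v) ∧
    (s.nvar 7 < j ∨ ((j : ℕ) = s.nvar 7 ∧ ∃ r < s.nvar 9, st.bkt (v j) r = v i))
  sorted : L.Pairwise fun p q => q.2 < p.2 ∨ (q.2 = p.2 ∧ q.1 < p.1)
  length : s.nvar 3 = L.length
  visits : ∀ t p, L[t]? = some p → ∃ k : Fin m, s.narr 4 t 0 = (k : ℕ) ∧
    s((e k).1, (e k).2) = s(v p.1, v p.2) ∧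
    s.rarr 0 k 0 = triangleStat Δ (v p.1) (v p.2) (v (star G v p.1))
  signs : ∀ k : Fin m, s.rarr 1 k 0 = (runSigns G v Δ L s((e k).1, (e k).2) : ℝ)

section Visits

variable {N m : ℕ} {G : SimpleGraph (Fin N)} {e : Fin m → Fin N × Fin N}
  {Δ : Finset (Fin N) → ℝ} {v : Fin N ≃ Fin N} {A : ℕ → ℕ → Prop} {st : Store} {s : Mem}
  {L : List (Fin N × Fin N)}

/-- The exhausted bucket contained all edges outside the forest with larger endpoint at the current
position, so the position can be lowered without changing `L`. -/
theorem Visiting.next (h : Visiting G e Δ v st s L) (hf : Found G A st v)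
    (hr : ¬ s.nvar 9 < s.nvar 10) (hq : 0 < s.nvar 7) :
    Visiting G e Δ v st (visitBody.run (minorTable Δ) s) L := by
  obtain ⟨h7, h9, h12, h10, h3, hna, hra⟩ := run_visitBody_next (minorTable Δ) hr rfl
  generalize visitBody.run (minorTable Δ) s = s' at *
  rw [h.bsz, h.ord] at h10
  rw [h.ord] at h12
  have hlt : s.nvar 7 - 1 < st.n := by have := h.q_le; omega
  have hord := hf.ord_eq ⟨s.nvar 7 - 1, hlt.trans_le hf.n_le⟩ hlt
  simp only at hord
  rw [hord] at h10 h12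
  refine ⟨by rw [hna]; exact h.ord, by rw [hna]; exact h.par, by rw [hna]; exact h.bsz,
    by rw [hna]; exact h.bkt, by rw [hna]; exact h.idx, by have := h.q_le; omega,
    Or.inr ⟨_, h7.symm, h12, h10, by omega⟩, fun i j => ?_, h.sorted, h3.trans h.length,
    by rw [hna, hra]; exact h.visits, by rw [hra]; exact h.signs⟩
  rw [h.mem, h7, h9]
  refine and_congr_right fun ⟨hij, hadj, hnf⟩ => ⟨?_, ?_⟩
  · rintro (h1 | ⟨h1, -⟩)
    · left; omega
    · left; omega
  · rintro (h1 | ⟨-, r, hr, -⟩)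
    · by_cases h2 : s.nvar 7 < j
      · exact Or.inl h2
      · refine Or.inr ⟨by omega, ?_⟩
        obtain ⟨r, hr', hb⟩ := hf.bkt_surj hij hadj hnf
        have hjn := (hf.lt_iff j).2 ⟨_, hadj.symm⟩
        rcases h.cur with ⟨h4, -, -⟩ | ⟨j', h4, h5, h6, h7⟩
        · omega
        · obtain rfl : j = j' := Fin.ext (by omega)
          exact ⟨r, by omega, hb⟩
    · exact absurd hr (Nat.not_lt_zero r)

theorem Visiting.visit (h : Visiting G e Δ v st s L) (hf : Found G A st v) (hv : IsPEO G v)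
    (he : Function.Injective fun k => s((e k).1, (e k).2)) (hr : s.nvar 9 < s.nvar 10) :
    ∃ L', Visiting G e Δ v st (visitBody.run (minorTable Δ) s) L' := by
  rcases h.cur with ⟨-, h9, h10⟩ | ⟨j, hj, hw, hd, hrd⟩
  · omega
  obtain ⟨i, hbi, hij, hadj, hnf⟩ := hf.bkt_mem (j := j) (r := s.nvar 9) (by omega)
  have hjl : j ∈ later G v i := mem_later.2 ⟨hij, hadj⟩
  have hst := star_mem ⟨j, hjl⟩
  have hne : star G v i ≠ j := fun h => hnf ((mem_forestEdges hij).2 ⟨hjl, h⟩)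
  have hadj1 := (mem_later.1 hst).2
  have hadj2 := hv.adj hjl hst hne.symm
  obtain ⟨k, hk, hek⟩ := h.idx _ _ hadj
  obtain ⟨k₁, hk₁, hek₁⟩ := h.idx _ _ hadj1
  obtain ⟨k₂, hk₂, hek₂⟩ := h.idx _ _ hadj2
  have hu : s.narr 14 (s.nvar 12) (s.nvar 9) = v i := by rw [h.bkt, hw, hbi]
  have hx : s.narr 12 (v i) 0 = v (star G v i) := by rw [h.par, hf.par_eq ⟨j, hjl⟩]
  obtain ⟨h7, h9, h10, h12, h3, h4, hr0, hr1⟩ :=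
    run_visitBody (minorTable Δ) hr hu hx (k := k) (by rw [hw, hk]) rfl
  have hkeep : ∀ a, a ≠ 4 → (visitBody.run (minorTable Δ) s).narr a = s.narr a := fun a ha =>
    Prog.run_narr_eq visitBody_loopFree (by simp [visitBody, signProg, Prog.KeepsArr, ha])
  generalize visitBody.run (minorTable Δ) s = s' at *
  rw [hw, hk₁, hk₂, h.signs, h.signs, hek₁, hek₂] at hr1
  simp only [hw, statVal_minorTable] at hr0 hr1
  have hmem : ∀ i₁ j₁, (i₁, j₁) ∈ L ++ [(i, j)] ↔
      (i₁ < j₁ ∧ G.Adj (v i₁) (v j₁) ∧ s(v i₁, v j₁) ∉ forestEdges G v) ∧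
      (s.nvar 7 < j₁ ∨ ((j₁ : ℕ) = s.nvar 7 ∧ ∃ r < s.nvar 9 + 1, st.bkt (v j₁) r = v i₁)) := by
    intro i₁ j₁
    rw [List.mem_append, List.mem_singleton, h.mem]
    constructor
    · rintro (⟨h1, h2 | ⟨h2, r, h3, h4⟩⟩ | h1)
      · exact ⟨h1, Or.inl h2⟩
      · exact ⟨h1, Or.inr ⟨h2, r, by omega, h4⟩⟩
      · obtain ⟨rfl, rfl⟩ := Prod.ext_iff.1 h1
        exact ⟨⟨hij, hadj, hnf⟩, Or.inr ⟨hj, _, Nat.lt_succ_self _, hbi⟩⟩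
    · rintro ⟨h1, h2 | ⟨h2, r, h3, hb⟩⟩
      · exact Or.inl ⟨h1, Or.inl h2⟩
      · rcases Nat.lt_succ_iff_lt_or_eq.1 h3 with h5 | rfl
        · exact Or.inl ⟨h1, Or.inr ⟨h2, r, h5, hb⟩⟩
        · obtain rfl : j₁ = j := Fin.ext (by omega)
          rw [hbi] at hb
          rw [v.injective (Fin.ext hb)]
          exact Or.inr rfl
  refine ⟨L ++ [(i, j)], by rw [hkeep 2 (by norm_num)]; exact h.ord,
    by rw [hkeep 12 (by norm_num)]; exact h.par, by rw [hkeep 13 (by norm_num)]; exact h.bsz,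
    by rw [hkeep 14 (by norm_num)]; exact h.bkt, by rw [hkeep 7 (by norm_num)]; exact h.idx,
    by rw [h7]; exact h.q_le,
    Or.inr ⟨j, by rw [h7]; exact hj, by rw [h12, hw], by rw [h10, hd], by omega⟩,
    by rw [h7, h9]; exact hmem, ?_, by rw [h3, h.length]; simp, ?_, ?_⟩
  · rw [List.pairwise_append]
    refine ⟨h.sorted, List.pairwise_singleton _ _, ?_⟩
    rintro ⟨i₁, j₁⟩ hp q hq
    rw [List.mem_singleton] at hq
    subst hq
    obtain ⟨-, h1 | ⟨h1, r, h2, h3⟩⟩ := (h.mem i₁ j₁).1 hp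
    · exact Or.inl (show (j : ℕ) < j₁ by omega)
    · obtain rfl : j₁ = j := Fin.ext (by omega)
      exact Or.inr ⟨rfl, hf.bkt_sorted h2 (by omega) h3 hbi⟩
  · intro t p hp
    rw [h4]
    rcases lt_or_ge t L.length with ht | ht
    · rw [List.getElem?_append_left ht] at hp
      obtain ⟨k', h1, h2, h3⟩ := h.visits t p hp
      rw [if_neg (by rw [h.length]; omega)]
      refine ⟨k', h1, h2, ?_⟩
      rw [hr0]
      -- If the same edge had been visited before, its statistic would be overwritten with the same
      -- value, so distinctness of the visits is not needed here.
      split_ifs with hkk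
      · obtain rfl : k' = k := Fin.ext hkk
        rw [hek] at h2
        obtain ⟨⟨hp12, -⟩, -⟩ := (h.mem p.1 p.2).1 (List.mem_of_getElem? hp)
        rcases Sym2.eq_iff.1 h2 with ⟨h5, h6⟩ | ⟨h5, h6⟩
        · rw [← v.injective h5, ← v.injective h6]
        · rw [← v.injective h5, ← v.injective h6] at hp12
          exact absurd hp12 hij.asymm
      · exact h3
    · rw [List.getElem?_append_right ht, List.getElem?_singleton] at hp
      split_ifs at hp with ht'
      obtain rfl : (i, j) = p := by simpa using hp
      rw [if_pos (by rw [h.length]; omega)]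
      exact ⟨k, rfl, hek, by rw [hr0, if_pos rfl]⟩
  · intro l
    rw [hr1, runSigns_append, ChordalSigns.visit]
    split_ifs with hl
    · obtain rfl : l = k := Fin.ext hl
      rw [hek, Function.update_self, SignType.coe_mul, SignType.coe_mul]
    · rw [Function.update_of_ne, h.signs]
      rw [← hek]
      exact fun h => hl (congrArg Fin.val (he h))

/-- The potential of the visits. -/
def visitPotential (st : Store) (s : Mem) : ℕ :=
  s.nvar 7 + ∑ t ∈ Finset.range (s.nvar 7), st.bsz (st.ord t) + (s.nvar 10 - s.nvar 9)

/-- The potential counts the buckets still to be opened in advance: opening one moves its size from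
the sum to the last term and lowers the position by one. -/
theorem exec_visits (h : Visiting G e Δ v st s L) (hf : Found G A st v) (hv : IsPEO G v)
    (he : Function.Injective fun k => s((e k).1, (e k).2)) :
    ∃ t s' L', Exec (minorTable Δ) (.loop searchTest visitBody) s t s' ∧
      t ≤ (visitBody.bound + searchTest.cost + 1) * (visitPotential st s + 1) ∧
      Visiting G e Δ v st s' L' ∧ IsVisitOrder G v L' := by
  obtain ⟨t, s', h1, h2, ⟨L', h3⟩, h4⟩ := Prog.exec_loop (minorTable Δ) searchTest visitBody
    visitBody_loopFree (fun s => ∃ L, Visiting G e Δ v st s L) (visitPotential st)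
    (fun s₁ ⟨L₁, h⟩ hb => by
      rw [searchTest_holds] at hb
      by_cases hr : s₁.nvar 9 < s₁.nvar 10
      · refine ⟨h.visit hf hv he hr, ?_⟩
        obtain ⟨h7, h9, h10, -⟩ := run_visitBody (minorTable Δ) hr rfl rfl rfl rfl
        unfold visitPotential
        rw [h7, h9, h10]
        omega
      · have hq := hb.resolve_right hr
        refine ⟨⟨L₁, h.next hf hr hq⟩, ?_⟩
        obtain ⟨h7, h9, h12, h10, -⟩ := run_visitBody_next (minorTable Δ) hr rfl
        unfold visitPotential
        rw [h7, h9, h10, h.ord, h.bsz]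
        obtain ⟨q, hq'⟩ : ∃ q, s₁.nvar 7 = q + 1 := ⟨s₁.nvar 7 - 1, by omega⟩
        rw [hq', Finset.sum_range_succ, Nat.add_sub_cancel]
        omega) s ⟨L, h⟩
  refine ⟨t, s', L', h1, h2, h3, fun i j => ?_, h3.sorted⟩
  rw [searchTest_holds] at h4
  rw [h3.mem, and_iff_left_iff_imp]
  rintro ⟨hij, hadj, hnf⟩
  have : (i : ℕ) < j := hij
  -- At the end the current position is `0`, and a larger endpoint `j` never has position `0`.
  left
  omega

end Visits


/-! ## The whole program -/

section Program

variable {N m : ℕ} {G : SimpleGraph (Fin N)} {e : Fin m → Fin N × Fin N}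

theorem initMem_fst (e : Fin m → Fin N × Fin N) (k : Fin m) :
    (initMem e).narr 0 k 0 = (e k).1 := by
  simp [initMem]

theorem initMem_snd (e : Fin m → Fin N × Fin N) (k : Fin m) :
    (initMem e).narr 1 k 0 = (e k).2 := by
  simp [initMem]

theorem initMem_narr_of_two_le (e : Fin m → Fin N × Fin N) {a : ℕ} (ha : 2 ≤ a) (x y : ℕ) :
    (initMem e).narr a x y = 0 := by
  simp only [initMem]
  split_ifs <;> first | rfl | omega

theorem initMem_nvar_of_two_le (e : Fin m → Fin N × Fin N) {x : ℕ} (hx : 2 ≤ x) :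
    (initMem e).nvar x = 0 := by
  simp only [initMem]
  split_ifs <;> first | rfl | omega

theorem sym2_val_eq_iff {a b c d : Fin N} :
    s((a : ℕ), (b : ℕ)) = s((c : ℕ), (d : ℕ)) ↔ s(a, b) = s(c, d) := by
  simp only [Sym2.eq_iff, Fin.ext_iff]

theorem IsEdgeList.adj (he : IsEdgeList G e) (k : Fin m) : G.Adj (e k).1 (e k).2 := by
  rw [← SimpleGraph.mem_edgeSet, ← he.2]
  exact ⟨k, rfl⟩

theorem IsEdgeList.edgeInput (he : IsEdgeList G e) :
    EdgeInput N m (fun k => (initMem e).narr 0 k 0) (fun k => (initMem e).narr 1 k 0) where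
  ea_lt k hk := (initMem_fst e ⟨k, hk⟩).trans_lt (Fin.is_lt _)
  eb_lt k hk := (initMem_snd e ⟨k, hk⟩).trans_lt (Fin.is_lt _)
  ne k hk h := by
    have h1 := initMem_fst e ⟨k, hk⟩
    have h2 := initMem_snd e ⟨k, hk⟩
    exact (he.adj ⟨k, hk⟩).ne (Fin.ext (h1.symm.trans (h.trans h2)))
  inj k hk k' hk' h := by
    have h1 := initMem_fst e ⟨k, hk⟩
    have h2 := initMem_snd e ⟨k, hk⟩
    have h3 := initMem_fst e ⟨k', hk'⟩
    have h4 := initMem_snd e ⟨k', hk'⟩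
    simp only at h1 h2 h3 h4
    rw [h1, h2, h3, h4, sym2_val_eq_iff] at h
    exact congrArg Fin.val (he.1 h)

/-- The endpoints of the edges in the input, as numbers. -/
def inputEnds (e : Fin m → Fin N × Fin N) (k : ℕ) : Sym2 ℕ :=
  s((initMem e).narr 0 k 0, (initMem e).narr 1 k 0)

theorem inputEnds_eq_iff (e : Fin m → Fin N × Fin N) (k : Fin m) (x y : Fin N) :
    inputEnds e k = s((x : ℕ), (y : ℕ)) ↔ s((e k).1, (e k).2) = s(x, y) := by
  rw [inputEnds, initMem_fst, initMem_snd, sym2_val_eq_iff]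

theorem IsEdgeList.arcs_iff (he : IsEdgeList G e) (x y : Fin N) :
    arcs (inputEnds e) m x y ↔ G.Adj x y := by
  rw [← SimpleGraph.mem_edgeSet, ← he.2]
  constructor
  · rintro ⟨k, hk, h⟩
    exact ⟨⟨k, hk⟩, (inputEnds_eq_iff e ⟨k, hk⟩ x y).1 h⟩
  · rintro ⟨k, h⟩
    exact ⟨k, k.2, (inputEnds_eq_iff e k x y).2 h⟩

theorem IsEdgeList.not_arcs_self (he : IsEdgeList G e) (x : ℕ) :
    ¬ arcs (inputEnds e) m x x := by
  rintro ⟨k, hk, h⟩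
  rcases Sym2.eq_iff.1 h with ⟨h1, h2⟩ | ⟨h1, h2⟩ <;>
    exact he.edgeInput.ne k hk (h1.trans h2.symm)

theorem visitInit_loopFree : visitInit.LoopFree := by
  simp [visitInit, Prog.LoopFree]

/-- The stages up to the marking of the forest. -/
theorem IsEdgeList.exec_prepare (he : IsEdgeList G e) (Δ : Finset (Fin N) → ℝ) :
    ∃ t₁ t₂ t₃ t₄ s₁ s₂ s₃ s₄ v,
      Exec (minorTable Δ) (.loop readTest readBody) (initMem e) t₁ s₁ ∧
      Exec (minorTable Δ) searchInit s₁ t₂ s₂ ∧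
      Exec (minorTable Δ) (.loop searchTest searchBody) s₂ t₃ s₃ ∧
      Exec (minorTable Δ) (.loop readTest markBody) s₃ t₄ s₄ ∧
      t₁ ≤ (readBody.bound + readTest.cost + 1) * (m + 1) ∧
      t₂ ≤ searchInit.bound ∧
      t₃ ≤ (searchBody.bound + searchTest.cost + 1) * (8 * m + 1) ∧
      t₄ ≤ (markBody.bound + readTest.cost + 1) * (m + 1) ∧
      Found G (arcs (inputEnds e) m) s₃.store v ∧ s₃.nvar 2 ≤ 2 * m ∧
      ∑ w ∈ Finset.range N, s₃.store.bsz w ≤ 8 * m ∧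
      (∀ x y, G.Adj x y → ∃ k : Fin m, s₄.narr 7 x y = k ∧ s((e k).1, (e k).2) = s(x, y)) ∧
      s₄.nvar 3 = 0 ∧
      (∀ k : Fin m, (s((e k).1, (e k).2) ∈ forestEdges G v → s₄.narr 3 k 0 = 1) ∧
        (s((e k).1, (e k).2) ∉ forestEdges G v → s₄.narr 3 k 0 = 0)) ∧
      ∀ k : Fin m, s₄.rarr 1 k 0 = (initSigns G v s((e k).1, (e k).2) : ℝ) := by
  classical
  obtain ⟨t₁, s₁, hs₁, ht₁, hl⟩ := exec_read he.edgeInput (s := initMem e) (minorTable Δ)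
    (by simp [initMem]) (fun _ _ => rfl) (fun _ _ => rfl) (initMem_nvar_of_two_le e le_rfl)
    (initMem_nvar_of_two_le e (by norm_num))
    (fun x => initMem_narr_of_two_le e (by norm_num) x 0)
  have hl' : Linked N m (inputEnds e) (arcs (inputEnds e) m) (2 * m) s₁ := hl
  have hv₁ : ∀ x, 2 ≤ x → (Prog.loop readTest readBody).KeepsVar x → s₁.nvar x = 0 :=
    fun x hx hk => (hs₁.nvar_eq hk).trans (initMem_nvar_of_two_le e hx)
  have ha₁ : ∀ a, 2 ≤ a → (Prog.loop readTest readBody).KeepsArr a → ∀ x, s₁.narr a x 0 = 0 :=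
    fun a ha hk x => by
      rw [hs₁.narr_eq hk]
      exact initMem_narr_of_two_le e ha x 0
  obtain ⟨t₂, ht₂, hs₂⟩ := searchInit.exec_run (minorTable Δ) searchInit_loopFree s₁
  obtain ⟨hse, hpot, hn, hn2⟩ := hl'.searching (minorTable Δ)
    (hv₁ 8 (by norm_num) (by simp [readBody, linkProg, Prog.KeepsVar]))
    (hv₁ 9 (by norm_num) (by simp [readBody, linkProg, Prog.KeepsVar]))
    (hv₁ 10 (by norm_num) (by simp [readBody, linkProg, Prog.KeepsVar]))
    (ha₁ 8 (by norm_num) (by simp [readBody, linkProg, Prog.KeepsArr]))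
    (ha₁ 10 (by norm_num) (by simp [readBody, linkProg, Prog.KeepsArr]))
    (ha₁ 11 (by norm_num) (by simp [readBody, linkProg, Prog.KeepsArr]))
    (ha₁ 13 (by norm_num) (by simp [readBody, linkProg, Prog.KeepsArr]))
  have h4 : (searchInit.run (minorTable Δ) s₁).nvar 4 = 0 := by
    simp [searchInit, Prog.run, NExp.eval]
  generalize searchInit.run (minorTable Δ) s₁ = s₂ at *
  have hadj : ∀ s : Mem, s.narr 5 = s₁.narr 5 → s.narr 6 = s₁.narr 6 →
      Adjacency N (arcs (inputEnds e) m) s.store.deg s.store.nbr := by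
    intro s h5 h6
    have e5 : s.store.deg = fun x => s₁.narr 5 x 0 := by
      rw [← h5]
      rfl
    have e6 : s.store.nbr = s₁.narr 6 := h6
    rw [e5, e6]
    exact hl'.adj
  have e5 : s₂.narr 5 = s₁.narr 5 := hs₂.narr_eq (by simp [searchInit, Prog.KeepsArr])
  have e6 : s₂.narr 6 = s₁.narr 6 := hs₂.narr_eq (by simp [searchInit, Prog.KeepsArr])
  obtain ⟨t₃, s₃, hs₃, ht₃, hse₃, hp₃, hr₃, hb₃⟩ := exec_search (minorTable Δ) hse
    (hadj s₂ e5 e6) (fun _ _ => arcs_symm) he.not_arcs_self hn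
  have hkv₃ : ∀ x, x < 5 → s₃.nvar x = s₂.nvar x := fun x hx => hs₃.nvar_eq (by
    simp [searchBody, touchProg, popProg, Prog.KeepsVar]
    omega)
  have hka₃ : ∀ a, (Prog.loop searchTest searchBody).KeepsArr a → s₃.narr a = s₂.narr a :=
    fun a ha => hs₃.narr_eq ha
  have f2 : s₂.nvar 2 = s₁.nvar 2 := hs₂.nvar_eq (by simp [searchInit, Prog.KeepsVar])
  have f1 : s₂.nvar 1 = s₁.nvar 1 := hs₂.nvar_eq (by simp [searchInit, Prog.KeepsVar])
  have f3 : s₂.nvar 3 = s₁.nvar 3 := hs₂.nvar_eq (by simp [searchInit, Prog.KeepsVar])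
  have g0 : s₃.narr 0 = (initMem e).narr 0 := by
    rw [hka₃ 0 (by simp [searchBody, touchProg, popProg, Prog.KeepsArr]),
      hs₂.narr_eq (by simp [searchInit, Prog.KeepsArr]),
      hs₁.narr_eq (by simp [readBody, linkProg, Prog.KeepsArr])]
  have g1 : s₃.narr 1 = (initMem e).narr 1 := by
    rw [hka₃ 1 (by simp [searchBody, touchProg, popProg, Prog.KeepsArr]),
      hs₂.narr_eq (by simp [searchInit, Prog.KeepsArr]),
      hs₁.narr_eq (by simp [readBody, linkProg, Prog.KeepsArr])]
  have g3 : s₃.narr 3 = (initMem e).narr 3 := by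
    rw [hka₃ 3 (by simp [searchBody, touchProg, popProg, Prog.KeepsArr]),
      hs₂.narr_eq (by simp [searchInit, Prog.KeepsArr]),
      hs₁.narr_eq (by simp [readBody, linkProg, Prog.KeepsArr])]
  have g5 : s₃.narr 5 = s₁.narr 5 := by
    rw [hka₃ 5 (by simp [searchBody, touchProg, popProg, Prog.KeepsArr]), e5]
  have g6 : s₃.narr 6 = s₁.narr 6 := by
    rw [hka₃ 6 (by simp [searchBody, touchProg, popProg, Prog.KeepsArr]), e6]
  have g7 : s₃.narr 7 = s₁.narr 7 := by
    rw [hka₃ 7 (by simp [searchBody, touchProg, popProg, Prog.KeepsArr]),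
      hs₂.narr_eq (by simp [searchInit, Prog.KeepsArr])]
  have gr : s₃.rarr 1 = (initMem e).rarr 1 := by
    rw [hs₃.rarr_eq (by simp [searchBody, touchProg, popProg, Prog.KeepsReal]),
      hs₂.rarr_eq (by simp [searchInit, Prog.KeepsReal]),
      hs₁.rarr_eq (by simp [readBody, linkProg, Prog.KeepsReal])]
  have hn₃ : s₃.store.n ≤ N := (hkv₃ 2 (by norm_num)).trans_le hn
  obtain ⟨v, hf⟩ := hse₃.exists_found (hadj s₃ g5 g6) (fun _ _ => arcs_symm) he.arcs_iff hp₃ hr₃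
    hn₃
  obtain ⟨t₄, s₄, hs₄, ht₄, hmark⟩ := exec_mark (m := m) (s := s₃) (minorTable Δ)
    (par := s₃.store.par) (pos := s₃.store.pos)
    (by
      rw [hkv₃ 1 (by norm_num), f1, hs₁.nvar_eq (by simp [readBody, linkProg, Prog.KeepsVar])]
      simp [initMem])
    (fun _ _ => rfl) (fun _ _ => rfl) (fun _ => rfl) (fun _ => rfl)
    ((hkv₃ 4 (by norm_num)).trans h4)
    (fun k => by rw [g3]; exact initMem_narr_of_two_le e (by norm_num) k 0)
    (fun k => by rw [gr]; rfl)
  have hfp : ∀ k : Fin m, ForestPair s₃.store.par s₃.store.pos (s₃.narr 0 k 0) (s₃.narr 1 k 0) ↔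
      s((e k).1, (e k).2) ∈ forestEdges G v := by
    intro k
    rw [g0, g1, initMem_fst, initMem_snd]
    exact hf.forestPair_iff (he.adj k)
  refine ⟨t₁, t₂, t₃, t₄, s₁, s₂, s₃, s₄, v, hs₁, hs₂, hs₃, hs₄, ht₁, ht₂,
    ht₃.trans (Nat.mul_le_mul_left _ (by omega)), ht₄, hf, ?_, hb₃.trans (by omega), ?_, ?_, ?_,
    ?_⟩
  · rw [hkv₃ 2 (by norm_num), f2]
    exact hn2
  · intro x y hxy
    obtain ⟨h1, h2⟩ := hl'.edge x y ((he.arcs_iff x y).2 hxy)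
    rw [hs₄.narr_eq (by simp [markBody, Prog.KeepsArr]), g7]
    exact ⟨⟨_, h1⟩, rfl, (inputEnds_eq_iff e ⟨_, h1⟩ x y).1 h2⟩
  · rw [hs₄.nvar_eq (by simp [markBody, Prog.KeepsVar]), hkv₃ 3 (by norm_num), f3]
    exact hv₁ 3 (by norm_num) (by simp [readBody, linkProg, Prog.KeepsVar])
  · intro k
    have h1 := (hmark k k.2).1
    rw [if_congr (hfp k) rfl rfl] at h1
    exact ⟨fun h => by rw [h1, if_pos h], fun h => by rw [h1, if_neg h]⟩
  · intro k
    have h1 := (hmark k k.2).2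
    rw [if_congr (hfp k) rfl rfl] at h1
    rw [h1, initSigns]
    by_cases h : s((e k).1, (e k).2) ∈ forestEdges G v <;> simp [h]

/-- A factor for the running time of the program. -/
def signsFactor : ℕ :=
  (readBody.bound + readTest.cost + 1) + searchInit.bound +
  8 * (searchBody.bound + searchTest.cost + 1) + (markBody.bound + readTest.cost + 1) +
  visitInit.bound + 10 * (visitBody.bound + searchTest.cost + 1)

theorem IsEdgeList.exec_signsProg (he : IsEdgeList G e) (hG : IsChordal G)
    (Δ : Finset (Fin N) → ℝ) :
    ∃ t s v L, Exec (minorTable Δ) signsProg (initMem e) t s ∧ t ≤ signsFactor * (m + 1) ∧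
      IsPEO G v ∧ IsVisitOrder G v L ∧ Holds s G e Δ v L := by
  obtain ⟨t₁, t₂, t₃, t₄, s₁, s₂, s₃, s₄, v, hs₁, hs₂, hs₃, hs₄, ht₁, ht₂, ht₃, ht₄, hf, hn, hb,
    hidx, h3, hmark, hsign⟩ := he.exec_prepare Δ
  obtain ⟨t₅, ht₅, hs₅⟩ := visitInit.exec_run (minorTable Δ) visitInit_loopFree s₄
  have hv := hf.isPEO hG
  have h7 : (visitInit.run (minorTable Δ) s₄).nvar 7 = s₄.nvar 2 := by
    simp [visitInit, Prog.run, NExp.eval]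
  have h9 : (visitInit.run (minorTable Δ) s₄).nvar 9 = 0 := by
    simp [visitInit, Prog.run, NExp.eval]
  have h10 : (visitInit.run (minorTable Δ) s₄).nvar 10 = 0 := by
    simp [visitInit, Prog.run, NExp.eval]
  generalize visitInit.run (minorTable Δ) s₄ = s₅ at *
  have ha₅ : s₅.narr = s₄.narr := funext fun a => hs₅.narr_eq (by simp [visitInit, Prog.KeepsArr])
  have hr₅ : s₅.rarr = s₄.rarr := funext fun a => hs₅.rarr_eq (by simp [visitInit, Prog.KeepsReal])
  have ha₄ : ∀ a, a ≠ 3 → s₄.narr a = s₃.narr a := fun a ha =>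
    hs₄.narr_eq (by simp [markBody, Prog.KeepsArr, ha])
  have h2 : s₄.nvar 2 = s₃.store.n := hs₄.nvar_eq (by simp [markBody, Prog.KeepsVar])
  have hvis : Visiting G e Δ v s₃.store s₅ [] := by
    refine ⟨?_, ?_, ?_, ?_, ?_, (h7.trans h2).le, Or.inl ⟨h7.trans h2, h9, h10⟩, ?_,
      List.Pairwise.nil, ?_, ?_, ?_⟩
    · intro t
      rw [ha₅, ha₄ 2 (by norm_num)]
      rfl
    · intro t
      rw [ha₅, ha₄ 12 (by norm_num)]
      rfl
    · intro t
      rw [ha₅, ha₄ 13 (by norm_num)]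
      rfl
    · rw [ha₅, ha₄ 14 (by norm_num)]
      rfl
    · rw [ha₅]
      exact hidx
    · intro i j
      refine iff_of_false List.not_mem_nil ?_
      rintro ⟨⟨-, hadj, -⟩, h⟩
      have := (hf.lt_iff j).2 ⟨_, hadj.symm⟩
      rw [h7, h2, h9] at h
      rcases h with h | ⟨h, -⟩ <;> omega
    · rw [hs₅.nvar_eq (by simp [visitInit, Prog.KeepsVar]), h3]
      rfl
    · intro t p hp
      simp at hp
    · intro k
      rw [hr₅, hsign]
      rfl
  obtain ⟨t₆, s₆, L, hs₆, ht₆, hvis₆, hL⟩ := exec_visits hvis hf hv he.1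
  have k2 : s₆.nvar 2 = s₃.store.n := by
    rw [hs₆.nvar_eq (by simp [visitBody, signProg, Prog.KeepsVar]),
      hs₅.nvar_eq (by simp [visitInit, Prog.KeepsVar]), h2]
  have k3 : s₆.narr 3 = s₄.narr 3 := by
    rw [hs₆.narr_eq (by simp [visitBody, signProg, Prog.KeepsArr]), ha₅]
  refine ⟨_, s₆, v, L, .seq hs₁ (.seq hs₂ (.seq hs₃ (.seq hs₄ (.seq hs₅ hs₆)))), ?_, hv, hL, ?_⟩
  · have hpot : visitPotential s₃.store s₅ ≤ 10 * m := by
      have h1 : ∑ t ∈ Finset.range s₃.store.n, s₃.store.bsz (s₃.store.ord t) ≤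
          ∑ w ∈ Finset.range N, s₃.store.bsz w := by
        have hord : ∀ t (ht : t < s₃.store.n), s₃.store.ord t = v ⟨t, ht.trans_le hf.n_le⟩ :=
          fun t ht => hf.ord_eq ⟨t, ht.trans_le hf.n_le⟩ ht
        -- Different positions hold different vertices, so no bucket is counted twice.
        rw [← Finset.sum_image (s := Finset.range s₃.store.n) (g := s₃.store.ord)]
        · refine Finset.sum_le_sum_of_subset fun x hx => ?_
          obtain ⟨t, ht, rfl⟩ := Finset.mem_image.1 hx
          rw [hord t (Finset.mem_range.1 ht)]
          exact Finset.mem_range.2 (Fin.is_lt _)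
        · intro t ht t' ht' heq
          rw [Finset.mem_coe, Finset.mem_range] at ht ht'
          rw [hord t ht, hord t' ht'] at heq
          exact congrArg Fin.val (v.injective (Fin.ext heq))
      unfold visitPotential
      rw [h7, h9, h10, h2]
      have h5 : s₃.store.n ≤ 2 * m := hn
      omega
    have ht₆' := ht₆.trans (Nat.mul_le_mul_left _ (Nat.succ_le_succ hpot))
    unfold signsFactor
    generalize readBody.bound + readTest.cost + 1 = c₁ at *
    generalize searchBody.bound + searchTest.cost + 1 = c₂ at *
    generalize markBody.bound + readTest.cost + 1 = c₃ at *
    generalize visitBody.bound + searchTest.cost + 1 = c₄ at *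
    generalize searchInit.bound = c₅ at *
    generalize visitInit.bound = c₆ at *
    have e1 : c₂ * (8 * m + 1) ≤ 8 * c₂ * (m + 1) := by nlinarith
    have e2 : c₄ * (10 * m).succ ≤ 10 * c₄ * (m + 1) := by
      rw [Nat.succ_eq_add_one]
      nlinarith
    have e3 : c₅ ≤ c₅ * (m + 1) := Nat.le_mul_of_pos_right _ (Nat.succ_pos m)
    have e4 : c₆ ≤ c₆ * (m + 1) := Nat.le_mul_of_pos_right _ (Nat.succ_pos m)
    simp only [Nat.add_mul]
    omega
  · refine ⟨?_, ?_, ?_, ?_, hvis₆.length, ?_, hvis₆.signs⟩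
    · rw [k2]
      exact hf.lt_iff
    · rw [k2]
      exact hf.n_le
    · rw [k2]
      intro t ht
      rw [hvis₆.ord, hf.ord_eq t ht]
    · rw [k3]
      exact hmark
    · intro t
      exact hvis₆.visits t _ (by simp)

end Program

end ChordalSigns

theorem mainTheorem7 :
    -- running time: one program and one constant for all inputs
    (∃ (P : ChordalSigns.Prog) (c : ℕ),
      ∀ (N m : ℕ) (K : Matrix (Fin N) (Fin N) ℝ) (e : Fin m → Fin N × Fin N)
        (Δ : Finset (Fin N) → ℝ),
        K.IsSymm →
        ChordalSigns.IsChordal (ChordalSigns.inducedGraph K) →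
        ChordalSigns.IsEdgeList (ChordalSigns.inducedGraph K) e →
        ∃ (t : ℕ) (s : ChordalSigns.Mem) (v : Fin N ≃ Fin N) (L : List (Fin N × Fin N)),
          ChordalSigns.Exec (ChordalSigns.minorTable Δ) P (ChordalSigns.initMem e) t s ∧
          t ≤ c * (m + 1) ∧
          ChordalSigns.IsPEO (ChordalSigns.inducedGraph K) v ∧
          ChordalSigns.IsVisitOrder (ChordalSigns.inducedGraph K) v L ∧
          ChordalSigns.Holds s (ChordalSigns.inducedGraph K) e Δ v L) ∧
    -- correctness of every execution
    (∀ (N : ℕ) (K : Matrix (Fin N) (Fin N) ℝ) (α : ℝ) (Δ : Finset (Fin N) → ℝ)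
        (v : Fin N ≃ Fin N) (L : List (Fin N × Fin N)),
        ChordalSigns.IsKernel K →
        0 < α → α < 1 →
        ChordalSigns.Separated K α →
        ChordalSigns.Accurate K α Δ →
        ChordalSigns.IsChordal (ChordalSigns.inducedGraph K) →
        ChordalSigns.IsPEO (ChordalSigns.inducedGraph K) v →
        ChordalSigns.IsVisitOrder (ChordalSigns.inducedGraph K) v L →
        ChordalSigns.IsSpanningForest
          (SimpleGraph.fromEdgeSet (ChordalSigns.forestEdges (ChordalSigns.inducedGraph K) v))
          (ChordalSigns.inducedGraph K) ∧
        ChordalSigns.SignsRecovered K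
          (ChordalSigns.runSigns (ChordalSigns.inducedGraph K) v Δ L)) := by
  refine ⟨⟨ChordalSigns.signsProg, ChordalSigns.signsFactor,
    fun N m K e Δ _ hG he => he.exec_signsProg hG Δ⟩, ?_⟩
  intro N K α Δ v L hK hα hα1 hs hΔ _ hv hL
  exact ⟨hv.isSpanningForest, hL.signsRecovered hK hα hα1 hs hΔ hv⟩
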